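/- Let $k,l\ge 1$, $n=k+l$, let $\tau_1=\dots=\tau_k=1$, $\tau_{k+1}=\dots=\tau_n=-1$ and $\langle x,y\rangle=\sum_i\tau_ix_iy_i$ on $\mathbb R^n$. Let $J=\mathrm{diag}(J_1,\dots,J_n)$ with $J_i\neq0$ and $J_i^2\neq J_j^2$ for $i\ne j$, let $\kappa>0$, and put $$M_\kappa=\{(q,Q)\in\mathbb R^n\times\mathbb R^n : \langle q,q\rangle=\langle Q,Q\rangle=0,\ \langle J^{-1}Q,q\rangle\neq0,\ \langle q,JQ\rangle=\pm\kappa\},\qquad \alpha=\sum_i\tau_iJ_iQ_i\,dq_i .$$ Consider the Heisenberg model on the light-like cone, i.e. the map $\Phi(q,Q)=(Q,\lambda J^{-1}Q-q)$, $\lambda=2\langle J^{-1}Q,q\rangle/\langle J^{-2}Q,Q\rangle$, defined where $\langle J^{-2}Q,Q\rangle\ne0$, and the functions $$f_i(q,Q)=\sum_{j\ne i}\frac{\tau_i\tau_j(J_jQ_jq_i-q_jJ_iQ_i)^2}{J_i^2-J_j^2},\qquad i=1,\dots,n.$$ Then $\Phi$ is a completely integrable contact transformation of $(M_\kappa,\alpha)$,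 in the following sense. 1. $M_\kappa$ is a smooth $(2n-3)$-dimensional submanifold, $\alpha|_{M_\kappa}$ is a contact form, and $\Phi$ restricts to a diffeomorphism of $M_\kappa\cap\{\langle J^{-2}Q,Q\rangle\neq0\}$ onto $M_\kappa\cap\{\langle J^{-2}q,q\rangle\neq0\}$ with $\Phi^*\alpha=\alpha$ and $f_i\circ\Phi=f_i$ for all $i$. 2. The Reeb field $Z$ of $(M_\kappa,\alpha)$ ($i_Z\alpha=1$, $i_Zd\alpha=0$) and the contact Hamiltonian vector fields $Y_{f_i}$ (the contact vector fields with $i_{Y_{f_i}}\alpha=f_i$) exist, and for all $i,j$ one has on $M_\kappa$: $\mathcal L_Zf_i=0$, $[Z,Y_{f_i}]=0$, the Jacobi bracket $[f_i,f_j]=\mathcal L_{Y_{f_i}}f_j-f_j\mathcal L_Zf_i$ vanishes, and $[Y_{f_i},Y_{f_j}]=0$. 3. Let $U\subset M_\kappa$ be the set of points at which the differentials of the functions $f_1|_{M_\kappa},\dots,f_n|_{M_\kappa}$ span a space of dimension $n-2$. Then $U$ is open and dense in $M_\kappa$, its complement in $M_\kappa$ has $(2n-3)$-dimensional Hausdorff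 measure zero, and there are $n-2$ of the functions $f_i$ whose restrictions to $M_\kappa$ have linearly independent differentials at every point of $U$. 4. Every level set $N_c=\{p\in U : f_i(p)=c_i,\ i=1,\dots,n\}$ is empty or a smooth $(n-1)$-dimensional submanifold with tangent spaces spanned by $Z,Y_{f_1},\dots,Y_{f_n}$, and it is invariant: $\Phi$ maps $N_c\cap\{\langle J^{-2}Q,Q\rangle\neq0\}$ bijectively onto $N_c\cap\{\langle J^{-2}q,q\rangle\neq0\}$. 5. The distribution $\mathcal F$ on $U$ spanned by the commuting contact fields $Z,Y_{f_1},\dots,Y_{f_n}$ has rank $n-1$ and is pre-Legendrian: it is integrable and transversal to $\mathcal H=\ker\alpha|_{M_\kappa}$, and $\mathcal G=\mathcal F\cap\mathcal H$ is a maximal integrable (Legendrian) subdistribution of $\mathcal H$, that is, $\mathcal G$ is integrable, $d\alpha|_{\mathcal G}=0$ and $2\operatorname{rank}\mathcal G=\operatorname{rank}\mathcal H$. -/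

import Mathlib

open scoped ContDiff MeasureTheory

noncomputable section

namespace HeisenbergContact

section Geometry

/-! ### Submanifolds, forms and vector fields in a finite-dimensional vector space -/

variable {E : Type*} [NormedAddCommGroup E] [NormedSpace ℝ E]

/-- `M` is a smooth embedded submanifold of `E` of dimension `d` (without boundary): near each of
its points it is the zero set of a smooth submersion to `ℝ ^ m`, where `d + m = dim E`. -/
def IsSmoothSubmanifold (d : ℕ) (M : Set E) : Prop :=
  ∀ p ∈ M, ∃ (m : ℕ) (W : Set E) (F : E → (Fin m → ℝ)),
    d + m = Module.finrank ℝ E ∧ IsOpen W ∧ p ∈ W ∧ ContDiffOn ℝ ∞ F W ∧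
    (∀ x ∈ W, Function.Surjective (fderiv ℝ F x)) ∧ M ∩ W = {x ∈ W | F x = 0}

/-- The tangent space `T_p M` of a submanifold `M ⊆ E`, as a linear subspace of `E`. -/
def tangentAt (M : Set E) (p : E) : Submodule ℝ E :=
  Submodule.span ℝ (tangentConeAt ℝ M p)

/-- The differential at `p` of a function on `M`, as a linear form on `T_p M`.  (The derivative
within `M` is uniquely determined on tangent vectors.) -/
def differentialOn (M : Set E) (f : E → ℝ) (p : E) : tangentAt M p →ₗ[ℝ] ℝ :=
  (fderivWithin ℝ f M p).toLinearMap.domRestrict (tangentAt M p)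

/-- The exterior derivative `dα` of a 1-form `α` on `E`, evaluated on two vectors. -/
def dForm (α : E → E →L[ℝ] ℝ) (p u v : E) : ℝ :=
  extDeriv (fun x => ContinuousAlternatingMap.ofSubsingleton ℝ E ℝ (0 : Fin 1) (α x)) p ![u, v]

/-- The horizontal space `H_p = ker α|_{T_p M}`. -/
def horizontalAt (M : Set E) (α : E → E →L[ℝ] ℝ) (p : E) : Submodule ℝ E :=
  tangentAt M p ⊓ LinearMap.ker (α p).toLinearMap

/-- The restriction of `α` to `M` is a contact form: it does not vanish at any point and `dα` is
nondegenerate on the horizontal distribution. -/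
def IsContactFormOn (M : Set E) (α : E → E →L[ℝ] ℝ) : Prop :=
  ∀ p ∈ M, (∃ v ∈ tangentAt M p, α p v ≠ 0) ∧
    ∀ u ∈ horizontalAt M α p, (∀ v ∈ horizontalAt M α p, dForm α p u v = 0) → u = 0

/-- `Y` is (on `M`) a smooth vector field on `M`, tangent to `M`. -/
def IsVectorFieldOn (M : Set E) (Y : E → E) : Prop :=
  ContDiffOn ℝ ∞ Y M ∧ ∀ p ∈ M, Y p ∈ tangentAt M p

/-- The Lie derivative on `M` of a function `f` along the vector field `Y`. -/
def lieDerivFun (M : Set E) (Y : E → E) (f : E → ℝ) (p : E) : ℝ :=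
  fderivWithin ℝ f M p (Y p)

/-- The Lie derivative `𝓛_Y α = i_Y dα + d (i_Y α)` on `M` of a 1-form `α`, evaluated on a tangent
vector `v`. -/
def lieDerivForm (M : Set E) (Y : E → E) (α : E → E →L[ℝ] ℝ) (p v : E) : ℝ :=
  dForm α p (Y p) v + fderivWithin ℝ (fun x => α x (Y x)) M p v

/-- `Y` is a contact vector field on `(M, α)`: `𝓛_Y α = μ α` for some smooth function `μ`. -/
def IsContactField (M : Set E) (α : E → E →L[ℝ] ℝ) (Y : E → E) : Prop :=
  IsVectorFieldOn M Y ∧ ∃ μ : E → ℝ, ContDiffOn ℝ ∞ μ M ∧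
    ∀ p ∈ M, ∀ v ∈ tangentAt M p, lieDerivForm M Y α p v = μ p * α p v

/-- `Z` is the Reeb vector field of `(M, α)`: `i_Z α = 1` and `i_Z dα = 0`. -/
def IsReebField (M : Set E) (α : E → E →L[ℝ] ℝ) (Z : E → E) : Prop :=
  IsVectorFieldOn M Z ∧ ∀ p ∈ M, α p (Z p) = 1 ∧ ∀ v ∈ tangentAt M p, dForm α p (Z p) v = 0

/-- `Y` is the contact Hamiltonian vector field on `(M, α)` with Hamiltonian function `f`: the
contact vector field with `i_Y α = f`. -/
def IsContactHamiltonianField (M : Set E) (α : E → E →L[ℝ] ℝ) (f : E → ℝ) (Y : E → E) : Prop :=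
  IsContactField M α Y ∧ ∀ p ∈ M, α p (Y p) = f p

/-- The Jacobi bracket `[f, g] = 𝓛_{Y_f} g - g 𝓛_Z f` on `M`, where `Z` is the Reeb field and `Yf`
is the contact Hamiltonian vector field of `f`. -/
def jacobiBracket (M : Set E) (Z Yf : E → E) (f g : E → ℝ) (p : E) : ℝ :=
  lieDerivFun M Yf g p - g p * lieDerivFun M Z f p

/-- The vector fields `X` and `Y` on `M` commute. -/
def CommuteOn (M : Set E) (X Y : E → E) : Prop :=
  ∀ p ∈ M, VectorField.lieBracketWithin ℝ X Y M p = 0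

/-- The distribution `D` is integrable (involutive) on `M`: the Lie bracket of any two smooth
vector fields on `M` with values in `D` has values in `D`. -/
def IsInvolutiveOn (M : Set E) (D : E → Submodule ℝ E) : Prop :=
  ∀ X Y : E → E, ContDiffOn ℝ ∞ X M → ContDiffOn ℝ ∞ Y M →
    (∀ p ∈ M, X p ∈ D p) → (∀ p ∈ M, Y p ∈ D p) →
    ∀ p ∈ M, VectorField.lieBracketWithin ℝ X Y M p ∈ D p

/-- The distribution `D` on the contact manifold `(M, α)` is pre-Legendrian (co-Legendrian): it is
integrable and transversal to the horizontal distribution `H`, and `G = D ∩ H` is a maximal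
integrable (that is, Legendrian) subdistribution of `H`. -/
structure IsPreLegendrian (M : Set E) (α : E → E →L[ℝ] ℝ) (D : E → Submodule ℝ E) : Prop where
  tangent : ∀ p ∈ M, D p ≤ tangentAt M p
  integrable : IsInvolutiveOn M D
  transversal : ∀ p ∈ M, D p ⊔ horizontalAt M α p = tangentAt M p
  integrable_inf : IsInvolutiveOn M (fun p => D p ⊓ horizontalAt M α p)
  isotropic : ∀ p ∈ M, ∀ u ∈ D p ⊓ horizontalAt M α p, ∀ v ∈ D p ⊓ horizontalAt M α p,
    dForm α p u v = 0
  half_dim : ∀ p ∈ M, 2 * Module.finrank ℝ ↥(D p ⊓ horizontalAt M α p) =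
    Module.finrank ℝ ↥(horizontalAt M α p)

/-- `Φ`, defined on the relatively open subset `D` of `(M, α)`, is a contact transformation
(preserving the contact form) onto the relatively open subset `D'` of `M`: it is a diffeomorphism
from `D` to `D'` and `Φ^* α = α`. -/
structure IsContactTransformation (M : Set E) (α : E → E →L[ℝ] ℝ) (D D' : Set E) (Φ : E → E) :
    Prop where
  open_source : ∃ O, IsOpen O ∧ D = M ∩ O
  open_target : ∃ O, IsOpen O ∧ D' = M ∩ O
  smooth : ContDiffOn ℝ ∞ Φ D
  bijOn : Set.BijOn Φ D D'
  smooth_inv : ∃ Ψ : E → E, ContDiffOn ℝ ∞ Ψ D' ∧ Set.InvOn Ψ Φ D D'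
  pullback : ∀ p ∈ D, ∀ v ∈ tangentAt D p,
    fderivWithin ℝ Φ D p v ∈ tangentAt M (Φ p) ∧
    α (Φ p) (fderivWithin ℝ Φ D p v) = α p v

/-- The rank at `p` of the differentials of the functions `f i` on `M`. -/
def rankAt {ι : Type*} (M : Set E) (f : ι → E → ℝ) (p : E) : ℕ :=
  Module.finrank ℝ ↥(Submodule.span ℝ (Set.range fun i => differentialOn M (f i) p))

end Geometry

section Model

/-! ### The Heisenberg model on the light-like cone in `E^{k,l}` -/

variable {k l : ℕ}

/-- The vector space `E^{k,l} × E^{k,l}`, with points `(q, Q)`. -/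
abbrev Phase (k l : ℕ) : Type := (Fin (k + l) → ℝ) × (Fin (k + l) → ℝ)

/-- The signs `τ_i`: the first `k` are `1` and the last `l` are `-1`. -/
def sgn (k l : ℕ) (i : Fin (k + l)) : ℝ := if (i : ℕ) < k then 1 else -1

/-- The pseudo-Euclidean scalar product `⟨x, y⟩` of signature `(k, l)`. -/
def ip (x y : Fin (k + l) → ℝ) : ℝ := ∑ i, sgn k l i * x i * y i

/-- The discrete Lagrangian `L(q, Q) = ⟨q, J Q⟩`, where `J = diag (J_1, …, J_n)`. -/
def lagrangian (J : Fin (k + l) → ℝ) (p : Phase k l) : ℝ := ip p.1 (J * p.2)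

/-- The function `K(q, Q) = ⟨J⁻¹ Q, q⟩`. -/
def integralK (J : Fin (k + l) → ℝ) (p : Phase k l) : ℝ := ip (J⁻¹ * p.2) p.1

/-- The 1-form `α = ∑ τ_i J_i Q_i dq_i`. -/
def alpha (J : Fin (k + l) → ℝ) (p : Phase k l) : Phase k l →L[ℝ] ℝ :=
  ∑ i, (sgn k l i * J i * p.2 i) •
    (ContinuousLinearMap.proj i).comp (ContinuousLinearMap.fst ℝ (Fin (k + l) → ℝ) _)

/-- The variety `M_κ`: both `q` and `Q` are on the light-like cone, `⟨J⁻¹ Q, q⟩ ≠ 0`, and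
`⟨q, J Q⟩ = ± κ`. -/
def contactVariety (J : Fin (k + l) → ℝ) (κ : ℝ) : Set (Phase k l) :=
  {p | ip p.1 p.1 = 0 ∧ ip p.2 p.2 = 0 ∧ integralK J p ≠ 0 ∧
    (lagrangian J p = κ ∨ lagrangian J p = -κ)}

/-- The map `Φ(q, Q) = (Q, λ J⁻¹ Q - q)` with `λ = 2 ⟨J⁻¹ Q, q⟩ / ⟨J⁻² Q, Q⟩`, to be considered
where `⟨J⁻² Q, Q⟩ ≠ 0`. -/
def heisenbergMap (J : Fin (k + l) → ℝ) (p : Phase k l) : Phase k l :=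
  (p.2, (2 * ip (J⁻¹ * p.2) p.1 / ip (J⁻¹ ^ 2 * p.2) p.2) • (J⁻¹ * p.2) - p.1)

/-- The part of `M_κ` where `Φ` is defined: `⟨J⁻² Q, Q⟩ ≠ 0`. -/
def mapSource (J : Fin (k + l) → ℝ) (κ : ℝ) : Set (Phase k l) :=
  contactVariety J κ ∩ {p | ip (J⁻¹ ^ 2 * p.2) p.2 ≠ 0}

/-- The part of `M_κ` where `Φ⁻¹` is defined: `⟨J⁻² q, q⟩ ≠ 0`. -/
def mapTarget (J : Fin (k + l) → ℝ) (κ : ℝ) : Set (Phase k l) :=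
  contactVariety J κ ∩ {p | ip (J⁻¹ ^ 2 * p.1) p.1 ≠ 0}

/-- The integrals `f_i`, in the light-like case `c = 0`. -/
def integralF (J : Fin (k + l) → ℝ) (i : Fin (k + l)) (p : Phase k l) : ℝ :=
  ∑ j ∈ Finset.univ.erase i,
    sgn k l i * sgn k l j * (J j * p.2 j * p.1 i - p.1 j * J i * p.2 i) ^ 2 / (J i ^ 2 - J j ^ 2)

/-- The regular set of the integrals on `M_κ`: the points where the differentials of the
restrictions of the `f_i` to `M_κ` have rank `n - 2`. -/
def regularSet (J : Fin (k + l) → ℝ) (κ : ℝ) : Set (Phase k l) :=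
  {p ∈ contactVariety J κ | rankAt (contactVariety J κ) (integralF J) p = k + l - 2}

/-- The regular level set `f_i = c_i`, `i = 1, …, n`. -/
def regularLevel (J : Fin (k + l) → ℝ) (κ : ℝ) (c : Fin (k + l) → ℝ) : Set (Phase k l) :=
  {p ∈ regularSet J κ | ∀ i, integralF J i p = c i}

end Model

end HeisenbergContact

end

/-! Everything rests on the ambient symplectic form `ω = dα`, a constant form on the vector space.
Locally `M_κ` is a level set of `⟨q,q⟩`, `⟨Q,Q⟩` and `L = ⟨q,JQ⟩`. Pairing with `q`, `Q`, `J⁻¹q`,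
`J⁻¹Q` and using `L ≠ 0`, `K = ⟨J⁻¹Q,q⟩ ≠ 0` gives the independence of these constraints and the
nondegeneracy of `ω` on the horizontal spaces (`eq_zero_of_omega_horizontal_eq_zero`).

The integrals are quadratic in `Q` and invariant under the scaling `(q,-Q)`, which generates the
Reeb field, and under the shear `(0,J⁻¹q)`. Hence the Hamiltonian field of `f_i`, corrected by a
multiple of the shear and by `-f_i Z`, is tangent to `M_κ` and is the contact Hamiltonian field; it
preserves `α`. Involution of the `f_i` for `ω` is a partial fraction identity
(`fderiv_integralF_hamField`), and commutation of the fields follows from nondegeneracy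
(`lieBracketWithin_eq_zero_of_omega_eq_zero`). The map `Φ` is an exchange of `q` and `Q` followed by
a reflection; it preserves the angular momenta up to an exchange of `q` and `Q`, which on the cone
does not change the `f_i`.

Two relations, `∑ f_i = 0` and `∑ J_i² f_i = -L²` on the cone, bound the rank by `n - 2` and let any
`n - 2` of the integrals generate the others. For the lower bound put `A = ∑ τ q_i²/(x - J_i²)`, `B
= ∑ τ (J_iQ_i)²/(x - J_i²)` and `C = ∑ τ q_i J_iQ_i/(x - J_i²)`. Then `∑ f_i/(x - J_i²) = AB - C²`.
If the numerators of `A` and `C` are coprime, a variation of `Q` alone which fixes all `f_i` is a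
multiple of the shear (`exists_eq_smul_of_fderiv_integralF_eq_zero`), and a dimension count gives
rank `n - 2` (`linearIndependent_frame_of_isCoprime`). Coprimality occurs in every open piece of
`M_κ`: fix `q`, and move `Q` away from the zeros of finitely many nonzero complex linear forms, one
for each root of `A` (`exists_mem_contactVariety_isCoprime`). Density follows, and analyticity of a
determinant gives full measure.

At regular points the common kernel `frameKer` of the differentials of the constraints and integrals
has dimension `n - 1`, contains the commuting fields and is spanned by them. It is the tangent space
of the level sets and is isotropic for `ω`, which yields the pre-Legendrian property. -/

noncomputable section
namespace HeisenbergContact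

/-! ### Regular level sets: charts and tangent spaces. -/

section LevelSets

open Filter Topology

variable {E : Type*} [NormedAddCommGroup E] [NormedSpace ℝ E]

theorem surjective_pi_of_linearIndependent {ι : Type*} [Fintype ι] {L : ι → E →L[ℝ] ℝ}
    (hL : LinearIndependent ℝ L) : Function.Surjective (ContinuousLinearMap.pi L) := by
  classical
  by_contra hns
  have hlt : LinearMap.range (ContinuousLinearMap.pi L).toLinearMap < ⊤ := by
    rw [lt_top_iff_ne_top]
    intro h
    exact hns (LinearMap.range_eq_top.1 h)
  obtain ⟨φ, hφ, hle⟩ := Submodule.exists_le_ker_of_lt_top _ hlt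
  apply hφ
  have hsum : ∀ x : ι → ℝ, φ x = ∑ i, x i * φ (Pi.single i 1) := by
    intro x
    conv_lhs => rw [pi_eq_sum_univ' x]
    rw [map_sum]
    refine Finset.sum_congr rfl fun i _ => ?_
    rw [map_smul, smul_eq_mul]
  have h0 : ∑ i, φ (Pi.single i 1) • L i = 0 := by
    ext v
    have := hle (LinearMap.mem_range_self (ContinuousLinearMap.pi L).toLinearMap v)
    rw [LinearMap.mem_ker, hsum] at this
    simpa [mul_comm] using this
  have := Fintype.linearIndependent_iff.1 hL _ h0
  ext i
  simpa using this i

/-- Inverse function theorem for `x ↦ (F x, P (x - p))`, where `P` is a linear projection onto `ker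
F'(p)`: the chart `ψ` is the local inverse restricted to the slice `{F p} × ℝ ^ d`. The order `n` is
left free because tangent spaces need `∞` and the measure estimate needs `ω`. -/
theorem exists_levelSet_chart [FiniteDimensional ℝ E] {G : Type*} [NormedAddCommGroup G]
    [NormedSpace ℝ G] [FiniteDimensional ℝ G] {n : ℕ∞ω} (hn : n ≠ 0) {d : ℕ} {F : E → G} {p : E}
    (hF : ContDiffAt ℝ n F p) (hs : Function.Surjective (fderiv ℝ F p))
    (hd : d + Module.finrank ℝ G = Module.finrank ℝ E) :
    ∃ (ψ : (Fin d → ℝ) → E) (P : E → Fin d → ℝ), ContDiffAt ℝ n ψ 0 ∧ ψ 0 = p ∧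
      (∀ᶠ t in 𝓝 0, F (ψ t) = F p) ∧ ContinuousAt P p ∧ P p = 0 ∧
      (∀ᶠ x in 𝓝 p, F x = F p → ψ (P x) = x) ∧
      ∀ v, fderiv ℝ F p v = 0 → ∃ w, fderiv ℝ ψ 0 w = v := by
  have : CompleteSpace E := FiniteDimensional.complete ℝ E
  have : CompleteSpace G := FiniteDimensional.complete ℝ G
  set f' := fderiv ℝ F p with hf'
  set K := LinearMap.ker f'.toLinearMap with hK
  have hKd : Module.finrank ℝ K = Module.finrank ℝ (Fin d → ℝ) := by
    have h1 := LinearMap.finrank_range_add_finrank_ker f'.toLinearMap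
    have h2 : LinearMap.range f'.toLinearMap = ⊤ := LinearMap.range_eq_top.2 hs
    rw [h2, finrank_top] at h1
    rw [Module.finrank_fin_fun, hK]
    omega
  obtain ⟨g, hg⟩ := LinearMap.exists_leftInverse_of_injective K.subtype (by simp)
  let eK : K ≃ₗ[ℝ] (Fin d → ℝ) := LinearEquiv.ofFinrankEq _ _ hKd
  let Pl : E →L[ℝ] (Fin d → ℝ) := LinearMap.toContinuousLinearMap (eK.toLinearMap ∘ₗ g)
  let A : E →ₗ[ℝ] G × (Fin d → ℝ) := (f'.prod Pl).toLinearMap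
  have hA : Function.Injective A := by
    rw [← LinearMap.ker_eq_bot, LinearMap.ker_eq_bot']
    intro v hv
    have h1 : f' v = 0 := congrArg Prod.fst hv
    have h2 : Pl v = 0 := congrArg Prod.snd hv
    have h3 : g v = 0 := by
      have : eK (g v) = 0 := h2
      simpa using this
    have h4 := LinearMap.congr_fun hg ⟨v, h1⟩
    simp only [LinearMap.comp_apply, Submodule.subtype_apply, LinearMap.id_apply] at h4
    rw [h3] at h4
    exact (congrArg Subtype.val h4).symm
  let Ae : E ≃L[ℝ] G × (Fin d → ℝ) :=
    (LinearEquiv.ofInjectiveOfFinrankEq A hA (by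
      rw [Module.finrank_prod, Module.finrank_fin_fun]; omega)).toContinuousLinearEquiv
  have hAe : (Ae : E →L[ℝ] G × (Fin d → ℝ)) = f'.prod Pl := by ext v <;> rfl
  let Ξ : E → G × (Fin d → ℝ) := fun x => (F x, Pl (x - p))
  have hΞ : ContDiffAt ℝ n Ξ p :=
    hF.prodMk (Pl.contDiff.contDiffAt.comp p (contDiffAt_id.sub contDiffAt_const))
  have hΞp : Ξ p = (F p, 0) := by simp [Ξ]
  have hΞ' : HasFDerivAt Ξ (Ae : E →L[ℝ] G × (Fin d → ℝ)) p := by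
    rw [hAe]
    refine HasFDerivAt.prodMk (hF.differentiableAt hn).hasFDerivAt ?_
    have h1 : HasFDerivAt (fun x => x - p) (ContinuousLinearMap.id ℝ E) p :=
      (hasFDerivAt_id p).sub_const p
    simpa using Pl.hasFDerivAt.comp p h1
  let e := hΞ.toOpenPartialHomeomorph Ξ hΞ' hn
  have hpe : p ∈ e.source := hΞ.mem_toOpenPartialHomeomorph_source hΞ' hn
  have hcoe : ∀ x, e x = Ξ x := fun x => rfl
  have hpt : (F p, (0 : Fin d → ℝ)) ∈ e.target := by
    rw [← hΞp]; exact hΞ.image_mem_toOpenPartialHomeomorph_target hΞ' hn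
  have hes : e.symm (F p, 0) = p := by rw [← hΞp, ← hcoe]; exact e.left_inv hpe
  have hsymm : ContDiffAt ℝ n e.symm (F p, (0 : Fin d → ℝ)) := by
    apply e.contDiffAt_symm hpt
    · rw [hes]; exact hΞ'
    · rw [hes]; exact hΞ
  have hsymm' : HasFDerivAt e.symm (Ae.symm : G × (Fin d → ℝ) →L[ℝ] E) (F p, (0 : Fin d → ℝ)) := by
    apply e.hasFDerivAt_symm hpt
    rw [hes]; exact hΞ'
  let j : (Fin d → ℝ) → G × (Fin d → ℝ) := fun t => (F p, t)
  have hj : HasFDerivAt j (ContinuousLinearMap.inr ℝ G (Fin d → ℝ)) 0 :=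
    hasFDerivAt_prodMk_right _ _
  refine ⟨fun t => e.symm (j t), fun x => Pl (x - p), ?_, hes, ?_, ?_, by simp, ?_, ?_⟩
  · exact ContDiffAt.comp (g := e.symm) (f := j) 0 hsymm (contDiffAt_const.prodMk contDiffAt_id)
  · have hjc : ContinuousAt j 0 := hj.continuousAt
    filter_upwards [hjc.eventually (e.open_target.mem_nhds hpt)] with t ht
    exact congrArg Prod.fst (e.right_inv ht)
  · fun_prop
  · filter_upwards [e.open_source.mem_nhds hpe] with x hx hFx
    have : j (Pl (x - p)) = e x := by rw [hcoe]; simp [j, Ξ, hFx]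
    simp only [this]
    exact e.left_inv hx
  · intro v hv
    refine ⟨Pl v, ?_⟩
    have h1 : HasFDerivAt (fun t => e.symm (j t)) _ 0 :=
      HasFDerivAt.comp (g := e.symm) (0 : Fin d → ℝ) hsymm' hj
    rw [h1.fderiv]
    have h2 : Ae v = (0, Pl v) := by
      have : Ae v = (f' v, Pl v) := rfl
      rw [this, hv]
    simp only [ContinuousLinearMap.comp_apply, ContinuousLinearMap.inr_apply]
    rw [← h2]
    exact Ae.symm_apply_apply v

/-- A submanifold of positive codimension is not a set of unique differentiability, but derivatives
within it still agree on the tangent cone, hence on its span. -/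
theorem unique_fderivWithin_of_mem_tangentAt {F : Type*} [NormedAddCommGroup F] [NormedSpace ℝ F]
    {M : Set E} {p : E} {f : E → F} {f₁ f₂ : E →L[ℝ] F} (h₁ : HasFDerivWithinAt f f₁ M p)
    (h₂ : HasFDerivWithinAt f f₂ M p) {v : E} (hv : v ∈ tangentAt M p) : f₁ v = f₂ v :=
  LinearMap.eqOn_span (f := f₁.toLinearMap) (g := f₂.toLinearMap) (h₁.unique_on h₂) hv

theorem fderivWithin_apply_of_mem_tangentAt {F : Type*} [NormedAddCommGroup F] [NormedSpace ℝ F]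
    {M : Set E} {p : E} {f : E → F} (hf : DifferentiableAt ℝ f p) {v : E}
    (hv : v ∈ tangentAt M p) : fderivWithin ℝ f M p v = fderiv ℝ f p v :=
  unique_fderivWithin_of_mem_tangentAt
    hf.differentiableWithinAt.hasFDerivWithinAt hf.hasFDerivAt.hasFDerivWithinAt hv

theorem fderivWithin_apply_eq_zero_of_const {F : Type*} [NormedAddCommGroup F] [NormedSpace ℝ F]
    {M : Set E} {p : E} {f : E → F} {f' : E →L[ℝ] F} {c : F} (hp : p ∈ M)
    (hf : HasFDerivWithinAt f f' M p) (hc : ∀ x ∈ M, f x = c) {v : E}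
    (hv : v ∈ tangentAt M p) : f' v = 0 := by
  have h2 : HasFDerivWithinAt f (0 : E →L[ℝ] F) M p :=
    (hasFDerivWithinAt_const c p M).congr hc (hc p hp)
  simpa using unique_fderivWithin_of_mem_tangentAt hf h2 hv

theorem tangentAt_inter_open {M O : Set E} {p : E} (hO : IsOpen O) (hp : p ∈ O) :
    tangentAt (M ∩ O) p = tangentAt M p := by
  rw [tangentAt, tangentAt, tangentConeAt_inter_nhds (hO.mem_nhds hp)]

theorem hasFDerivAt_pi_fderiv {ι : Type*} [Fintype ι] {h : ι → E → ℝ} {p : E}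
    (hh : ∀ i, DifferentiableAt ℝ (h i) p) :
    HasFDerivAt (fun x i => h i x) (ContinuousLinearMap.pi fun i => fderiv ℝ (h i) p) p :=
  hasFDerivAt_pi.2 fun i => (hh i).hasFDerivAt

/-- The tangent space of a regular level set is the common kernel of the differentials. -/
theorem mem_tangentAt_iff_of_levelSet [FiniteDimensional ℝ E] {ι : Type*} [Fintype ι]
    {h : ι → E → ℝ} {M W : Set E} {p : E} (hh : ∀ i, ContDiff ℝ ∞ (h i)) (hp : p ∈ M)
    (hW : W ∈ 𝓝 p) (hM : M ∩ W = {x ∈ W | ∀ i, h i x = h i p})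
    (hli : LinearIndependent ℝ fun i => fderiv ℝ (h i) p) (v : E) :
    v ∈ tangentAt M p ↔ ∀ i, fderiv ℝ (h i) p v = 0 := by
  have hdiff : ∀ i, DifferentiableAt ℝ (h i) p := fun i =>
    (hh i).differentiable (by simp) p
  constructor
  · intro hv i
    rw [tangentAt, ← tangentConeAt_inter_nhds hW] at hv
    refine fderivWithin_apply_eq_zero_of_const (M := M ∩ W) (c := h i p)
      ⟨hp, mem_of_mem_nhds hW⟩ (hdiff i).hasFDerivAt.hasFDerivWithinAt ?_ hv
    intro x hx
    rw [hM] at hx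
    exact hx.2 i
  · intro hv
    have hF := hasFDerivAt_pi_fderiv hdiff
    have hs := surjective_pi_of_linearIndependent hli
    rw [← hF.fderiv] at hs
    have hle : Fintype.card ι ≤ Module.finrank ℝ E := by
      have := LinearMap.finrank_le_finrank_of_surjective
        (f := (fderiv ℝ (fun x i => h i x) p).toLinearMap) hs
      simpa using this
    obtain ⟨ψ, P, hψ, hψ0, hFψ, -, -, -, htan⟩ := exists_levelSet_chart (n := ∞)
      (d := Module.finrank ℝ E - Fintype.card ι) (by simp)
      (contDiffAt_pi.2 fun i => (hh i).contDiffAt) hs (by rw [Module.finrank_fintype_fun_eq_card]; omega)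
    obtain ⟨w, hw⟩ := htan v (by rw [hF.fderiv]; ext i; simpa using hv i)
    apply Submodule.subset_span
    have hd : HasFDerivAt ψ (fderiv ℝ ψ 0) 0 := (hψ.differentiableAt (by simp)).hasFDerivAt
    -- The curve `t ↦ ψ (t • w)` runs in `M` for small `t` and has velocity `v` at `p`, so its
    -- difference quotients exhibit `v` as an element of the tangent cone.
    have hline : HasDerivAt (fun t : ℝ => ψ (t • w)) v 0 := by
      have h1 : HasDerivAt (fun t : ℝ => t • w) w 0 := by
        simpa using (hasDerivAt_id (0 : ℝ)).smul_const w
      have h2 : HasFDerivAt ψ (fderiv ℝ ψ 0) ((0 : ℝ) • w) := by simpa using hd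
      have h3 := h2.comp_hasDerivAt (0 : ℝ) h1
      rw [hw] at h3
      exact h3
    have hcont : Tendsto (fun t : ℝ => ψ (t • w)) (𝓝 0) (𝓝 p) := by
      have := hline.continuousAt.tendsto
      simpa [hψ0] using this
    refine mem_tangentConeAt_of_seq (𝓝[≠] (0 : ℝ)) (fun t => t⁻¹) (fun t => ψ (t • w) - p) ?_ ?_ ?_
    · have := (hcont.sub_const p).mono_left (nhdsWithin_le_nhds (s := {0}ᶜ))
      simpa using this
    · have hsm : Tendsto (fun t : ℝ => t • w) (𝓝 0) (𝓝 0) := by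
        have : Continuous fun t : ℝ => t • w := by fun_prop
        simpa using this.tendsto 0
      filter_upwards [nhdsWithin_le_nhds (hcont.eventually hW),
        nhdsWithin_le_nhds (hsm.eventually hFψ)] with t ht1 ht2
      have : ψ (t • w) ∈ M ∩ W := by
        rw [hM]
        exact ⟨ht1, fun i => congrFun ht2 i⟩
      simpa using this.1
    · have := hasDerivAt_iff_tendsto_slope.1 hline
      refine this.congr fun t => ?_
      simp [slope, hψ0]

theorem isSmoothSubmanifold_of_levelSet [FiniteDimensional ℝ E] {d : ℕ} {M : Set E}
    {ι : Type*} [Fintype ι] {h : ι → E → ℝ} (hh : ∀ i, ContDiff ℝ ∞ (h i))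
    (hd : d + Fintype.card ι = Module.finrank ℝ E)
    (hM : ∀ p ∈ M, ∃ W, IsOpen W ∧ p ∈ W ∧ M ∩ W = {x ∈ W | ∀ i, h i x = h i p})
    (hli : ∀ p ∈ M, LinearIndependent ℝ fun i => fderiv ℝ (h i) p) :
    IsSmoothSubmanifold d M := by
  intro p hp
  obtain ⟨W, hWo, hpW, hMW⟩ := hM p hp
  -- Independence of the differentials is an open condition, so `W` can be shrunk until the defining
  -- map is a submersion at all of its points.
  have hopen : IsOpen {x | LinearIndependent ℝ fun i => fderiv ℝ (h i) x} := by
    have hc : Continuous fun x => (fun i => fderiv ℝ (h i) x) :=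
      continuous_pi fun i => (hh i).continuous_fderiv (by simp)
    exact isOpen_setOfPred_linearIndependent.preimage hc
  let ε := (Fintype.equivFin ι).symm
  have hF : ∀ x, HasFDerivAt (fun y (j : Fin (Fintype.card ι)) => h (ε j) y - h (ε j) p)
      (ContinuousLinearMap.pi fun j => fderiv ℝ (h (ε j)) x) x := fun x =>
    hasFDerivAt_pi.2 fun j =>
      (((hh (ε j)).differentiable (by simp) x).hasFDerivAt).sub_const _
  refine ⟨Fintype.card ι, W ∩ {x | LinearIndependent ℝ fun i => fderiv ℝ (h i) x},
    fun x j => h (ε j) x - h (ε j) p, hd, hWo.inter hopen, ⟨hpW, hli p hp⟩, ?_, ?_, ?_⟩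
  · exact (contDiff_pi.2 fun j => (hh (ε j)).sub contDiff_const).contDiffOn
  · intro x hx
    rw [(hF x).fderiv]
    exact surjective_pi_of_linearIndependent (hx.2.comp ε ε.injective)
  · ext x
    have := Set.ext_iff.1 hMW x
    simp only [Set.mem_inter_iff, Set.mem_ofPred_eq] at this ⊢
    constructor
    · rintro ⟨h1, h2, h3⟩
      refine ⟨⟨h2, h3⟩, ?_⟩
      funext j
      simpa [sub_eq_zero] using (this.1 ⟨h1, h2⟩).2 (ε j)
    · rintro ⟨⟨h2, h3⟩, h4⟩
      refine ⟨(this.2 ⟨h2, fun i => ?_⟩).1, h2, h3⟩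
      have := congrFun h4 (ε.symm i)
      simpa [sub_eq_zero] using this

end LevelSets

end HeisenbergContact
end

noncomputable section
namespace HeisenbergContact

/-! ### Zero sets of analytic functions and Hausdorff measure. -/

section AnalyticNull

open Filter Topology MeasureTheory

/-- The zero set of an analytic function which does not vanish identically on a convex open set
is Lebesgue null. -/
theorem volume_zeros_eq_zero_of_analyticOnNhd {d : ℕ} {B : Set (Fin d → ℝ)} (hBo : IsOpen B)
    (hBc : Convex ℝ B) {g : (Fin d → ℝ) → ℝ} (hg : AnalyticOnNhd ℝ g B) {x₀ : Fin d → ℝ}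
    (hx₀ : x₀ ∈ B) (hgx₀ : g x₀ ≠ 0) : volume {x ∈ B | g x = 0} = 0 := by
  set S : Set (Fin d → ℝ) := {x ∈ B | g x = 0} with hS
  have hSm : MeasurableSet S := by
    obtain ⟨C, hC, hCe⟩ := (continuousOn_iff_isClosed.1 hg.continuousOn) {0} isClosed_singleton
    have : S = C ∩ B := by
      rw [← hCe]; ext x; simp [hS, and_comm]
    rw [this]
    exact hC.measurableSet.inter hBo.measurableSet
  -- Contraction towards `x₀`. On each segment issuing from `x₀` the function is analytic and
  -- nonzero at `t = 0`, so its zeros there form a null set of parameters `t`.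
  let γ : ℝ → (Fin d → ℝ) → (Fin d → ℝ) := fun t x => x₀ + t • (x - x₀)
  have hmemB : ∀ x ∈ B, ∀ t ∈ Set.Icc (0 : ℝ) 1, γ t x ∈ B := by
    intro x hx t ht
    have := hBc hx₀ hx (sub_nonneg.2 ht.2) ht.1 (by ring)
    convert! this using 1
    simp only [γ]
    module
  let T : Set ((Fin d → ℝ) × ℝ) := {y | y.1 ∈ B ∧ y.2 ∈ Set.Ioc (0 : ℝ) 1 ∧ γ y.2 y.1 ∈ S}
  have hTm : MeasurableSet T := by
    have h1 : Measurable fun y : (Fin d → ℝ) × ℝ => γ y.2 y.1 := by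
      have : Continuous fun y : (Fin d → ℝ) × ℝ => γ y.2 y.1 := by fun_prop
      exact this.measurable
    exact (measurable_fst hBo.measurableSet).inter
      ((measurable_snd measurableSet_Ioc).inter (h1 hSm))
  have hT0 : (volume.prod volume) T = 0 := by
    rw [Measure.measure_prod_null hTm]
    refine Eventually.of_forall fun x => ?_
    by_cases hx : x ∈ B
    swap
    · have : Prod.mk x ⁻¹' T = ∅ := by ext t; simp [T, hx]
      simp [this]
    have hγ : ∀ t ∈ Set.Icc (0 : ℝ) 1, AnalyticAt ℝ (fun t => g (γ t x)) t := by
      intro t ht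
      have hγa : AnalyticAt ℝ (fun t => γ t x) t := by fun_prop
      exact AnalyticAt.fun_comp (g := g) (f := fun t => γ t x) (hg _ (hmemB x hx t ht)) hγa
    have h0 : ¬ Set.EqOn (fun t => g (γ t x)) 0 (Set.Icc 0 1) := by
      intro h
      have := h (Set.left_mem_Icc.2 zero_le_one)
      simp [γ, hgx₀] at this
    have hae := ((AnalyticOnNhd.eqOn_zero_or_eventually_ne_zero_of_preconnected hγ
      isPreconnected_Icc).resolve_left h0)
    have hae2 : ∀ᵐ t ∂(volume.restrict (Set.Icc (0 : ℝ) 1)), g (γ t x) ≠ 0 :=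
      ae_restrict_le_codiscreteWithin measurableSet_Icc hae
    rw [ae_restrict_iff' measurableSet_Icc] at hae2
    rw [Pi.zero_apply]
    refine measure_mono_null ?_ hae2
    rintro t ⟨-, ht, htS⟩ h
    exact h (Set.Ioc_subset_Icc_self ht) htS.2
  -- Fubini in the other order: for almost every `t` the points `x` with `γ t x ∈ S` are null, and
  -- so is their image under the homothety of ratio `t`. Such `t` exist arbitrarily close to `1`.
  have hT1 := Measure.measure_ae_null_of_prod_null (μ := (volume : Measure ℝ))
    (ν := (volume : Measure (Fin d → ℝ))) (s := Prod.swap ⁻¹' T) (by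
      rw [← Measure.prod_swap, Measure.map_apply measurable_swap (measurable_swap hTm)]
      simpa [← Set.preimage_comp] using hT0)
  have hslice : ∀ t ∈ Set.Ioc (0 : ℝ) 1, volume (Prod.mk t ⁻¹' (Prod.swap ⁻¹' T)) = 0 →
      volume (S ∩ γ t '' B) = 0 := by
    intro t ht h
    have hsub : S ∩ γ t '' B ⊆ AffineMap.homothety x₀ t '' (Prod.mk t ⁻¹' (Prod.swap ⁻¹' T)) := by
      rintro _ ⟨hyS, x, hx, rfl⟩
      refine ⟨x, ⟨hx, ht, hyS⟩, ?_⟩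
      simp [AffineMap.homothety_apply, γ, add_comm]
    refine measure_mono_null hsub ?_
    rw [Measure.addHaar_image_homothety, h, mul_zero]
  have hfreq : ∃ᶠ t in 𝓝[<] (1 : ℝ), t ∈ Set.Ioc (0 : ℝ) 1 ∧ volume (S ∩ γ t '' B) = 0 := by
    rw [frequently_iff]
    intro U hU
    obtain ⟨a, ha, haU⟩ := (mem_nhdsLT_iff_exists_Ioo_subset (a := (1 : ℝ))).1 hU
    have ha1 : max a 0 < 1 := max_lt ha zero_lt_one
    have hpos : 0 < volume (Set.Ioo (max a 0) (1 : ℝ)) := by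
      rw [Real.volume_Ioo]; simpa using ha1
    have hpos' : ∃ t ∈ Set.Ioo (max a 0) (1 : ℝ),
        volume (Prod.mk t ⁻¹' (Prod.swap ⁻¹' T)) = 0 := by
      by_contra! hcon
      refine hpos.ne' (measure_mono_null ?_ hT1)
      intro t ht h
      exact hcon t ht h
    obtain ⟨t, ht, ht0⟩ := hpos'
    have ht' : t ∈ Set.Ioc (0 : ℝ) 1 := ⟨(le_max_right _ _).trans_lt ht.1, ht.2.le⟩
    exact ⟨t, haU ⟨(le_max_left _ _).trans_lt ht.1, ht.2⟩, ht', hslice t ht' ht0⟩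
  obtain ⟨t, htlim, ht⟩ := exists_seq_forall_of_frequently hfreq
  -- Since `B` is open, each of its points lies in `γ t '' B` once `t` is close enough to `1`.
  have hcov : S ⊆ ⋃ n, S ∩ γ (t n) '' B := by
    intro x hx
    have h1 : Tendsto (fun n => x₀ + (t n)⁻¹ • (x - x₀)) atTop (𝓝 x) := by
      have h2 : Tendsto (fun n => (t n)⁻¹) atTop (𝓝 1) := by
        have := (tendsto_nhds_of_tendsto_nhdsWithin htlim).inv₀ one_ne_zero
        simpa using this
      have := (h2.smul_const (x - x₀)).const_add x₀
      simpa using this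
    obtain ⟨n, hn⟩ := (h1.eventually (hBo.mem_nhds hx.1)).exists
    refine Set.mem_iUnion.2 ⟨n, hx, _, hn, ?_⟩
    have hne : t n ≠ 0 := (ht n).1.1.ne'
    simp [γ, smul_smul, mul_inv_cancel₀ hne]
  exact measure_mono_null hcov (measure_iUnion_null fun n => (ht n).2)

variable {E : Type*} [NormedAddCommGroup E] [NormedSpace ℝ E]

/-- Near each point of an analytic regular level set of dimension `d`, an analytic function which
does not vanish identically has a zero set of vanishing `d`-dimensional Hausdorff measure. -/
theorem exists_nhds_hausdorffMeasure_zeros_eq_zero [FiniteDimensional ℝ E] [MeasurableSpace E]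
    [BorelSpace E] {ι : Type*} [Fintype ι] {h : ι → E → ℝ} {M W : Set E} {p : E} {d : ℕ}
    (hh : ∀ i, ContDiff ℝ ω (h i)) (hW : W ∈ 𝓝 p) (hM : M ∩ W = {x ∈ W | ∀ i, h i x = h i p})
    (hli : LinearIndependent ℝ fun i => fderiv ℝ (h i) p)
    (hd : d + Fintype.card ι = Module.finrank ℝ E) :
    ∃ V ∈ 𝓝 p, ∀ g : E → ℝ, ContDiff ℝ ω g → (∃ x ∈ M ∩ V, g x ≠ 0) →
      μH[(d : ℝ)] {x ∈ M ∩ V | g x = 0} = 0 := by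
  have hdiff : ∀ i, DifferentiableAt ℝ (h i) p := fun i =>
    (hh i).differentiable (by simp) p
  have hF := hasFDerivAt_pi_fderiv hdiff
  have hs := surjective_pi_of_linearIndependent hli
  rw [← hF.fderiv] at hs
  obtain ⟨ψ, P, hψ, hψ0, hFψ, hPc, hP0, hψP, -⟩ := exists_levelSet_chart (n := ω) (d := d) (by simp)
    (contDiffAt_pi.2 fun i => (hh i).contDiffAt) hs
    (by rw [Module.finrank_fintype_fun_eq_card]; exact hd)
  obtain ⟨C, s, hs0, hLip⟩ := (hψ.of_le (m := 1) le_top).exists_lipschitzOnWith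
  have hψc : Tendsto ψ (𝓝 0) (𝓝 p) := by
    have := hψ.continuousAt.tendsto
    rwa [hψ0] at this
  have hgood : ∀ᶠ t in 𝓝 (0 : Fin d → ℝ), AnalyticAt ℝ ψ t ∧ t ∈ s :=
    hψ.analyticAt.eventually_analyticAt.and hs0
  obtain ⟨r, hr, hball⟩ := Metric.eventually_nhds_iff_ball.1 hgood
  have hB : Metric.ball (0 : Fin d → ℝ) r ∈ 𝓝 (P p) := by
    rw [hP0]; exact Metric.ball_mem_nhds _ hr
  refine ⟨W ∩ {x | ((fun i => h i x) = (fun i => h i p) → ψ (P x) = x) ∧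
    P x ∈ Metric.ball (0 : Fin d → ℝ) r}, inter_mem hW (hψP.and (hPc.eventually hB)), ?_⟩
  intro g hg ⟨x, ⟨hxM, hxW, hxψ, hxB⟩, hgx⟩
  have hlev : ∀ y ∈ M, y ∈ W → (fun i => h i y) = (fun i => h i p) := by
    intro y hy hyW
    have : y ∈ M ∩ W := ⟨hy, hyW⟩
    rw [hM] at this
    exact funext this.2
  have hnull : volume {t ∈ Metric.ball (0 : Fin d → ℝ) r | g (ψ t) = 0} = 0 := by
    refine volume_zeros_eq_zero_of_analyticOnNhd Metric.isOpen_ball (convex_ball _ _)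
      (g := fun t => g (ψ t)) (fun t ht => ?_) hxB ?_
    · exact hg.contDiffAt.analyticAt.fun_comp (hball t ht).1
    · rwa [hxψ (hlev x hxM hxW)]
  -- On `Fin d → ℝ` with the sup norm, `d`-dimensional Hausdorff measure is Lebesgue measure; the
  -- Lipschitz map `ψ` carries null sets to null sets.
  have hnull' : μH[(d : ℝ)] {t ∈ Metric.ball (0 : Fin d → ℝ) r | g (ψ t) = 0} = 0 := by
    have := hausdorffMeasure_pi_real (ι := Fin d)
    rw [Fintype.card_fin] at this
    rw [this, hnull]
  have himg : μH[(d : ℝ)] (ψ '' {t ∈ Metric.ball (0 : Fin d → ℝ) r | g (ψ t) = 0}) = 0 := by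
    have hsub : {t ∈ Metric.ball (0 : Fin d → ℝ) r | g (ψ t) = 0} ⊆ s := fun t ht =>
      (hball t ht.1).2
    have := (hLip.mono hsub).hausdorffMeasure_image_le (d := (d : ℝ)) (by positivity)
    rw [hnull', mul_zero] at this
    exact le_antisymm this bot_le
  refine measure_mono_null ?_ himg
  rintro y ⟨⟨hyM, hyW, hyψ, hyB⟩, hgy⟩
  have := hyψ (hlev y hyM hyW)
  exact ⟨P y, ⟨hyB, by rw [this]; exact hgy⟩, this⟩

end AnalyticNull

/-! ### Forms and Lie brackets on subsets. -/

section Brackets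

variable {E : Type*} [NormedAddCommGroup E] [NormedSpace ℝ E]

theorem dForm_eq {α : E → E →L[ℝ] ℝ} {p : E} (hα : DifferentiableAt ℝ α p) (u v : E) :
    dForm α p u v = fderiv ℝ α p u v - fderiv ℝ α p v u := by
  have h1 : DifferentiableAt ℝ
      (fun x => ContinuousAlternatingMap.ofSubsingleton ℝ E ℝ (0 : Fin 1) (α x)) p := by
    exact (ContinuousAlternatingMap.ofSubsingletonLIE (𝕜 := ℝ) (E := E) (F := ℝ)
      (0 : Fin 1)).differentiable.differentiableAt.comp p hα
  rw [dForm, extDeriv_apply h1]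
  have h2 : ∀ w z : E, fderiv ℝ (fun x => α x w) p z = fderiv ℝ α p z w := fun w z => by
    simpa using congrArg (· z) (hα.hasFDerivAt.clm_apply (hasFDerivAt_const w p)).fderiv
  rw [Fin.sum_univ_succ, Fin.sum_univ_one]
  simp [h2, sub_eq_add_neg, Fin.removeNth]

theorem unique_fderivWithin_of_eqOn {F : Type*} [NormedAddCommGroup F] [NormedSpace ℝ F]
    {M : Set E} {p : E} (hp : p ∈ M) {f g : E → F} {f' g' : E →L[ℝ] F}
    (hf : HasFDerivWithinAt f f' M p) (hg : HasFDerivWithinAt g g' M p)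
    (hfg : ∀ x ∈ M, f x = g x) {v : E} (hv : v ∈ tangentAt M p) : f' v = g' v :=
  unique_fderivWithin_of_mem_tangentAt hf (hg.congr hfg (hfg p hp)) hv

/-- The value of a 1-form on the bracket of two tangent fields. -/
theorem apply_lieBracketWithin {M : Set E} {p : E} (hp : p ∈ M) {β : E → E →L[ℝ] ℝ}
    (hβ : DifferentiableAt ℝ β p) {X Y : E → E} (hX : DifferentiableWithinAt ℝ X M p)
    (hY : DifferentiableWithinAt ℝ Y M p) (hXt : X p ∈ tangentAt M p) (hYt : Y p ∈ tangentAt M p)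
    {a b : E → ℝ} (ha : DifferentiableAt ℝ a p) (hb : DifferentiableAt ℝ b p)
    (hβX : ∀ x ∈ M, β x (X x) = a x) (hβY : ∀ x ∈ M, β x (Y x) = b x) :
    β p (VectorField.lieBracketWithin ℝ X Y M p) =
      fderiv ℝ b p (X p) - fderiv ℝ a p (Y p) +
        (fderiv ℝ β p (Y p) (X p) - fderiv ℝ β p (X p) (Y p)) := by
  have h1 := unique_fderivWithin_of_eqOn hp
    (hβ.hasFDerivAt.hasFDerivWithinAt.clm_apply hX.hasFDerivWithinAt)
    ha.hasFDerivAt.hasFDerivWithinAt hβX hYt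
  have h2 := unique_fderivWithin_of_eqOn hp
    (hβ.hasFDerivAt.hasFDerivWithinAt.clm_apply hY.hasFDerivWithinAt)
    hb.hasFDerivAt.hasFDerivWithinAt hβY hXt
  simp only [add_apply, ContinuousLinearMap.comp_apply,
    ContinuousLinearMap.flip_apply] at h1 h2
  rw [VectorField.lieBracketWithin, map_sub]
  linarith

/-- Applied to `β = dh`, the bracket formula leaves only the antisymmetric part of the second
derivative of `h`, which is zero. -/
theorem fderiv_apply_lieBracketWithin_eq_zero {M : Set E} {p : E} (hp : p ∈ M) {h : E → ℝ}
    (hh : ContDiff ℝ ∞ h) {X Y : E → E} (hX : DifferentiableWithinAt ℝ X M p)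
    (hY : DifferentiableWithinAt ℝ Y M p) (hXt : X p ∈ tangentAt M p) (hYt : Y p ∈ tangentAt M p)
    (hhX : ∀ x ∈ M, fderiv ℝ h x (X x) = 0) (hhY : ∀ x ∈ M, fderiv ℝ h x (Y x) = 0) :
    fderiv ℝ h p (VectorField.lieBracketWithin ℝ X Y M p) = 0 := by
  have hd : DifferentiableAt ℝ (fderiv ℝ h) p :=
    (hh.fderiv_right (m := ∞) (by simp)).differentiable (by simp) p
  have h0 : DifferentiableAt ℝ (fun _ : E => (0 : ℝ)) p := differentiableAt_const _
  rw [apply_lieBracketWithin hp hd hX hY hXt hYt h0 h0 hhX hhY]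
  have hsymm : IsSymmSndFDerivAt ℝ h p := hh.contDiffAt.isSymmSndFDerivAt (by
    rw [minSmoothness_of_isRCLikeNormedField]; exact WithTop.coe_le_coe.2 le_top)
  rw [hsymm (Y p) (X p)]
  simp

theorem lieBracketWithin_eq_lieBracket_of_tangent {M : Set E} {p : E} {X Y : E → E}
    (hX : DifferentiableAt ℝ X p) (hY : DifferentiableAt ℝ Y p) (hXt : X p ∈ tangentAt M p)
    (hYt : Y p ∈ tangentAt M p) :
    VectorField.lieBracketWithin ℝ X Y M p = VectorField.lieBracket ℝ X Y p := by
  rw [VectorField.lieBracketWithin, VectorField.lieBracket,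
    fderivWithin_apply_of_mem_tangentAt hX hYt, fderivWithin_apply_of_mem_tangentAt hY hXt]

end Brackets

end HeisenbergContact
end

noncomputable section
namespace HeisenbergContact

variable {k l : ℕ}

/-! ### Algebra of the indefinite scalar product. -/

section InnerProduct

variable (x y z J : Fin (k + l) → ℝ) (c : ℝ)

theorem sgn_mul_self (i : Fin (k + l)) : sgn k l i * sgn k l i = 1 := by
  unfold sgn; split_ifs <;> norm_num

theorem sgn_ne_zero (i : Fin (k + l)) : sgn k l i ≠ 0 := by
  unfold sgn; split_ifs <;> norm_num

theorem ip_comm : ip x y = ip y x := by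
  unfold ip; exact Finset.sum_congr rfl fun i _ => by ring

theorem ip_add_left : ip (x + y) z = ip x z + ip y z := by
  unfold ip; rw [← Finset.sum_add_distrib]; exact Finset.sum_congr rfl fun i _ => by simp; ring

theorem ip_add_right : ip x (y + z) = ip x y + ip x z := by
  rw [ip_comm, ip_add_left, ip_comm y, ip_comm z]

theorem ip_smul_left : ip (c • x) y = c * ip x y := by
  unfold ip; rw [Finset.mul_sum]; exact Finset.sum_congr rfl fun i _ => by simp; ring

theorem ip_smul_right : ip x (c • y) = c * ip x y := by
  rw [ip_comm, ip_smul_left, ip_comm y]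

theorem ip_neg_left : ip (-x) y = -ip x y := by
  rw [← neg_one_smul ℝ, ip_smul_left]; ring

theorem ip_neg_right : ip x (-y) = -ip x y := by
  rw [ip_comm, ip_neg_left, ip_comm y]

theorem ip_sub_left : ip (x - y) z = ip x z - ip y z := by
  rw [sub_eq_add_neg, ip_add_left, ip_neg_left]; ring

theorem ip_sub_right : ip x (y - z) = ip x y - ip x z := by
  rw [ip_comm, ip_sub_left, ip_comm y, ip_comm z]

theorem ip_zero_left : ip 0 y = 0 := by
  rw [← zero_smul ℝ (0 : Fin (k + l) → ℝ), ip_smul_left, zero_mul]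

theorem ip_zero_right : ip x 0 = 0 := by
  rw [ip_comm, ip_zero_left]

theorem ip_mul_left : ip (J * x) y = ip x (J * y) := by
  unfold ip; exact Finset.sum_congr rfl fun i _ => by simp; ring

theorem ip_single (i : Fin (k + l)) : ip x (Pi.single i 1) = sgn k l i * x i := by
  unfold ip
  rw [Finset.sum_eq_single i]
  · simp
  · intro b _ hb; simp [hb]
  · simp

variable {x y J}

theorem eq_zero_of_ip_eq_zero (h : ∀ w, ip x w = 0) : x = 0 := by
  funext i
  have := h (Pi.single i 1)
  rw [ip_single] at this
  simpa [sgn_ne_zero] using this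

theorem mul_inv_mul_cancel_of_forall_ne_zero (hJ0 : ∀ i, J i ≠ 0) : J * (J⁻¹ * x) = x := by
  funext i; simp [hJ0 i]

theorem inv_mul_mul_cancel_of_forall_ne_zero (hJ0 : ∀ i, J i ≠ 0) : J⁻¹ * (J * x) = x := by
  funext i; simp [hJ0 i]

theorem ip_mul_inv_mul (hJ0 : ∀ i, J i ≠ 0) : ip (J * x) (J⁻¹ * y) = ip x y := by
  rw [ip_mul_left, mul_inv_mul_cancel_of_forall_ne_zero hJ0]

theorem ip_inv_mul_mul (hJ0 : ∀ i, J i ≠ 0) : ip (J⁻¹ * x) (J * y) = ip x y := by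
  rw [ip_mul_left, inv_mul_mul_cancel_of_forall_ne_zero hJ0]

end InnerProduct

/-! ### The form `dα` as a constant symplectic form. -/

section Symplectic

variable (J : Fin (k + l) → ℝ)

/-- The constant symplectic form `dα = ∑ τ_i J_i dQ_i ∧ dq_i`. -/
def omega (u v : Phase k l) : ℝ := ip u.2 (J * v.1) - ip v.2 (J * u.1)

theorem alpha_apply (p v : Phase k l) : alpha J p v = ip p.2 (J * v.1) := by
  simp only [alpha, sum_apply, smul_apply, ip]
  refine Finset.sum_congr rfl fun i _ => ?_
  simp; ring

theorem hasFDerivAt_alpha (p : Phase k l) :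
    ∃ A : Phase k l →L[ℝ] Phase k l →L[ℝ] ℝ, HasFDerivAt (alpha J) A p ∧
      ∀ u v, A u v = alpha J u v := by
  let A₀ : Phase k l →ₗ[ℝ] Phase k l →L[ℝ] ℝ :=
    { toFun := alpha J
      map_add' := fun u w => by
        refine ContinuousLinearMap.ext fun v => ?_
        simp only [add_apply, alpha_apply, Prod.snd_add, ip_add_left]
      map_smul' := fun c u => by
        refine ContinuousLinearMap.ext fun v => ?_
        simp only [smul_apply, alpha_apply, Prod.smul_snd, ip_smul_left,
          smul_eq_mul, RingHom.id_apply] }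
  exact ⟨LinearMap.toContinuousLinearMap A₀,
    (LinearMap.toContinuousLinearMap A₀).hasFDerivAt, fun _ _ => rfl⟩

theorem differentiableAt_alpha (p : Phase k l) : DifferentiableAt ℝ (alpha J) p :=
  (hasFDerivAt_alpha J p).choose_spec.1.differentiableAt

theorem fderiv_alpha_apply (p u v : Phase k l) : fderiv ℝ (alpha J) p u v = alpha J u v := by
  obtain ⟨A, hA, h⟩ := hasFDerivAt_alpha J p
  rw [hA.fderiv, h]

theorem dForm_alpha (p u v : Phase k l) : dForm (alpha J) p u v = omega J u v := by
  rw [dForm_eq (differentiableAt_alpha J p), fderiv_alpha_apply, fderiv_alpha_apply,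
    alpha_apply, alpha_apply, omega]

variable {J}

theorem omega_swap (u v : Phase k l) : omega J u v = -omega J v u := by
  unfold omega; ring

/-- The symplectic form as a continuous bilinear map. -/
def omegaL (J : Fin (k + l) → ℝ) : Phase k l →L[ℝ] Phase k l →L[ℝ] ℝ :=
  LinearMap.toContinuousLinearMap
    (LinearMap.toContinuousLinearMap.toLinearMap ∘ₗ LinearMap.mk₂ ℝ (omega J)
      (fun u v w => by
        simp only [omega, Prod.fst_add, Prod.snd_add, mul_add, ip_add_left, ip_add_right]; ring)
      (fun c u v => by
        simp only [omega, Prod.smul_fst, Prod.smul_snd, mul_smul_comm, ip_smul_left,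
          ip_smul_right, smul_eq_mul]; ring)
      (fun u v w => by
        simp only [omega, Prod.fst_add, Prod.snd_add, mul_add, ip_add_left, ip_add_right]; ring)
      (fun c u v => by
        simp only [omega, Prod.smul_fst, Prod.smul_snd, mul_smul_comm, ip_smul_left,
          ip_smul_right, smul_eq_mul]; ring))

theorem omegaL_apply (u v : Phase k l) : omegaL J u v = omega J u v := rfl

end Symplectic

/-! ### Differentials of the constraints and of the integrals. -/

section Derivatives

/-- Along a line the constraints and the angular momenta are quadratic polynomials in `t`, so their
differentials can be read off from the linear coefficient. -/
theorem fderiv_apply_of_hasDerivAt_line {E : Type*} [NormedAddCommGroup E] [NormedSpace ℝ E]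
    {f : E → ℝ} {p v : E} {c : ℝ} (hf : DifferentiableAt ℝ f p)
    (h : HasDerivAt (fun t : ℝ => f (p + t • v)) c 0) : fderiv ℝ f p v = c := by
  rw [← hf.lineDeriv_eq_fderiv]
  exact h.deriv

variable (J : Fin (k + l) → ℝ)

/-- The angular momentum `J_j Q_j q_i - q_j J_i Q_i`. -/
def angMom (i j : Fin (k + l)) (p : Phase k l) : ℝ := J j * p.2 j * p.1 i - p.1 j * J i * p.2 i

/-- The differential of `angMom`. -/
def dAngMom (i j : Fin (k + l)) (p v : Phase k l) : ℝ :=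
  J j * (v.2 j * p.1 i + p.2 j * v.1 i) - J i * (v.1 j * p.2 i + p.1 j * v.2 i)

/-- The coefficients of the integrals `f_i`, doubled. -/
def coeffF (i j : Fin (k + l)) : ℝ := 2 * (sgn k l i * sgn k l j / (J i ^ 2 - J j ^ 2))

/-- The functions defining `M_κ`. -/
def constraint : Fin 3 → Phase k l → ℝ :=
  ![fun p => ip p.1 p.1, fun p => ip p.2 p.2, lagrangian J]

variable {J}

theorem contDiff_ip {n : ℕ∞ω} {E : Type*} [NormedAddCommGroup E] [NormedSpace ℝ E]
    {f g : E → Fin (k + l) → ℝ} (hf : ContDiff ℝ n f) (hg : ContDiff ℝ n g) :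
    ContDiff ℝ n fun x => ip (f x) (g x) := by
  unfold ip
  fun_prop

theorem contDiff_lagrangian : ContDiff ℝ ω (lagrangian J : Phase k l → ℝ) := by
  unfold lagrangian ip
  simp only [Pi.mul_apply]
  fun_prop

theorem contDiff_integralK : ContDiff ℝ ω (integralK J : Phase k l → ℝ) := by
  unfold integralK ip
  simp only [Pi.mul_apply]
  fun_prop

theorem contDiff_constraint (i : Fin 3) : ContDiff ℝ ω (constraint J i : Phase k l → ℝ) := by
  fin_cases i
  · exact contDiff_ip contDiff_fst contDiff_fst
  · exact contDiff_ip contDiff_snd contDiff_snd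
  · exact contDiff_lagrangian

theorem contDiff_integralF (i : Fin (k + l)) : ContDiff ℝ ω (integralF J i : Phase k l → ℝ) := by
  unfold integralF
  fun_prop

/-- The diagonal term may be added because `coeffF J i i` is a division by zero, hence `0`. Summing
over all `j` makes antisymmetry in `i, j` available. -/
theorem integralF_eq_sum (i : Fin (k + l)) (p : Phase k l) :
    integralF J i p = ∑ j, coeffF J i j / 2 * angMom J i j p ^ 2 := by
  rw [integralF, ← Finset.sum_erase (a := i) Finset.univ]
  · refine Finset.sum_congr rfl fun j _ => ?_
    rw [coeffF, angMom]; ring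
  · simp [coeffF]

theorem hasDerivAt_quadratic (a b c : ℝ) :
    HasDerivAt (fun t : ℝ => a + t * b + t ^ 2 * c) b 0 := by
  have h1 := (((hasDerivAt_id (0 : ℝ)).mul_const b).const_add a).fun_add
    ((hasDerivAt_pow 2 (0 : ℝ)).mul_const c)
  simpa using h1

theorem hasDerivAt_ip_line (a b u v : Fin (k + l) → ℝ) :
    HasDerivAt (fun t : ℝ => ip (a + t • u) (b + t • v)) (ip u b + ip a v) 0 := by
  have h : (fun t : ℝ => ip (a + t • u) (b + t • v)) =
      fun t => ip a b + t * (ip u b + ip a v) + t ^ 2 * ip u v := by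
    funext t
    simp only [ip_add_left, ip_add_right, ip_smul_left, ip_smul_right]
    ring
  rw [h]
  exact hasDerivAt_quadratic _ _ _

theorem fderiv_constraint_zero (p v : Phase k l) :
    fderiv ℝ (constraint J 0) p v = 2 * ip p.1 v.1 := by
  refine fderiv_apply_of_hasDerivAt_line ((contDiff_constraint 0).differentiable (by simp) p) ?_
  convert! hasDerivAt_ip_line p.1 p.1 v.1 v.1 using 1
  rw [ip_comm v.1]; ring

theorem fderiv_constraint_one (p v : Phase k l) :
    fderiv ℝ (constraint J 1) p v = 2 * ip p.2 v.2 := by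
  refine fderiv_apply_of_hasDerivAt_line ((contDiff_constraint 1).differentiable (by simp) p) ?_
  convert! hasDerivAt_ip_line p.2 p.2 v.2 v.2 using 1
  rw [ip_comm v.2]; ring

theorem fderiv_lagrangian (p v : Phase k l) :
    fderiv ℝ (lagrangian J) p v = ip v.1 (J * p.2) + ip p.1 (J * v.2) := by
  refine fderiv_apply_of_hasDerivAt_line (contDiff_lagrangian.differentiable (by simp) p) ?_
  convert! hasDerivAt_ip_line p.1 (J * p.2) v.1 (J * v.2) using 1
  funext t
  simp [lagrangian, mul_add]

theorem fderiv_constraint_two (p v : Phase k l) :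
    fderiv ℝ (constraint J 2) p v = ip v.1 (J * p.2) + ip p.1 (J * v.2) :=
  fderiv_lagrangian p v

theorem hasDerivAt_angMom_line (i j : Fin (k + l)) (p v : Phase k l) :
    HasDerivAt (fun t : ℝ => angMom J i j (p + t • v)) (dAngMom J i j p v) 0 := by
  have h : (fun t : ℝ => angMom J i j (p + t • v)) =
      fun t => angMom J i j p + t * dAngMom J i j p v + t ^ 2 * angMom J i j v := by
    funext t
    simp only [angMom, dAngMom, Prod.fst_add, Prod.snd_add, Prod.smul_fst, Prod.smul_snd,
      Pi.add_apply, Pi.smul_apply, smul_eq_mul]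
    ring
  rw [h]
  exact hasDerivAt_quadratic _ _ _

theorem fderiv_integralF (i : Fin (k + l)) (p v : Phase k l) :
    fderiv ℝ (integralF J i) p v = ∑ j, coeffF J i j * angMom J i j p * dAngMom J i j p v := by
  refine fderiv_apply_of_hasDerivAt_line ((contDiff_integralF i).differentiable (by simp) p) ?_
  have h : (fun t : ℝ => integralF J i (p + t • v)) =
      fun t => ∑ j, coeffF J i j / 2 * angMom J i j (p + t • v) ^ 2 := by
    funext t; exact integralF_eq_sum i _
  rw [h]
  refine HasDerivAt.fun_sum fun j _ => ?_
  convert! ((hasDerivAt_angMom_line i j p v).fun_pow 2).const_mul (coeffF J i j / 2) using 1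
  simp; ring

end Derivatives

/-! ### The contact manifold `M_κ`. -/

section Variety

variable {J : Fin (k + l) → ℝ} {κ : ℝ} {p : Phase k l}

theorem lagrangian_ne_zero (hκ : 0 < κ) (hp : p ∈ contactVariety J κ) : lagrangian J p ≠ 0 := by
  rcases hp.2.2.2 with h | h <;> rw [h] <;> linarith [hκ]

theorem lagrangian_sq (hp : p ∈ contactVariety J κ) : lagrangian J p ^ 2 = κ ^ 2 := by
  rcases hp.2.2.2 with h | h <;> rw [h]; ring

theorem ip_inv_mul_eq_integralK : ip p.2 (J⁻¹ * p.1) = integralK J p := by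
  rw [integralK, ip_mul_left]

theorem ip_inv_mul_eq_integralK' : ip p.1 (J⁻¹ * p.2) = integralK J p := by
  rw [integralK, ip_comm]

theorem linearIndependent_fderiv_constraint (hκ : 0 < κ)
    (hp : p ∈ contactVariety J κ) :
    LinearIndependent ℝ fun i => fderiv ℝ (constraint J i) p := by
  have hL := lagrangian_ne_zero hκ hp
  obtain ⟨h1, h2, hK, -⟩ := hp
  rw [Fintype.linearIndependent_iff]
  intro g hg
  have key : ∀ v : Phase k l, g 0 * (2 * ip p.1 v.1) + g 1 * (2 * ip p.2 v.2) +
      g 2 * (ip v.1 (J * p.2) + ip p.1 (J * v.2)) = 0 := by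
    intro v
    have := congrArg (fun L => L v) hg
    simpa [Fin.sum_univ_three, fderiv_constraint_zero, fderiv_constraint_one,
      fderiv_constraint_two] using this
  -- `(q, 0)` sees only `dL` and yields `g 2 * L = 0`. Once `g 2 = 0`, the other two vectors isolate
  -- `g 0` and `g 1`, each with factor `2 K`.
  have e2 := key (p.1, 0)
  have e0 := key (J⁻¹ * p.2, 0)
  have e1 := key (0, J⁻¹ * p.1)
  have hg2 : g 2 = 0 := by
    simp only [h1, mul_zero, ip_zero_right, zero_add, add_zero] at e2
    exact (mul_eq_zero.1 e2).resolve_right hL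
  simp only [hg2, mul_zero, zero_mul, ip_zero_right, zero_add, add_zero,
    ip_inv_mul_eq_integralK, ip_inv_mul_eq_integralK'] at e0 e1
  have hg0 : g 0 = 0 := by
    rcases mul_eq_zero.1 e0 with h | h
    · exact h
    · exact absurd (by linarith) hK
  have hg1 : g 1 = 0 := by
    rcases mul_eq_zero.1 e1 with h | h
    · exact h
    · exact absurd (by linarith) hK
  intro i
  fin_cases i
  exacts [hg0, hg1, hg2]

/-- Locally, `M_κ` is a level set of the three constraint functions. -/
theorem contactVariety_local_levelSet (hκ : 0 < κ) (hp : p ∈ contactVariety J κ) :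
    ∃ W, IsOpen W ∧ p ∈ W ∧ contactVariety J κ ∩ W =
      {x ∈ W | ∀ i, constraint J i x = constraint J i p} := by
  have hL := lagrangian_ne_zero hκ hp
  -- The sign condition keeps `L` on one of its two branches, so that `±κ` becomes a single value.
  refine ⟨{x | integralK J x ≠ 0 ∧ 0 < lagrangian J x * lagrangian J p}, ?_,
    ⟨hp.2.2.1, mul_self_pos.2 hL⟩, ?_⟩
  · exact (isOpen_ne_fun contDiff_integralK.continuous continuous_const).inter
      (isOpen_lt continuous_const (contDiff_lagrangian.continuous.mul continuous_const))
  · ext x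
    simp only [Set.mem_inter_iff, Set.mem_ofPred_eq, Fin.forall_fin_succ, IsEmpty.forall_iff,
      and_true]
    have e0 : constraint J 0 p = 0 := hp.1
    have e1 : constraint J 1 p = 0 := hp.2.1
    have e2 : constraint J 2 p = lagrangian J p := rfl
    constructor
    · rintro ⟨hx, hK, hpos⟩
      refine ⟨⟨hK, hpos⟩, hx.1.trans e0.symm, hx.2.1.trans e1.symm, ?_⟩
      change lagrangian J x = lagrangian J p
      rcases hp.2.2.2 with h | h <;> rcases hx.2.2.2 with h' | h' <;> rw [h, h'] at hpos ⊢ <;>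
        nlinarith
    · rintro ⟨⟨hK, hpos⟩, h0, h1, h2⟩
      have h2' : lagrangian J x = lagrangian J p := h2
      refine ⟨⟨h0.trans e0, h1.trans e1, hK, ?_⟩, hK, hpos⟩
      rw [h2']
      exact hp.2.2.2

theorem finrank_phase : Module.finrank ℝ (Phase k l) = 2 * (k + l) := by
  rw [Module.finrank_prod, Module.finrank_fin_fun]; ring

theorem isSmoothSubmanifold_contactVariety (hn : 2 ≤ k + l) (hκ : 0 < κ) :
    IsSmoothSubmanifold (2 * (k + l) - 3) (contactVariety J κ) := by
  refine isSmoothSubmanifold_of_levelSet (h := constraint J)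
    (fun i => (contDiff_constraint i).of_le le_top) ?_
    (fun p hp => contactVariety_local_levelSet hκ hp)
    (fun p hp => linearIndependent_fderiv_constraint hκ hp)
  rw [finrank_phase, Fintype.card_fin]; omega

theorem mem_tangentAt_iff_constraint (hκ : 0 < κ)
    (hp : p ∈ contactVariety J κ) (v : Phase k l) :
    v ∈ tangentAt (contactVariety J κ) p ↔ ∀ i, fderiv ℝ (constraint J i) p v = 0 := by
  obtain ⟨W, hWo, hpW, hMW⟩ := contactVariety_local_levelSet hκ hp
  exact mem_tangentAt_iff_of_levelSet (fun i => (contDiff_constraint i).of_le le_top) hp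
    (hWo.mem_nhds hpW) hMW (linearIndependent_fderiv_constraint hκ hp) v

theorem mem_tangentAt_iff (hκ : 0 < κ)
    (hp : p ∈ contactVariety J κ) (v : Phase k l) :
    v ∈ tangentAt (contactVariety J κ) p ↔ ip p.1 v.1 = 0 ∧ ip p.2 v.2 = 0 ∧
      ip v.1 (J * p.2) + ip p.1 (J * v.2) = 0 := by
  rw [mem_tangentAt_iff_constraint hκ hp]
  simp only [Fin.forall_fin_succ, IsEmpty.forall_iff, and_true]
  change fderiv ℝ (constraint J 0) p v = 0 ∧ fderiv ℝ (constraint J 1) p v = 0 ∧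
    fderiv ℝ (constraint J 2) p v = 0 ↔ _
  rw [fderiv_constraint_zero, fderiv_constraint_one, fderiv_constraint_two]
  simp

theorem mem_horizontalAt_iff (hκ : 0 < κ)
    (hp : p ∈ contactVariety J κ) (v : Phase k l) :
    v ∈ horizontalAt (contactVariety J κ) (alpha J) p ↔ ip p.1 v.1 = 0 ∧ ip p.2 v.2 = 0 ∧
      ip (J * p.2) v.1 = 0 ∧ ip (J * p.1) v.2 = 0 := by
  rw [horizontalAt, Submodule.mem_inf, mem_tangentAt_iff hκ hp, LinearMap.mem_ker]
  change _ ∧ alpha J p v = 0 ↔ _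
  rw [alpha_apply, ip_comm v.1, ← ip_mul_left p.1, ← ip_mul_left]
  constructor
  · rintro ⟨⟨h1, h2, h3⟩, h4⟩
    exact ⟨h1, h2, h4, by linarith⟩
  · rintro ⟨h1, h2, h3, h4⟩
    exact ⟨⟨h1, h2, by linarith⟩, h3⟩

/-- `dα` is nondegenerate on the horizontal distribution. -/
theorem eq_zero_of_omega_horizontal_eq_zero (hJ0 : ∀ i, J i ≠ 0) (hκ : 0 < κ)
    (hp : p ∈ contactVariety J κ) {u : Phase k l}
    (hu : u ∈ horizontalAt (contactVariety J κ) (alpha J) p)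
    (h : ∀ v ∈ horizontalAt (contactVariety J κ) (alpha J) p, omega J u v = 0) : u = 0 := by
  have hL := lagrangian_ne_zero hκ hp
  have hLd : ip (J * p.2) p.1 = lagrangian J p := by rw [lagrangian, ip_comm]
  have hLd' : ip (J * p.1) p.2 = lagrangian J p := by rw [lagrangian, ip_mul_left]
  obtain ⟨hu1, hu2, hu3, hu4⟩ := (mem_horizontalAt_iff hκ hp u).1 hu
  have hq := hp.1
  have hQ := hp.2.1
  have hK := hp.2.2.1
  have h2 : J * u.2 = 0 := by
    refine eq_zero_of_ip_eq_zero fun w => ?_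
    -- Multiples of `J⁻¹Q` and `q` make an arbitrary `w` horizontal in the first factor. Both
    -- corrections pair to zero with `J u₂`, since `u₂` is orthogonal to `Q` and to `Jq`; thus `J
    -- u₂` is orthogonal to every `w`.
    have := h (w - (ip p.1 w / integralK J p) • (J⁻¹ * p.2) -
      (ip (J * p.2) w / lagrangian J p) • p.1, 0) (by
        rw [mem_horizontalAt_iff hκ hp]
        simp only [ip_sub_right, ip_smul_right, ip_inv_mul_eq_integralK', ip_mul_inv_mul hJ0, hq,
          hQ, hLd, ip_zero_right]
        refine ⟨by field_simp; ring, trivial, by field_simp; ring, trivial⟩)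
    rw [omega, ip_zero_left, ← ip_mul_left] at this
    simp only [ip_sub_right, ip_smul_right, ip_mul_inv_mul hJ0] at this
    rw [ip_comm u.2 p.2, hu2, ip_mul_left u.2 p.1 J, ip_comm u.2 (J * p.1), hu4] at this
    linarith
  have h1 : J * u.1 = 0 := by
    refine eq_zero_of_ip_eq_zero fun w => ?_
    have := h (0, w - (ip p.2 w / integralK J p) • (J⁻¹ * p.1) -
      (ip (J * p.1) w / lagrangian J p) • p.2) (by
        rw [mem_horizontalAt_iff hκ hp]
        simp only [ip_sub_right, ip_smul_right, ip_inv_mul_eq_integralK, ip_mul_inv_mul hJ0, hq,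
          hQ, hLd', ip_zero_right]
        refine ⟨trivial, by field_simp; ring, trivial, by field_simp; ring⟩)
    rw [omega, mul_zero, ip_zero_right, ip_comm _ (J * u.1)] at this
    simp only [ip_sub_right, ip_smul_right, ip_mul_inv_mul hJ0] at this
    rw [ip_comm u.1 p.1, hu1, ip_mul_left u.1 p.2 J, ip_comm u.1 (J * p.2), hu3] at this
    linarith
  ext i
  · have := congrFun h1 i; simpa [hJ0 i] using this
  · have := congrFun h2 i; simpa [hJ0 i] using this

theorem isContactFormOn_contactVariety (hJ0 : ∀ i, J i ≠ 0) (hκ : 0 < κ) :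
    IsContactFormOn (contactVariety J κ) (alpha J) := by
  intro p hp
  -- The scaling direction is tangent, and `α` takes the value `L` on it.
  refine ⟨⟨(p.1, -p.2), ?_, ?_⟩, fun u hu h => ?_⟩
  · rw [mem_tangentAt_iff hκ hp]
    simp only [mul_neg, ip_neg_right, hp.1, hp.2.1]
    exact ⟨trivial, neg_zero, add_neg_cancel _⟩
  · rw [alpha_apply, ← ip_mul_left, ip_comm]
    exact lagrangian_ne_zero hκ hp
  · refine eq_zero_of_omega_horizontal_eq_zero hJ0 hκ hp hu fun v hv => ?_
    rw [← dForm_alpha J p]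
    exact h v hv

end Variety

end HeisenbergContact
end

noncomputable section
namespace HeisenbergContact

variable {k l : ℕ}

/-! ### Hamiltonian, Reeb and contact Hamiltonian fields in the ambient space. -/

section Fields

variable (J : Fin (k + l) → ℝ)

/-- The Hamiltonian vector field of `f` with respect to the symplectic form `dα`. -/
def hamField (f : Phase k l → ℝ) (p : Phase k l) : Phase k l :=
  (fun i => sgn k l i / J i * fderiv ℝ f p (0, Pi.single i 1),
    fun i => -(sgn k l i / J i * fderiv ℝ f p (Pi.single i 1, 0)))

/-- The Reeb field of `(M_κ, α)`. -/
def reebField (p : Phase k l) : Phase k l := (lagrangian J p)⁻¹ • (p.1, -p.2)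

/-- The coefficient which makes the Hamiltonian field of `f` tangent to the cone `⟨Q, Q⟩ = 0`. -/
def tangencyCoeff (f : Phase k l → ℝ) (p : Phase k l) : ℝ :=
  -(ip p.2 (hamField J f p).2 / integralK J p)

/-- The contact Hamiltonian vector field of `f` on `(M_κ, α)`. -/
def contactField (f : Phase k l → ℝ) (p : Phase k l) : Phase k l :=
  hamField J f p + tangencyCoeff J f p • (0, J⁻¹ * p.1) - f p • reebField J p

/-- The properties of the integrals that are needed to compute their contact Hamiltonian
fields: `f` is quadratic in `Q`, and it is invariant under the flows `(e^t q, e^{-t} Q)` and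
`(q, Q + t J⁻¹ q)`. -/
structure IsInvariantQuadratic (f : Phase k l → ℝ) : Prop where
  contDiff : ContDiff ℝ ω f
  vertical : ∀ p, fderiv ℝ f p (0, p.2) = 2 * f p
  scaling : ∀ p, fderiv ℝ f p (p.1, -p.2) = 0
  shear : ∀ p, fderiv ℝ f p (0, J⁻¹ * p.1) = 0

variable {J}

theorem fderiv_eq_sum_single (L : Phase k l →L[ℝ] ℝ) (v : Phase k l) :
    L v = ∑ i, v.1 i * L (Pi.single i 1, 0) + ∑ i, v.2 i * L (0, Pi.single i 1) := by
  have h1 : v = ∑ i, v.1 i • ((Pi.single i 1, 0) : Phase k l) +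
      ∑ i, v.2 i • ((0, Pi.single i 1) : Phase k l) := by
    ext j
    · simp [Prod.fst_sum, Finset.sum_apply, Pi.single_apply]
    · simp [Prod.snd_sum, Finset.sum_apply, Pi.single_apply]
  conv_lhs => rw [h1]
  simp only [map_add, map_sum, map_smul, smul_eq_mul]

theorem omega_hamField (hJ0 : ∀ i, J i ≠ 0) (f : Phase k l → ℝ) (p v : Phase k l) :
    omega J (hamField J f p) v = -fderiv ℝ f p v := by
  rw [fderiv_eq_sum_single (fderiv ℝ f p) v, omega, ip, ip, hamField, neg_add, ← sub_eq_add_neg,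
    ← Finset.sum_neg_distrib]
  congr 1 <;> refine Finset.sum_congr rfl fun i _ => ?_
  · simp only [Pi.mul_apply]
    have := sgn_mul_self i
    field_simp [hJ0 i]
    linear_combination (-(fderiv ℝ f p) (Pi.single i 1, 0) * v.1 i) * this
  · simp only [Pi.mul_apply]
    have := sgn_mul_self i
    field_simp [hJ0 i]
    linear_combination ((fderiv ℝ f p) (0, Pi.single i 1) * v.2 i) * this

theorem omega_add_left (u v w : Phase k l) : omega J (u + v) w = omega J u w + omega J v w := by
  simp only [← omegaL_apply, map_add, add_apply]

theorem omega_sub_left (u v w : Phase k l) : omega J (u - v) w = omega J u w - omega J v w := by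
  simp only [← omegaL_apply, map_sub, sub_apply]

theorem omega_smul_left (c : ℝ) (u w : Phase k l) : omega J (c • u) w = c * omega J u w := by
  simp only [← omegaL_apply, map_smul, smul_apply, smul_eq_mul]

theorem omega_scaling (p v : Phase k l) :
    omega J (p.1, -p.2) v = -fderiv ℝ (lagrangian J) p v := by
  have h1 : ip p.2 (J * v.1) = ip v.1 (J * p.2) := by rw [← ip_mul_left, ip_comm]
  have h2 : ip v.2 (J * p.1) = ip p.1 (J * v.2) := by rw [← ip_mul_left, ip_comm]
  rw [omega, fderiv_lagrangian, ip_neg_left, h1, h2]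
  ring

theorem omega_shear (hJ0 : ∀ i, J i ≠ 0) (p v : Phase k l) :
    omega J (0, J⁻¹ * p.1) v = ip p.1 v.1 := by
  rw [omega, mul_zero, ip_zero_right, ip_inv_mul_mul hJ0, sub_zero]

theorem omega_reebField (p v : Phase k l) :
    omega J (reebField J p) v = -((lagrangian J p)⁻¹ * fderiv ℝ (lagrangian J) p v) := by
  rw [reebField, omega_smul_left, omega_scaling]; ring

theorem omega_contactField (hJ0 : ∀ i, J i ≠ 0) (f : Phase k l → ℝ) (p v : Phase k l) :
    omega J (contactField J f p) v = -fderiv ℝ f p v + tangencyCoeff J f p * ip p.1 v.1 +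
      f p * (lagrangian J p)⁻¹ * fderiv ℝ (lagrangian J) p v := by
  rw [contactField, omega_sub_left, omega_add_left, omega_smul_left, omega_smul_left,
    omega_hamField hJ0, omega_shear hJ0, omega_reebField]
  ring

theorem contDiff_hamField {f : Phase k l → ℝ} (hf : ContDiff ℝ ω f) :
    ContDiff ℝ ∞ (hamField J f) := by
  have h : ContDiff ℝ ∞ (fderiv ℝ f) :=
    (hf.of_le le_top : ContDiff ℝ ∞ f).fderiv_right (m := ∞) (by simp)
  unfold hamField
  fun_prop

theorem contDiffAt_reebField {p : Phase k l} (hL : lagrangian J p ≠ 0) :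
    ContDiffAt ℝ ∞ (reebField J) p := by
  have h : ContDiffAt ℝ ∞ (lagrangian J) p := contDiff_lagrangian.contDiffAt.of_le le_top
  unfold reebField
  exact (h.inv hL).smul (contDiffAt_fst.prodMk contDiffAt_snd.neg)

theorem contDiffAt_tangencyCoeff {f : Phase k l → ℝ} (hf : ContDiff ℝ ω f) {p : Phase k l}
    (hK : integralK J p ≠ 0) : ContDiffAt ℝ ∞ (tangencyCoeff J f) p := by
  have h : ContDiffAt ℝ ∞ (integralK J) p := contDiff_integralK.contDiffAt.of_le le_top
  unfold tangencyCoeff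
  exact (((contDiff_ip contDiff_snd (contDiff_hamField hf).snd).contDiffAt).div h hK).neg

theorem contDiffAt_contactField {f : Phase k l → ℝ} (hf : ContDiff ℝ ω f) {p : Phase k l}
    (hK : integralK J p ≠ 0) (hL : lagrangian J p ≠ 0) :
    ContDiffAt ℝ ∞ (contactField J f) p := by
  have h1 : ContDiff ℝ ∞ fun p : Phase k l => ((0, J⁻¹ * p.1) : Phase k l) := by
    refine contDiff_const.prodMk (contDiff_pi.2 fun i => ?_)
    simp only [Pi.mul_apply]
    fun_prop
  exact ((contDiff_hamField hf).contDiffAt.add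
    ((contDiffAt_tangencyCoeff hf hK).smul h1.contDiffAt)).sub
    ((hf.of_le le_top).contDiffAt.smul (contDiffAt_reebField hL))

/-- If `i_X ω = ∑ c_i dh_i`, where each `c_i` is stationary or `dh_i` vanishes on `u` and `w`,
then `d (i_X ω) (u, w) = 0`. -/
theorem omega_fderiv_symm {ι : Type*} [Fintype ι] {X : Phase k l → Phase k l}
    {c h : ι → Phase k l → ℝ} {p u w : Phase k l} (hX : DifferentiableAt ℝ X p)
    (hc : ∀ i, DifferentiableAt ℝ (c i) p) (hh : ∀ i, ContDiff ℝ ∞ (h i))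
    (hXc : ∀ x v, omega J (X x) v = ∑ i, c i x * fderiv ℝ (h i) x v)
    (huw : ∀ i, fderiv ℝ (c i) p = 0 ∨ fderiv ℝ (h i) p u = 0 ∧ fderiv ℝ (h i) p w = 0) :
    omega J (fderiv ℝ X p u) w = omega J (fderiv ℝ X p w) u := by
  have key : ∀ a b : Phase k l, omega J (fderiv ℝ X p a) b = ∑ i,
      (c i p * fderiv ℝ (fderiv ℝ (h i)) p a b + fderiv ℝ (c i) p a * fderiv ℝ (h i) p b) := by
    intro a b
    have h1 : HasFDerivAt (fun x => omegaL J (X x) b) _ p :=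
      (((omegaL J).hasFDerivAt.comp p hX.hasFDerivAt).clm_apply (hasFDerivAt_const b p))
    have h2 : HasFDerivAt (fun x => ∑ i, c i x * fderiv ℝ (h i) x b) _ p :=
      HasFDerivAt.fun_sum fun i (_ : i ∈ Finset.univ) => (hc i).hasFDerivAt.fun_mul
        ((((hh i).fderiv_right (m := ∞) (by simp)).differentiable
          (by simp) p).hasFDerivAt.clm_apply (hasFDerivAt_const b p))
    have h3 : (fun x => omegaL J (X x) b) = fun x => ∑ i, c i x * fderiv ℝ (h i) x b :=
      funext fun x => hXc x b
    rw [h3] at h1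
    have h4 := congrArg (fun L => L a) (h1.unique h2)
    simpa [omegaL_apply, sum_apply, mul_comm] using h4
  rw [key, key]
  refine Finset.sum_congr rfl fun i _ => ?_
  have hsymm : IsSymmSndFDerivAt ℝ (h i) p := (hh i).contDiffAt.isSymmSndFDerivAt (by
    rw [minSmoothness_of_isRCLikeNormedField]; exact WithTop.coe_le_coe.2 le_top)
  rw [hsymm u w]
  rcases huw i with h0 | ⟨h0, h1⟩
  · simp [h0]
  · simp [h0, h1]

end Fields

/-! ### Tangency, uniqueness and commutation of the fields on `M_κ`. -/

section OnVariety

variable {J : Fin (k + l) → ℝ} {κ : ℝ} {p : Phase k l}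

theorem fderiv_eq_zero_of_mem_tangentAt (hκ : 0 < κ) (hp : p ∈ contactVariety J κ)
    {v : Phase k l} (hv : v ∈ tangentAt (contactVariety J κ) p) :
    fderiv ℝ (lagrangian J) p v = 0 := by
  rw [fderiv_lagrangian]
  exact ((mem_tangentAt_iff hκ hp v).1 hv).2.2

theorem reebField_mem_tangentAt (hκ : 0 < κ) (hp : p ∈ contactVariety J κ) :
    reebField J p ∈ tangentAt (contactVariety J κ) p := by
  refine Submodule.smul_mem _ _ ?_
  rw [mem_tangentAt_iff hκ hp]
  simp only [mul_neg, ip_neg_right, hp.1, hp.2.1]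
  exact ⟨trivial, neg_zero, add_neg_cancel _⟩

theorem alpha_reebField (hκ : 0 < κ) (hp : p ∈ contactVariety J κ) :
    alpha J p (reebField J p) = 1 := by
  have hL := lagrangian_ne_zero hκ hp
  rw [reebField, map_smul, alpha_apply, ← ip_mul_left, ip_comm, smul_eq_mul]
  exact inv_mul_cancel₀ hL

theorem isReebField_reebField (hκ : 0 < κ) :
    IsReebField (contactVariety J κ) (alpha J) (reebField J) := by
  refine ⟨⟨fun p hp => (contDiffAt_reebField (lagrangian_ne_zero hκ hp)).contDiffWithinAt,
    fun p hp => reebField_mem_tangentAt hκ hp⟩, fun p hp => ⟨alpha_reebField hκ hp,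
    fun v hv => ?_⟩⟩
  rw [dForm_alpha, omega_reebField, fderiv_eq_zero_of_mem_tangentAt hκ hp hv, mul_zero, neg_zero]

/-- The difference of two Reeb fields is horizontal and `ω`-orthogonal to all tangent vectors, so
nondegeneracy forces it to vanish. -/
theorem IsReebField.eq_reebField (hJ0 : ∀ i, J i ≠ 0) (hκ : 0 < κ) {Z : Phase k l → Phase k l}
    (hZ : IsReebField (contactVariety J κ) (alpha J) Z) (hp : p ∈ contactVariety J κ) :
    Z p = reebField J p := by
  have hR := isReebField_reebField (J := J) hκ
  rw [← sub_eq_zero]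
  refine eq_zero_of_omega_horizontal_eq_zero hJ0 hκ hp ⟨Submodule.sub_mem _ (hZ.1.2 p hp)
    (hR.1.2 p hp), ?_⟩ fun v hv => ?_
  · change alpha J p (Z p - reebField J p) = 0
    rw [map_sub, (hZ.2 p hp).1, (hR.2 p hp).1, sub_self]
  · have h1 := (hZ.2 p hp).2 v hv.1
    have h2 := (hR.2 p hp).2 v hv.1
    rw [dForm_alpha] at h1 h2
    rw [omega_sub_left, h1, h2, sub_self]

namespace IsInvariantQuadratic

variable {f g : Phase k l → ℝ}

theorem differentiableAt (hf : IsInvariantQuadratic J f) (p : Phase k l) :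
    DifferentiableAt ℝ f p := hf.contDiff.differentiable (by simp) p

/-- The shear is the Hamiltonian field of `-⟨q,q⟩/2`, so invariance of `f` under it is the same as
invariance of `⟨q,q⟩` under the flow of `f`. -/
theorem fderiv_constraint_zero_hamField (hJ0 : ∀ i, J i ≠ 0) (hf : IsInvariantQuadratic J f)
    (p : Phase k l) : ip p.1 (hamField J f p).1 = 0 := by
  rw [← omega_shear hJ0, omega_swap, omega_hamField hJ0, hf.shear, neg_zero, neg_zero]

/-- The same exchange of roles for the scaling, which is the Hamiltonian field of `L`. -/
theorem fderiv_lagrangian_hamField (hJ0 : ∀ i, J i ≠ 0) (hf : IsInvariantQuadratic J f)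
    (p : Phase k l) : fderiv ℝ (lagrangian J) p (hamField J f p) = 0 := by
  have := omega_scaling (J := J) p (hamField J f p)
  rw [omega_swap, omega_hamField hJ0, hf.scaling] at this
  linarith

/-- Contracting `ω` with the vertical Euler field `(0, Q)` gives `α`, and homogeneity of degree two
gives the factor `2`. -/
theorem alpha_hamField (hJ0 : ∀ i, J i ≠ 0) (hf : IsInvariantQuadratic J f) (p : Phase k l) :
    alpha J p (hamField J f p) = 2 * f p := by
  have h1 : omega J (0, p.2) (hamField J f p) = alpha J p (hamField J f p) := by
    rw [omega, mul_zero, ip_zero_right, sub_zero, alpha_apply]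
  rw [← h1, omega_swap, omega_hamField hJ0, hf.vertical, neg_neg]

theorem contactField_mem_tangentAt (hJ0 : ∀ i, J i ≠ 0) (hκ : 0 < κ)
    (hf : IsInvariantQuadratic J f) (hp : p ∈ contactVariety J κ) :
    contactField J f p ∈ tangentAt (contactVariety J κ) p := by
  refine Submodule.sub_mem _ ?_ (Submodule.smul_mem _ _ (reebField_mem_tangentAt hκ hp))
  rw [mem_tangentAt_iff hκ hp]
  have hK := hp.2.2.1
  refine ⟨?_, ?_, ?_⟩
  · simp [hf.fderiv_constraint_zero_hamField hJ0]
  · simp only [Prod.snd_add, Prod.smul_snd, ip_add_right, ip_smul_right, ip_inv_mul_eq_integralK,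
      tangencyCoeff]
    field_simp
    ring
  · rw [← fderiv_lagrangian, map_add, hf.fderiv_lagrangian_hamField hJ0, map_smul,
      fderiv_lagrangian, ip_zero_left, mul_inv_mul_cancel_of_forall_ne_zero hJ0, hp.1]
    simp

theorem alpha_contactField (hJ0 : ∀ i, J i ≠ 0) (hκ : 0 < κ)
    (hf : IsInvariantQuadratic J f) (hp : p ∈ contactVariety J κ) :
    alpha J p (contactField J f p) = f p := by
  rw [contactField, map_sub, map_add, hf.alpha_hamField hJ0, map_smul, map_smul,
    alpha_reebField hκ hp, alpha_apply, mul_zero, ip_zero_right]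
  simp; ring

theorem omega_contactField_of_mem_tangentAt (hJ0 : ∀ i, J i ≠ 0) (hκ : 0 < κ)
    (hp : p ∈ contactVariety J κ) {v : Phase k l}
    (hv : v ∈ tangentAt (contactVariety J κ) p) :
    omega J (contactField J f p) v = -fderiv ℝ f p v := by
  rw [omega_contactField hJ0, fderiv_eq_zero_of_mem_tangentAt hκ hp hv,
    ((mem_tangentAt_iff hκ hp v).1 hv).1]
  ring

theorem fderivWithin_alpha_apply {Y : Phase k l → Phase k l} (hf : IsInvariantQuadratic J f)
    (hp : p ∈ contactVariety J κ) (hY : ∀ x ∈ contactVariety J κ, alpha J x (Y x) = f x)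
    {v : Phase k l} (hv : v ∈ tangentAt (contactVariety J κ) p) :
    fderivWithin ℝ (fun x => alpha J x (Y x)) (contactVariety J κ) p v = fderiv ℝ f p v := by
  rw [fderivWithin_congr hY (hY p hp),
    fderivWithin_apply_of_mem_tangentAt (hf.differentiableAt p) hv]

/-- On tangent vectors `i_Y dα = -df`, while `α(Y) = f`; hence `𝓛_Y α = 0` and the conformal factor
is `0`. -/
theorem isContactHamiltonianField (hJ0 : ∀ i, J i ≠ 0) (hκ : 0 < κ)
    (hf : IsInvariantQuadratic J f) :
    IsContactHamiltonianField (contactVariety J κ) (alpha J) f (contactField J f) := by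
  refine ⟨⟨⟨fun p hp => (contDiffAt_contactField hf.contDiff hp.2.2.1
    (lagrangian_ne_zero hκ hp)).contDiffWithinAt,
    fun p hp => hf.contactField_mem_tangentAt hJ0 hκ hp⟩, fun _ => 0, contDiffOn_const, ?_⟩,
    fun p hp => hf.alpha_contactField hJ0 hκ hp⟩
  intro p hp v hv
  rw [lieDerivForm, dForm_alpha, omega_contactField_of_mem_tangentAt hJ0 hκ hp hv,
    hf.fderivWithin_alpha_apply hp (fun x hx => hf.alpha_contactField hJ0 hκ hx) hv]
  ring

/-- On horizontal vectors the unknown factor `μ` disappears, so `i_Y dα = -df` there; together with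
`α(Y) = f` and nondegeneracy this determines `Y`. -/
theorem eq_contactField (hJ0 : ∀ i, J i ≠ 0) (hκ : 0 < κ) (hf : IsInvariantQuadratic J f)
    {Y : Phase k l → Phase k l}
    (hY : IsContactHamiltonianField (contactVariety J κ) (alpha J) f Y)
    (hp : p ∈ contactVariety J κ) : Y p = contactField J f p := by
  obtain ⟨⟨⟨-, hYt⟩, μ, -, hμ⟩, hYα⟩ := hY
  rw [← sub_eq_zero]
  refine eq_zero_of_omega_horizontal_eq_zero hJ0 hκ hp ⟨Submodule.sub_mem _ (hYt p hp)
    (hf.contactField_mem_tangentAt hJ0 hκ hp), ?_⟩ fun v hv => ?_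
  · change alpha J p (Y p - contactField J f p) = 0
    rw [map_sub, hYα p hp, hf.alpha_contactField hJ0 hκ hp, sub_self]
  · have h1 := hμ p hp v hv.1
    have h2 : alpha J p v = 0 := hv.2
    rw [lieDerivForm, dForm_alpha, hf.fderivWithin_alpha_apply hp hYα hv.1, h2, mul_zero] at h1
    rw [omega_sub_left, omega_contactField_of_mem_tangentAt hJ0 hκ hp hv.1]
    linarith

theorem fderiv_reebField (hf : IsInvariantQuadratic J f) (p : Phase k l) :
    fderiv ℝ f p (reebField J p) = 0 := by
  rw [reebField, map_smul, hf.scaling, smul_zero]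

theorem fderiv_contactField (hg : IsInvariantQuadratic J g)
    (hgf : fderiv ℝ g p (hamField J f p) = 0) : fderiv ℝ g p (contactField J f p) = 0 := by
  rw [contactField, map_sub, map_add, hgf, map_smul, hg.shear, map_smul, hg.fderiv_reebField]
  simp

theorem omega_fderiv_contactField_symm (hJ0 : ∀ i, J i ≠ 0) (hκ : 0 < κ)
    (hf : IsInvariantQuadratic J f) (hp : p ∈ contactVariety J κ) {u w : Phase k l}
    (hu : u ∈ tangentAt (contactVariety J κ) p) (hw : w ∈ tangentAt (contactVariety J κ) p) :
    omega J (fderiv ℝ (contactField J f) p u) w = omega J (fderiv ℝ (contactField J f) p w) u := by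
  have hL := lagrangian_ne_zero hκ hp
  have hK := hp.2.2.1
  -- Here `i_Y ω = -df + (t/2) d⟨q,q⟩ + (f/L) dL`, with `t` the tangency coefficient. The first
  -- coefficient is constant, and the other two differentials vanish on tangent vectors.
  refine omega_fderiv_symm (ι := Fin 3)
    (c := ![fun _ => -1, fun x => tangencyCoeff J f x / 2, fun x => f x * (lagrangian J x)⁻¹])
    (h := ![f, constraint J 0, lagrangian J])
    ((contDiffAt_contactField hf.contDiff hK hL).differentiableAt (by simp)) ?_ ?_ ?_ ?_
  · intro i
    fin_cases i
    · exact differentiableAt_const _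
    · have h := (contDiffAt_tangencyCoeff (J := J) hf.contDiff hK).differentiableAt (by simp)
      change DifferentiableAt ℝ (fun x => tangencyCoeff J f x / 2) p
      simpa [div_eq_mul_inv] using h.mul_const (2⁻¹ : ℝ)
    · exact (hf.differentiableAt p).mul
        ((contDiff_lagrangian.differentiable (by simp) p).inv hL)
  · intro i
    fin_cases i
    · exact hf.contDiff.of_le le_top
    · exact (contDiff_constraint (J := J) 0).of_le le_top
    · exact contDiff_lagrangian.of_le le_top
  · intro x v
    rw [omega_contactField hJ0, Fin.sum_univ_three]
    change _ = -1 * fderiv ℝ f x v + tangencyCoeff J f x / 2 * fderiv ℝ (constraint J 0) x v +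
      f x * (lagrangian J x)⁻¹ * fderiv ℝ (lagrangian J) x v
    rw [fderiv_constraint_zero]
    ring
  · intro i
    fin_cases i
    · left; exact fderiv_const_apply _
    · right
      have h := fun v => (mem_tangentAt_iff_constraint (J := J) hκ hp v).1
      exact ⟨h u hu 0, h w hw 0⟩
    · right
      exact ⟨fderiv_eq_zero_of_mem_tangentAt hκ hp hu, fderiv_eq_zero_of_mem_tangentAt hκ hp hw⟩

end IsInvariantQuadratic

theorem omega_fderiv_reebField_symm (hκ : 0 < κ) (hp : p ∈ contactVariety J κ) {u w : Phase k l}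
    (hu : u ∈ tangentAt (contactVariety J κ) p) (hw : w ∈ tangentAt (contactVariety J κ) p) :
    omega J (fderiv ℝ (reebField J) p u) w = omega J (fderiv ℝ (reebField J) p w) u := by
  have hL := lagrangian_ne_zero hκ hp
  refine omega_fderiv_symm (ι := Unit) (c := fun _ x => -(lagrangian J x)⁻¹)
    (h := fun _ => lagrangian J) ((contDiffAt_reebField hL).differentiableAt (by simp))
    (fun _ => ((contDiff_lagrangian.differentiable (by simp) p).inv hL).neg)
    (fun _ => contDiff_lagrangian.of_le le_top) ?_ (fun _ => Or.inr
      ⟨fderiv_eq_zero_of_mem_tangentAt hκ hp hu, fderiv_eq_zero_of_mem_tangentAt hκ hp hw⟩)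
  intro x v
  simp [omega_reebField]

/-- Two fields on `M_κ` which preserve `α`, are orthogonal with respect to `dα` and preserve the
Hamiltonian functions of each other commute. -/
theorem lieBracketWithin_eq_zero_of_omega_eq_zero (hJ0 : ∀ i, J i ≠ 0) (hκ : 0 < κ)
    (hp : p ∈ contactVariety J κ) {X Y : Phase k l → Phase k l} {a b : Phase k l → ℝ}
    (hX : DifferentiableAt ℝ X p) (hY : DifferentiableAt ℝ Y p)
    (hXt : ∀ x ∈ contactVariety J κ, X x ∈ tangentAt (contactVariety J κ) x)
    (hYt : ∀ x ∈ contactVariety J κ, Y x ∈ tangentAt (contactVariety J κ) x)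
    (hXs : ∀ u ∈ tangentAt (contactVariety J κ) p, ∀ w ∈ tangentAt (contactVariety J κ) p,
      omega J (fderiv ℝ X p u) w = omega J (fderiv ℝ X p w) u)
    (hYs : ∀ u ∈ tangentAt (contactVariety J κ) p, ∀ w ∈ tangentAt (contactVariety J κ) p,
      omega J (fderiv ℝ Y p u) w = omega J (fderiv ℝ Y p w) u)
    (hXY : ∀ x ∈ contactVariety J κ, omega J (X x) (Y x) = 0)
    (ha : DifferentiableAt ℝ a p) (hb : DifferentiableAt ℝ b p)
    (haX : ∀ x ∈ contactVariety J κ, alpha J x (X x) = a x)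
    (hbY : ∀ x ∈ contactVariety J κ, alpha J x (Y x) = b x)
    (haY : fderiv ℝ a p (Y p) = 0) (hbX : fderiv ℝ b p (X p) = 0) :
    VectorField.lieBracketWithin ℝ X Y (contactVariety J κ) p = 0 := by
  have hXp := hXt p hp
  have hYp := hYt p hp
  have hXd := hX.differentiableWithinAt (s := contactVariety J κ)
  have hYd := hY.differentiableWithinAt (s := contactVariety J κ)
  refine eq_zero_of_omega_horizontal_eq_zero hJ0 hκ hp ⟨?_, ?_⟩ fun w hw => ?_
  · rw [SetLike.mem_coe, mem_tangentAt_iff_constraint hκ hp]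
    intro i
    refine fderiv_apply_lieBracketWithin_eq_zero hp ((contDiff_constraint i).of_le le_top)
      hXd hYd hXp hYp (fun x hx => ?_) (fun x hx => ?_)
    · exact (mem_tangentAt_iff_constraint hκ hx _).1 (hXt x hx) i
    · exact (mem_tangentAt_iff_constraint hκ hx _).1 (hYt x hx) i
  · change alpha J p _ = 0
    rw [apply_lieBracketWithin hp (differentiableAt_alpha J p) hXd hYd hXp hYp ha hb haX hbY,
      haY, hbX, fderiv_alpha_apply, fderiv_alpha_apply]
    have := hXY p hp
    rw [omega, ← alpha_apply, ← alpha_apply] at this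
    linarith
  -- By the symmetry of `DX` and `DY`, `ω([X,Y], w) = ω(DY w, X) - ω(DX w, Y)`. This is minus the
  -- derivative of `ω(X, Y)` along `w`, and `ω(X, Y)` vanishes on `M_κ`.
  · have h1 : HasFDerivAt (fun x => omegaL J (X x) (Y x)) _ p :=
      ((omegaL J).hasFDerivAt.comp p hX.hasFDerivAt).clm_apply hY.hasFDerivAt
    have h2 := fderivWithin_apply_eq_zero_of_const hp h1.hasFDerivWithinAt hXY hw.1
    simp only [add_apply, ContinuousLinearMap.comp_apply, ContinuousLinearMap.flip_apply,
      omegaL_apply] at h2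
    rw [lieBracketWithin_eq_lieBracket_of_tangent hX hY hXp hYp, VectorField.lieBracket,
      omega_sub_left, hYs _ hXp w hw.1, hXs _ hYp w hw.1, omega_swap]
    change omega J (X p) (fderiv ℝ Y p w) + omega J (fderiv ℝ X p w) (Y p) = 0 at h2
    linarith

theorem lieBracketWithin_reebField_contactField (hJ0 : ∀ i, J i ≠ 0) (hκ : 0 < κ)
    (hp : p ∈ contactVariety J κ) {f : Phase k l → ℝ} (hf : IsInvariantQuadratic J f) :
    VectorField.lieBracketWithin ℝ (reebField J) (contactField J f) (contactVariety J κ) p = 0 := by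
  have hL := lagrangian_ne_zero hκ hp
  refine lieBracketWithin_eq_zero_of_omega_eq_zero hJ0 hκ hp (a := fun _ => 1) (b := f)
    ((contDiffAt_reebField hL).differentiableAt (by simp))
    ((contDiffAt_contactField hf.contDiff hp.2.2.1 hL).differentiableAt (by simp))
    (fun x hx => reebField_mem_tangentAt hκ hx)
    (fun x hx => hf.contactField_mem_tangentAt hJ0 hκ hx)
    (fun u hu w hw => omega_fderiv_reebField_symm hκ hp hu hw)
    (fun u hu w hw => hf.omega_fderiv_contactField_symm hJ0 hκ hp hu hw)
    (fun x hx => ?_) (differentiableAt_const _) (hf.differentiableAt p)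
    (fun x hx => alpha_reebField hκ hx) (fun x hx => hf.alpha_contactField hJ0 hκ hx)
    (by simp) (hf.fderiv_reebField p)
  rw [omega_reebField, fderiv_eq_zero_of_mem_tangentAt hκ hx
    (hf.contactField_mem_tangentAt hJ0 hκ hx), mul_zero, neg_zero]

theorem lieBracketWithin_contactField_contactField (hJ0 : ∀ i, J i ≠ 0) (hκ : 0 < κ)
    (hp : p ∈ contactVariety J κ) {f g : Phase k l → ℝ} (hf : IsInvariantQuadratic J f)
    (hg : IsInvariantQuadratic J g) (hgf : ∀ x, fderiv ℝ g x (hamField J f x) = 0)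
    (hfg : ∀ x, fderiv ℝ f x (hamField J g x) = 0) :
    VectorField.lieBracketWithin ℝ (contactField J f) (contactField J g)
      (contactVariety J κ) p = 0 := by
  have hL := lagrangian_ne_zero hκ hp
  refine lieBracketWithin_eq_zero_of_omega_eq_zero hJ0 hκ hp (a := f) (b := g)
    ((contDiffAt_contactField hf.contDiff hp.2.2.1 hL).differentiableAt (by simp))
    ((contDiffAt_contactField hg.contDiff hp.2.2.1 hL).differentiableAt (by simp))
    (fun x hx => hf.contactField_mem_tangentAt hJ0 hκ hx)
    (fun x hx => hg.contactField_mem_tangentAt hJ0 hκ hx)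
    (fun u hu w hw => hf.omega_fderiv_contactField_symm hJ0 hκ hp hu hw)
    (fun u hu w hw => hg.omega_fderiv_contactField_symm hJ0 hκ hp hu hw)
    (fun x hx => ?_) (hf.differentiableAt p) (hg.differentiableAt p)
    (fun x hx => hf.alpha_contactField hJ0 hκ hx) (fun x hx => hg.alpha_contactField hJ0 hκ hx)
    (hf.fderiv_contactField (hfg p)) (hg.fderiv_contactField (hgf p))
  rw [IsInvariantQuadratic.omega_contactField_of_mem_tangentAt hJ0 hκ hx
    (hg.contactField_mem_tangentAt hJ0 hκ hx), hf.fderiv_contactField (hfg x), neg_zero]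

end OnVariety

/-! ### Invariance and involution of the integrals. -/

section Involution

variable {J : Fin (k + l) → ℝ}

/-- Each angular momentum is linear in `Q` and is itself invariant under the scaling and the shear.
-/
theorem isInvariantQuadratic_integralF (hJ0 : ∀ i, J i ≠ 0) (i : Fin (k + l)) :
    IsInvariantQuadratic J (integralF J i) := by
  refine ⟨contDiff_integralF i, fun p => ?_, fun p => ?_, fun p => ?_⟩
  · rw [fderiv_integralF, integralF_eq_sum, Finset.mul_sum]
    refine Finset.sum_congr rfl fun j _ => ?_
    simp only [dAngMom, angMom, Pi.zero_apply]
    ring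
  · rw [fderiv_integralF]
    refine Finset.sum_eq_zero fun j _ => ?_
    simp only [dAngMom, angMom, Pi.neg_apply]
    ring
  · rw [fderiv_integralF]
    refine Finset.sum_eq_zero fun j _ => ?_
    simp only [dAngMom, angMom, Pi.zero_apply, Pi.mul_apply, Pi.inv_apply]
    have := hJ0 i
    have := hJ0 j
    field_simp
    ring

theorem angMom_self (i : Fin (k + l)) (p : Phase k l) : angMom J i i p = 0 := by
  unfold angMom; ring

theorem angMom_swap (i j : Fin (k + l)) (p : Phase k l) : angMom J j i p = -angMom J i j p := by
  unfold angMom; ring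

theorem coeffF_swap (i j : Fin (k + l)) : coeffF J j i = -coeffF J i j := by
  rw [coeffF, coeffF, ← neg_sub (J i ^ 2), div_neg]; ring

theorem hamField_integralF_fst (hJ0 : ∀ i, J i ≠ 0) (i m : Fin (k + l)) (p : Phase k l) :
    (hamField J (integralF J i) p).1 m = sgn k l m * (coeffF J i m * angMom J i m p * p.1 i -
      if i = m then ∑ a, coeffF J i a * angMom J i a p * p.1 a else 0) := by
  have hm := hJ0 m
  have h1 : ∀ a, coeffF J i a * angMom J i a p * dAngMom J i a p (0, Pi.single m 1) =
      (if m = a then J a * (coeffF J i a * angMom J i a p * p.1 i) else 0) -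
        if i = m then J m * (coeffF J i a * angMom J i a p * p.1 a) else 0 := by
    intro a
    simp only [dAngMom, Pi.single_apply, Pi.zero_apply, eq_comm (a := a)]
    split_ifs with h1 h2 h2 <;> first | (subst h2; ring) | ring
  simp only [hamField, fderiv_integralF]
  simp only [h1, Finset.sum_sub_distrib, Finset.sum_ite_eq, Finset.mem_univ, if_true]
  split_ifs with h
  · rw [← Finset.mul_sum]; field_simp
  · simp; field_simp

theorem hamField_integralF_snd (hJ0 : ∀ i, J i ≠ 0) (i m : Fin (k + l)) (p : Phase k l) :
    J m * (hamField J (integralF J i) p).2 m =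
      sgn k l m * (coeffF J i m * angMom J i m p * (J i * p.2 i) -
        if i = m then ∑ a, coeffF J i a * angMom J i a p * (J a * p.2 a) else 0) := by
  have hm := hJ0 m
  have h1 : ∀ a, coeffF J i a * angMom J i a p * dAngMom J i a p (Pi.single m 1, 0) =
      (if i = m then (coeffF J i a * angMom J i a p * (J a * p.2 a)) else 0) -
        if m = a then (coeffF J i a * angMom J i a p * (J i * p.2 i)) else 0 := by
    intro a
    simp only [dAngMom, Pi.single_apply, Pi.zero_apply, eq_comm (a := a)]
    split_ifs with h1 h2 h2 <;> first | (subst h2; ring) | ring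
  simp only [hamField, fderiv_integralF]
  simp only [h1, Finset.sum_sub_distrib, Finset.sum_ite_eq, Finset.mem_univ, if_true]
  split_ifs with h
  · field_simp; ring
  · simp; field_simp

/-- The integrals `f_i` are in involution with respect to the symplectic form `dα`. -/
theorem fderiv_integralF_hamField (hJ0 : ∀ i, J i ≠ 0) (hJ : ∀ i j, i ≠ j → J i ^ 2 ≠ J j ^ 2)
    (i j : Fin (k + l)) (p : Phase k l) :
    fderiv ℝ (integralF J j) p (hamField J (integralF J i) p) = 0 := by
  by_cases hij : i = j
  · subst hij
    have := omega_hamField hJ0 (integralF J i) p (hamField J (integralF J i) p)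
    rw [omega, sub_self] at this
    linarith
  -- The angular momenta close under the Poisson bracket: the derivative of one along the
  -- Hamiltonian field of `f_i` is again an expression in angular momenta alone.
  have h1 : ∀ b, dAngMom J j b p (hamField J (integralF J i) p) =
      sgn k l j * (coeffF J i j * angMom J i j p) * angMom J i b p -
      sgn k l b * (coeffF J i b * angMom J i b p) * angMom J i j p -
      if i = b then sgn k l b * ∑ a, coeffF J i a * angMom J i a p * angMom J j a p else 0 := by
    intro b
    have e1 := hamField_integralF_snd hJ0 i b p
    have e2 := hamField_integralF_snd hJ0 i j p
    have e3 := hamField_integralF_fst hJ0 i b p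
    have e4 := hamField_integralF_fst hJ0 i j p
    rw [if_neg hij, sub_zero] at e2 e4
    have e5 : ∑ a, coeffF J i a * angMom J i a p * angMom J j a p =
        p.1 j * ∑ a, coeffF J i a * angMom J i a p * (J a * p.2 a) -
          J j * p.2 j * ∑ a, coeffF J i a * angMom J i a p * p.1 a := by
      rw [Finset.mul_sum, Finset.mul_sum, ← Finset.sum_sub_distrib]
      refine Finset.sum_congr rfl fun a _ => ?_
      rw [angMom, angMom]; ring
    rw [e5]
    have e6 : angMom J i b p = J b * p.2 b * p.1 i - p.1 b * J i * p.2 i := rfl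
    have e7 : angMom J i j p = J j * p.2 j * p.1 i - p.1 j * J i * p.2 i := rfl
    rw [dAngMom]
    split_ifs at e1 e3 ⊢ with hib
    · linear_combination p.1 j * e1 - p.1 b * e2 - J j * p.2 j * e3 + J b * p.2 b * e4 -
        sgn k l j * (coeffF J i j * angMom J i j p) * e6 +
        sgn k l b * (coeffF J i b * angMom J i b p) * e7
    · linear_combination p.1 j * e1 - p.1 b * e2 - J j * p.2 j * e3 + J b * p.2 b * e4 -
        sgn k l j * (coeffF J i j * angMom J i j p) * e6 +
        sgn k l b * (coeffF J i b * angMom J i b p) * e7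
  rw [fderiv_integralF]
  simp only [h1]
  simp only [mul_sub, mul_ite, mul_zero, Finset.sum_sub_distrib, Finset.sum_ite_eq,
    Finset.mem_univ, if_true, Finset.mul_sum]
  rw [← Finset.sum_sub_distrib, ← Finset.sum_sub_distrib]
  refine Finset.sum_eq_zero fun c _ => ?_
  rw [coeffF_swap i j, angMom_swap i j]
  by_cases hci : c = i
  · subst hci; rw [angMom_self]; ring
  by_cases hcj : c = j
  · subst hcj; rw [angMom_self]; ring
  have d1 := sub_ne_zero.2 (hJ i j hij)
  have d2 := sub_ne_zero.2 (hJ i c (Ne.symm hci))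
  have d3 := sub_ne_zero.2 (hJ j c (Ne.symm hcj))
  -- With `a = J²`, this is `1/((a_j-a_c)(a_i-a_j)) - 1/((a_i-a_c)(a_j-a_c)) -
  -- 1/((a_i-a_j)(a_i-a_c)) = 0`; it multiplies the product of the three momenta of `i, j, c`.
  have hc : sgn k l j * coeffF J j c * coeffF J i j - sgn k l c * coeffF J i c * coeffF J j c -
      sgn k l i * coeffF J i j * coeffF J i c = 0 := by
    have si := sgn_mul_self i
    have sj := sgn_mul_self j
    have sc := sgn_mul_self c
    have t1 : sgn k l j * coeffF J j c * coeffF J i j = 4 * (sgn k l i * sgn k l j * sgn k l c) *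
        (sgn k l j * sgn k l j) / ((J i ^ 2 - J j ^ 2) * (J j ^ 2 - J c ^ 2)) := by
      rw [coeffF, coeffF]; field_simp; ring
    have t2 : sgn k l c * coeffF J i c * coeffF J j c = 4 * (sgn k l i * sgn k l j * sgn k l c) *
        (sgn k l c * sgn k l c) / ((J i ^ 2 - J c ^ 2) * (J j ^ 2 - J c ^ 2)) := by
      rw [coeffF, coeffF]; field_simp; ring
    have t3 : sgn k l i * coeffF J i j * coeffF J i c = 4 * (sgn k l i * sgn k l j * sgn k l c) *
        (sgn k l i * sgn k l i) / ((J i ^ 2 - J j ^ 2) * (J i ^ 2 - J c ^ 2)) := by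
      rw [coeffF, coeffF]; field_simp; ring
    rw [t1, t2, t3, si, sj, sc]
    field_simp
    ring
  linear_combination (angMom J i j p * angMom J i c p * angMom J j c p) * hc

end Involution

end HeisenbergContact
end

noncomputable section
namespace HeisenbergContact

/-! ### Rank of a family of invariant functions along a map. -/

section RankInvariance

variable {E : Type*} [NormedAddCommGroup E] [NormedSpace ℝ E]

theorem fderiv_mem_tangentAt_of_mapsTo {S M : Set E} {Φ : E → E} {p v : E}
    (hΦ : DifferentiableAt ℝ Φ p) (hM : Set.MapsTo Φ S M) (hv : v ∈ tangentAt S p) :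
    fderiv ℝ Φ p v ∈ tangentAt M (Φ p) := by
  have h1 : tangentAt S p ≤ (tangentAt M (Φ p)).comap (fderiv ℝ Φ p).toLinearMap := by
    refine Submodule.span_le.2 fun w hw => Submodule.subset_span ?_
    exact tangentConeAt_mono hM.image_subset
      (hΦ.hasFDerivAt.hasFDerivWithinAt.mapsTo_tangent_cone hw)
  exact h1 hv

/-- Invariance makes the differentials at `p` the pullbacks by `dΦ` of those at `Φ p`, and a linear
image cannot have larger dimension. -/
theorem rankAt_le_rankAt_of_comp_eq [FiniteDimensional ℝ E] {ι : Type*} [Finite ι]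
    {M O : Set E} {f : ι → E → ℝ} {Φ : E → E} {p : E} (hO : IsOpen O) (hp : p ∈ M ∩ O)
    (hΦ : DifferentiableAt ℝ Φ p) (hM : Set.MapsTo Φ (M ∩ O) M)
    (hf : ∀ i, Differentiable ℝ (f i)) (hfΦ : ∀ i, ∀ x ∈ M ∩ O, f i (Φ x) = f i x) :
    rankAt M f p ≤ rankAt M f (Φ p) := by
  have hT : ∀ v ∈ tangentAt M p, fderiv ℝ Φ p v ∈ tangentAt M (Φ p) := fun v hv =>
    fderiv_mem_tangentAt_of_mapsTo hΦ hM (by rwa [tangentAt_inter_open hO hp.2])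
  let T : tangentAt M p →ₗ[ℝ] tangentAt M (Φ p) := (fderiv ℝ Φ p).toLinearMap.restrict hT
  have hd : ∀ i, differentialOn M (f i) p = (differentialOn M (f i) (Φ p)).comp T := by
    intro i
    refine LinearMap.ext fun v => ?_
    change fderivWithin ℝ (f i) M p v = fderivWithin ℝ (f i) M (Φ p) (fderiv ℝ Φ p v)
    rw [fderivWithin_apply_of_mem_tangentAt (hf i p) v.2,
      fderivWithin_apply_of_mem_tangentAt (hf i (Φ p)) (hT v v.2)]
    have h1 := unique_fderivWithin_of_eqOn hp
      ((hf i (Φ p)).hasFDerivAt.comp p hΦ.hasFDerivAt).hasFDerivWithinAt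
      (hf i p).hasFDerivAt.hasFDerivWithinAt (hfΦ i) (v := v)
      (by rw [tangentAt_inter_open hO hp.2]; exact v.2)
    exact h1.symm
  let C : (tangentAt M (Φ p) →ₗ[ℝ] ℝ) →ₗ[ℝ] (tangentAt M p →ₗ[ℝ] ℝ) := LinearMap.lcomp ℝ ℝ T
  have hr : Set.range (fun i => differentialOn M (f i) p) =
      C '' Set.range fun i => differentialOn M (f i) (Φ p) := by
    rw [← Set.range_comp]
    exact congrArg Set.range (funext hd)
  rw [rankAt, rankAt, hr, ← Submodule.map_span]
  exact Submodule.finrank_map_le _ _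

end RankInvariance

variable {k l : ℕ} {J : Fin (k + l) → ℝ} {κ : ℝ} {p : Phase k l}

/-! ### The Heisenberg map as a contact transformation with integrals. -/

section Map

/-- The inverse of the Heisenberg map. -/
def heisenbergInv (J : Fin (k + l) → ℝ) (p : Phase k l) : Phase k l :=
  (heisenbergMap J p.swap).swap

theorem lagrangian_swap (p : Phase k l) : lagrangian J p.swap = lagrangian J p := by
  rw [lagrangian, lagrangian, ← ip_mul_left, ip_comm]; rfl

theorem integralK_swap (p : Phase k l) : integralK J p.swap = integralK J p := by
  rw [integralK, integralK, ip_mul_left, ip_comm]; rfl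

theorem swap_mem_contactVariety (hp : p ∈ contactVariety J κ) :
    p.swap ∈ contactVariety J κ := by
  refine ⟨hp.2.1, hp.1, ?_, ?_⟩
  · rw [integralK_swap]; exact hp.2.2.1
  · rw [lagrangian_swap]; exact hp.2.2.2

theorem swap_mem_mapSource (hp : p ∈ mapTarget J κ) : p.swap ∈ mapSource J κ :=
  ⟨swap_mem_contactVariety hp.1, hp.2⟩

theorem ip_inv_sq_mul (x y : Fin (k + l) → ℝ) : ip (J⁻¹ ^ 2 * x) y = ip (J⁻¹ * x) (J⁻¹ * y) := by
  rw [ip_mul_left x, sq, mul_assoc, ← ip_mul_left x]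

/-- Because of this change of sign, `M_κ` has to contain both levels `L = κ` and `L = -κ`. -/
theorem lagrangian_heisenbergMap (hJ0 : ∀ i, J i ≠ 0) (hQ : ip p.2 p.2 = 0) :
    lagrangian J (heisenbergMap J p) = -lagrangian J p := by
  rw [lagrangian, heisenbergMap, mul_sub, ip_sub_right, mul_smul_comm, ip_smul_right,
    mul_inv_mul_cancel_of_forall_ne_zero hJ0, hQ, ← ip_mul_left, ip_comm (J * p.2), lagrangian]
  ring

theorem integralK_heisenbergMap (hD : ip (J⁻¹ ^ 2 * p.2) p.2 ≠ 0) :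
    integralK J (heisenbergMap J p) = integralK J p := by
  rw [← ip_inv_mul_eq_integralK', heisenbergMap]
  simp only
  rw [← ip_mul_left, ip_sub_right, ip_smul_right, ← ip_inv_sq_mul, div_mul_cancel₀ _ hD, integralK]
  ring

theorem mapsTo_heisenbergMap (hJ0 : ∀ i, J i ≠ 0) :
    Set.MapsTo (heisenbergMap J) (mapSource J κ) (mapTarget J κ) := by
  rintro p ⟨hp, hD⟩
  refine ⟨⟨hp.2.1, ?_, ?_, ?_⟩, hD⟩
  -- With `x = J⁻¹Q`, the square of `λx - q` is `λ(λ⟨x,x⟩ - 2⟨x,q⟩)` for null `q`; `λ` is the value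
  -- that makes it zero.
  · have h1 : ip (J⁻¹ * p.2) (J⁻¹ * p.2) ≠ 0 := by rw [← ip_inv_sq_mul]; exact hD
    simp only [heisenbergMap, ip_sub_left, ip_sub_right, ip_smul_left, ip_smul_right, hp.1,
      ip_inv_sq_mul, ip_comm p.1 (J⁻¹ * p.2)]
    field_simp
    ring
  · rw [integralK_heisenbergMap hD]; exact hp.2.2.1
  · rw [lagrangian_heisenbergMap hJ0 hp.2.1]
    rcases hp.2.2.2 with h | h
    · exact Or.inr (by rw [h])
    · exact Or.inl (by rw [h, neg_neg])

theorem mapsTo_heisenbergInv (hJ0 : ∀ i, J i ≠ 0) :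
    Set.MapsTo (heisenbergInv J) (mapTarget J κ) (mapSource J κ) := fun _ hp =>
  swap_mem_mapSource (mapsTo_heisenbergMap hJ0 (swap_mem_mapSource hp))

theorem heisenbergInv_heisenbergMap (hp : p ∈ mapSource J κ) :
    heisenbergInv J (heisenbergMap J p) = p := by
  have hD : ip (J⁻¹ ^ 2 * p.2) p.2 ≠ 0 := hp.2
  set c := 2 * ip (J⁻¹ * p.2) p.1 / ip (J⁻¹ ^ 2 * p.2) p.2 with hc
  -- For fixed `Q` the passage from `q` to `λJ⁻¹Q - q` is a reflection: recomputing `λ` at the image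
  -- gives the same number, so applying it twice returns `q`.
  have h1 : 2 * ip (J⁻¹ * p.2) (c • (J⁻¹ * p.2) - p.1) / ip (J⁻¹ ^ 2 * p.2) p.2 = c := by
    rw [ip_sub_right, ip_smul_right, ← ip_inv_sq_mul, hc]
    field_simp
    ring
  have h2 : (heisenbergMap J p).swap = (c • (J⁻¹ * p.2) - p.1, p.2) := rfl
  rw [heisenbergInv, h2, heisenbergMap]
  simp only [h1, Prod.swap_prod_mk, sub_sub_cancel]

theorem heisenbergMap_heisenbergInv (hp : p ∈ mapTarget J κ) :
    heisenbergMap J (heisenbergInv J p) = p := by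
  have := heisenbergInv_heisenbergMap (swap_mem_mapSource hp)
  rw [heisenbergInv] at this ⊢
  simpa using congrArg Prod.swap this

/-- The squares of the two angular momenta differ by `(J_i² - J_j²)(q_j² Q_i² - Q_j² q_i²)`. The
denominators cancel, and the sum over `j` is a combination of `⟨q,q⟩` and `⟨Q,Q⟩`. -/
theorem integralF_swap (hJ : ∀ i j, i ≠ j → J i ^ 2 ≠ J j ^ 2) (i : Fin (k + l))
    (h1 : ip p.1 p.1 = 0) (h2 : ip p.2 p.2 = 0) : integralF J i p.swap = integralF J i p := by
  have key : ∀ j ∈ Finset.univ.erase i,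
      sgn k l i * sgn k l j * (J j * p.2 j * p.1 i - p.1 j * J i * p.2 i) ^ 2 /
        (J i ^ 2 - J j ^ 2) -
      sgn k l i * sgn k l j * (J j * p.1 j * p.2 i - p.2 j * J i * p.1 i) ^ 2 /
        (J i ^ 2 - J j ^ 2) =
      sgn k l i * (p.2 i ^ 2 * (sgn k l j * p.1 j * p.1 j) -
        p.1 i ^ 2 * (sgn k l j * p.2 j * p.2 j)) := by
    intro j hj
    have := sub_ne_zero.2 (hJ i j (Finset.ne_of_mem_erase hj).symm)
    field_simp
    ring
  have hsum : ∑ j ∈ Finset.univ.erase i, sgn k l i * (p.2 i ^ 2 * (sgn k l j * p.1 j * p.1 j) -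
      p.1 i ^ 2 * (sgn k l j * p.2 j * p.2 j)) = 0 := by
    rw [Finset.sum_erase _ (by ring), ← Finset.mul_sum, Finset.sum_sub_distrib, ← Finset.mul_sum,
      ← Finset.mul_sum]
    rw [ip] at h1 h2
    rw [h1, h2]; ring
  rw [← Finset.sum_congr rfl key, Finset.sum_sub_distrib] at hsum
  exact (sub_eq_zero.1 hsum).symm

/-- In the angular momenta at `Φ p` the terms with `λ` cancel, and what remains is, up to sign, the
angular momenta at `p.swap`. -/
theorem integralF_heisenbergMap (hJ0 : ∀ i, J i ≠ 0) (hJ : ∀ i j, i ≠ j → J i ^ 2 ≠ J j ^ 2)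
    (i : Fin (k + l)) (hp : p ∈ contactVariety J κ) :
    integralF J i (heisenbergMap J p) = integralF J i p := by
  rw [← integralF_swap hJ i hp.1 hp.2.1]
  refine Finset.sum_congr rfl fun j _ => ?_
  congr 2
  have := hJ0 i
  have := hJ0 j
  simp only [heisenbergMap, Pi.sub_apply, Pi.smul_apply, Pi.mul_apply, Pi.inv_apply, smul_eq_mul,
    Prod.fst_swap, Prod.snd_swap]
  field_simp
  ring

theorem contDiffAt_heisenbergMap (hD : ip (J⁻¹ ^ 2 * p.2) p.2 ≠ 0) :
    ContDiffAt ℝ ∞ (heisenbergMap J) p := by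
  have hJs : ContDiff ℝ ∞ fun x : Phase k l => J⁻¹ * x.2 := by
    refine contDiff_pi.2 fun i => ?_
    simp only [Pi.mul_apply]
    fun_prop
  have hJs2 : ContDiff ℝ ∞ fun x : Phase k l => J⁻¹ ^ 2 * x.2 := by
    refine contDiff_pi.2 fun i => ?_
    simp only [Pi.mul_apply]
    fun_prop
  unfold heisenbergMap
  refine contDiffAt_snd.prodMk (ContDiffAt.sub (ContDiffAt.fun_smul ?_ hJs.contDiffAt) contDiffAt_fst)
  exact ((contDiff_const.mul (contDiff_ip hJs contDiff_fst)).contDiffAt).div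
    (contDiff_ip hJs2 contDiff_snd).contDiffAt hD

theorem contDiffAt_heisenbergInv (hD : ip (J⁻¹ ^ 2 * p.1) p.1 ≠ 0) :
    ContDiffAt ℝ ∞ (heisenbergInv J) p := by
  have h1 : ContDiff ℝ ∞ (Prod.swap : Phase k l → Phase k l) := contDiff_snd.prodMk contDiff_fst
  have h2 : ContDiffAt ℝ ∞ (heisenbergMap J) p.swap := contDiffAt_heisenbergMap hD
  exact h1.contDiffAt.comp p (h2.comp p h1.contDiffAt)

theorem isOpen_setOf_ip_inv_sq_ne_zero {x : Phase k l → Fin (k + l) → ℝ} (hx : Continuous x) :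
    IsOpen {p | ip (J⁻¹ ^ 2 * x p) (x p) ≠ 0} := by
  refine isOpen_ne_fun ?_ continuous_const
  unfold ip
  simp only [Pi.mul_apply]
  fun_prop

theorem bijOn_heisenbergMap (hJ0 : ∀ i, J i ≠ 0) :
    Set.BijOn (heisenbergMap J) (mapSource J κ) (mapTarget J κ) :=
  Set.InvOn.bijOn ⟨fun _ hp => heisenbergInv_heisenbergMap hp,
    fun _ hp => heisenbergMap_heisenbergInv hp⟩ (mapsTo_heisenbergMap hJ0)
    (mapsTo_heisenbergInv hJ0)

theorem isContactTransformation_heisenbergMap (hJ0 : ∀ i, J i ≠ 0) (hκ : 0 < κ) :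
    IsContactTransformation (contactVariety J κ) (alpha J) (mapSource J κ) (mapTarget J κ)
      (heisenbergMap J) where
  open_source := ⟨_, isOpen_setOf_ip_inv_sq_ne_zero continuous_snd, rfl⟩
  open_target := ⟨_, isOpen_setOf_ip_inv_sq_ne_zero continuous_fst, rfl⟩
  smooth p hp := (contDiffAt_heisenbergMap hp.2).contDiffWithinAt
  bijOn := bijOn_heisenbergMap hJ0
  smooth_inv := ⟨heisenbergInv J, fun p hp => (contDiffAt_heisenbergInv hp.2).contDiffWithinAt,
    fun _ hp => heisenbergInv_heisenbergMap hp, fun _ hp => heisenbergMap_heisenbergInv hp⟩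
  pullback p hp v hv := by
    have hd : DifferentiableAt ℝ (heisenbergMap J) p :=
      (contDiffAt_heisenbergMap hp.2).differentiableAt (by simp)
    rw [fderivWithin_apply_of_mem_tangentAt hd hv]
    refine ⟨fderiv_mem_tangentAt_of_mapsTo hd
      (fun x hx => (mapsTo_heisenbergMap (κ := κ) hJ0 hx).1) hv, ?_⟩
    have h1 : (fderiv ℝ (heisenbergMap J) p v).1 = v.2 := by
      have h2 : HasFDerivAt (fun x => (heisenbergMap J x).1) _ p := hd.hasFDerivAt.fst
      have h3 : HasFDerivAt (fun x : Phase k l => x.2)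
        (ContinuousLinearMap.snd ℝ _ _) p := hasFDerivAt_snd
      exact congrArg (fun L => L v) (h2.unique h3)
    have hv' : v ∈ tangentAt (contactVariety J κ) p := by
      rwa [mapSource, tangentAt_inter_open (isOpen_setOf_ip_inv_sq_ne_zero continuous_snd) hp.2]
        at hv
    obtain ⟨-, hv2, hv3⟩ := (mem_tangentAt_iff hκ hp.1 v).1 hv'
    have e1 : ip p.2 (J * v.1) = ip v.1 (J * p.2) := by rw [← ip_mul_left, ip_comm]
    -- The pullback is `λ⟨Q,v₂⟩ - ⟨q,Jv₂⟩`. Tangency to the cone removes the first term, and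
    -- tangency to the level of `L` turns the second into `⟨v₁,JQ⟩`.
    rw [alpha_apply, alpha_apply, h1, e1, heisenbergMap]
    simp only
    rw [ip_sub_left, ip_smul_left, ip_inv_mul_mul hJ0, hv2]
    linarith

theorem differentiable_integralF (i : Fin (k + l)) :
    Differentiable ℝ (integralF J i : Phase k l → ℝ) :=
  (contDiff_integralF i).differentiable (by simp)

theorem integralF_heisenbergInv (hJ0 : ∀ i, J i ≠ 0) (hJ : ∀ i j, i ≠ j → J i ^ 2 ≠ J j ^ 2)
    (i : Fin (k + l)) (hp : p ∈ mapTarget J κ) :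
    integralF J i (heisenbergInv J p) = integralF J i p := by
  rw [← integralF_heisenbergMap hJ0 hJ i (mapsTo_heisenbergInv hJ0 hp).1,
    heisenbergMap_heisenbergInv hp]

theorem rankAt_heisenbergMap (hJ0 : ∀ i, J i ≠ 0) (hJ : ∀ i j, i ≠ j → J i ^ 2 ≠ J j ^ 2)
    (hp : p ∈ mapSource J κ) :
    rankAt (contactVariety J κ) (integralF J) (heisenbergMap J p) =
      rankAt (contactVariety J κ) (integralF J) p := by
  have hΦp := mapsTo_heisenbergMap hJ0 hp
  refine le_antisymm ?_ ?_
  · have := rankAt_le_rankAt_of_comp_eq (M := contactVariety J κ) (f := integralF J)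
      (Φ := heisenbergInv J) (isOpen_setOf_ip_inv_sq_ne_zero (J := J) continuous_fst) hΦp
      ((contDiffAt_heisenbergInv hΦp.2).differentiableAt (by simp))
      (fun x hx => (mapsTo_heisenbergInv hJ0 hx).1) differentiable_integralF
      (fun i x hx => integralF_heisenbergInv hJ0 hJ i hx)
    rwa [heisenbergInv_heisenbergMap hp] at this
  · exact rankAt_le_rankAt_of_comp_eq (M := contactVariety J κ) (f := integralF J)
      (Φ := heisenbergMap J) (isOpen_setOf_ip_inv_sq_ne_zero (J := J) continuous_snd) hp
      ((contDiffAt_heisenbergMap hp.2).differentiableAt (by simp))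
      (fun x hx => (mapsTo_heisenbergMap hJ0 hx).1) differentiable_integralF
      (fun i x hx => integralF_heisenbergMap hJ0 hJ i hx.1)

theorem bijOn_regularLevel (hJ0 : ∀ i, J i ≠ 0) (hJ : ∀ i j, i ≠ j → J i ^ 2 ≠ J j ^ 2)
    (c : Fin (k + l) → ℝ) :
    Set.BijOn (heisenbergMap J) (regularLevel J κ c ∩ mapSource J κ)
      (regularLevel J κ c ∩ mapTarget J κ) := by
  refine Set.InvOn.bijOn (f' := heisenbergInv J)
    ⟨fun _ hp => heisenbergInv_heisenbergMap hp.2, fun _ hp => heisenbergMap_heisenbergInv hp.2⟩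
    ?_ ?_
  · rintro p ⟨⟨⟨hpM, hr⟩, hc⟩, hp⟩
    refine ⟨⟨⟨(mapsTo_heisenbergMap hJ0 hp).1, ?_⟩, fun i => ?_⟩, mapsTo_heisenbergMap hJ0 hp⟩
    · rw [rankAt_heisenbergMap hJ0 hJ hp, hr]
    · rw [integralF_heisenbergMap hJ0 hJ i hpM, hc]
  · rintro p ⟨⟨⟨hpM, hr⟩, hc⟩, hp⟩
    have hp' := mapsTo_heisenbergInv hJ0 hp
    refine ⟨⟨⟨hp'.1, ?_⟩, fun i => ?_⟩, hp'⟩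
    · rw [← rankAt_heisenbergMap hJ0 hJ hp', heisenbergMap_heisenbergInv hp, hr]
    · rw [integralF_heisenbergInv hJ0 hJ i hp, hc]

end Map

end HeisenbergContact
end

noncomputable section
namespace HeisenbergContact

variable {k l : ℕ} {J : Fin (k + l) → ℝ} {κ : ℝ} {p : Phase k l}

/-! ### The two linear relations between the integrals. -/

section Relations

theorem sum_antisymm {ι R : Type*} [Fintype ι] [CommRing R] [CharZero R] [NoZeroDivisors R]
    (c : ι → ι → R) (hc : ∀ i j, c j i = -c i j) : ∑ i, ∑ j, c i j = 0 := by
  have h : ∑ i, ∑ j, c i j = -∑ i, ∑ j, c i j := by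
    conv_lhs => rw [Finset.sum_comm]
    rw [← Finset.sum_neg_distrib]
    refine Finset.sum_congr rfl fun i _ => ?_
    rw [← Finset.sum_neg_distrib]
    exact Finset.sum_congr rfl fun j _ => hc i j
  have h2 : (2 : R) * ∑ i, ∑ j, c i j = 0 := by linear_combination h
  exact (mul_eq_zero.1 h2).resolve_left two_ne_zero

theorem sum_integralF (p : Phase k l) : ∑ i, integralF J i p = 0 := by
  simp only [integralF_eq_sum]
  refine sum_antisymm _ fun i j => ?_
  rw [coeffF_swap i j, angMom_swap i j]; ring

/-- Write `J_i²` as half the sum plus half the difference of `J_i²` and `J_j²`. The sum contributes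
an antisymmetric double sum; the difference cancels the denominator and leaves Lagrange's identity
for `q` and `JQ`. -/
theorem sum_sq_mul_integralF (hJ : ∀ i j, i ≠ j → J i ^ 2 ≠ J j ^ 2) (p : Phase k l) :
    ∑ i, J i ^ 2 * integralF J i p =
      ip p.1 p.1 * ip (J * p.2) (J * p.2) - lagrangian J p ^ 2 := by
  have h1 : ∀ i j, J i ^ 2 * (coeffF J i j / 2 * angMom J i j p ^ 2) =
      (J i ^ 2 + J j ^ 2) / 2 * (coeffF J i j / 2 * angMom J i j p ^ 2) +
        sgn k l i * sgn k l j * angMom J i j p ^ 2 / 2 := by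
    intro i j
    by_cases hij : i = j
    · subst hij; rw [angMom_self]; ring
    · have := sub_ne_zero.2 (hJ i j hij)
      rw [coeffF]
      field_simp
      ring
  have h2 : ∑ i, ∑ j, (J i ^ 2 + J j ^ 2) / 2 * (coeffF J i j / 2 * angMom J i j p ^ 2) = 0 := by
    refine sum_antisymm _ fun i j => ?_
    rw [coeffF_swap i j, angMom_swap i j]; ring
  have h3 : ∑ i, ∑ j, sgn k l i * sgn k l j * angMom J i j p ^ 2 / 2 =
      ip p.1 p.1 * ip (J * p.2) (J * p.2) - lagrangian J p ^ 2 := by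
    have e1 : ∀ i j : Fin (k + l), sgn k l i * sgn k l j * angMom J i j p ^ 2 / 2 =
        (sgn k l i * p.1 i * p.1 i) * (sgn k l j * (J j * p.2 j) * (J j * p.2 j)) / 2 +
        (sgn k l i * (J i * p.2 i) * (J i * p.2 i)) * (sgn k l j * p.1 j * p.1 j) / 2 -
        (sgn k l i * p.1 i * (J i * p.2 i)) * (sgn k l j * p.1 j * (J j * p.2 j)) := by
      intro i j; rw [angMom]; ring
    simp only [e1, Finset.sum_sub_distrib, Finset.sum_add_distrib, ← Finset.sum_div,
      ← Finset.mul_sum, ← Finset.sum_mul, ip, lagrangian, Pi.mul_apply]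
    ring
  simp only [integralF_eq_sum, Finset.mul_sum, h1, Finset.sum_add_distrib]
  rw [h2, h3, zero_add]

theorem sum_fderiv_integralF (p v : Phase k l) : ∑ i, fderiv ℝ (integralF J i) p v = 0 := by
  simp only [fderiv_integralF]
  refine sum_antisymm _ fun i j => ?_
  rw [coeffF_swap i j, angMom_swap i j]
  simp only [dAngMom]
  ring

theorem sum_sq_mul_fderiv_integralF (hJ : ∀ i j, i ≠ j → J i ^ 2 ≠ J j ^ 2)
    (hp : ip p.1 p.1 = 0) (v : Phase k l) :
    ∑ i, J i ^ 2 * fderiv ℝ (integralF J i) p v =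
      2 * ip p.1 v.1 * ip (J * p.2) (J * p.2) -
        2 * lagrangian J p * fderiv ℝ (lagrangian J) p v := by
  have hy : DifferentiableAt ℝ (fun x : Phase k l => ip (J * x.2) (J * x.2)) p := by
    have : ContDiff ℝ ω fun x : Phase k l => J * x.2 := by
      refine contDiff_pi.2 fun i => ?_
      simp only [Pi.mul_apply]
      fun_prop
    exact (contDiff_ip this this).differentiable (by simp) p
  have h1 : HasFDerivAt (fun x => ∑ i, J i ^ 2 * integralF J i x) _ p :=
    HasFDerivAt.fun_sum fun i (_ : i ∈ Finset.univ) =>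
      (differentiable_integralF i p).hasFDerivAt.const_mul (J i ^ 2)
  have h0 : HasFDerivAt (fun x : Phase k l => ip x.1 x.1) (fderiv ℝ (constraint J 0) p) p :=
    ((contDiff_constraint (J := J) 0).differentiable (by simp) p).hasFDerivAt
  have hL : HasFDerivAt (lagrangian J) (fderiv ℝ (lagrangian J) p) p :=
    (contDiff_lagrangian.differentiable (by simp) p).hasFDerivAt
  have h2 := (h0.fun_mul hy.hasFDerivAt).fun_sub
    (hL.fun_mul hL)
  have h4 : (fun x : Phase k l => ∑ i, J i ^ 2 * integralF J i x) = fun x =>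
      ip x.1 x.1 * ip (J * x.2) (J * x.2) - lagrangian J x * lagrangian J x :=
    funext fun x => by rw [sum_sq_mul_integralF hJ, sq (lagrangian J x)]
  rw [h4] at h1
  have h3 := congrArg (fun L => L v) (h1.unique h2)
  simp only [sum_apply, smul_apply, smul_eq_mul, add_apply, sub_apply, hp,
    fderiv_constraint_zero] at h3
  rw [h3]
  ring

/-- Two linear relations with independent coefficients express all members of a family by those
other than `x i₀` and `x i₁`. -/
theorem mem_span_of_two_relations {ι V : Type*} [Fintype ι] [AddCommGroup V] [Module ℝ V]
    {x : ι → V} {a : ι → ℝ} (h1 : ∑ i, x i = 0) (h2 : ∑ i, a i • x i = 0) {i₀ i₁ : ι}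
    (ha : a i₀ ≠ a i₁) {S : Finset ι} (hS : ∀ i, i ∈ S ↔ i ≠ i₀ ∧ i ≠ i₁) (i : ι) :
    x i ∈ Submodule.span ℝ (Set.range fun i : S => x i) := by
  classical
  have key : ∀ j₀ j₁, a j₀ ≠ a j₁ → (∀ i, i ∈ S ↔ i ≠ j₀ ∧ i ≠ j₁) →
      x j₀ ∈ Submodule.span ℝ (Set.range fun i : S => x i) := by
    intro j₀ j₁ hj hSj
    have h3 : ∑ i, (a i - a j₁) • x i = 0 := by
      simp only [sub_smul, Finset.sum_sub_distrib, ← Finset.smul_sum, h1, h2]; simp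
    rw [← Finset.add_sum_erase _ _ (Finset.mem_univ j₀)] at h3
    have h4 : (a j₀ - a j₁) • x j₀ ∈ Submodule.span ℝ (Set.range fun i : S => x i) := by
      rw [eq_neg_of_add_eq_zero_left h3]
      refine Submodule.neg_mem _ (Submodule.sum_mem _ fun i hi => ?_)
      by_cases hij : i = j₁
      · subst hij; simp
      · exact Submodule.smul_mem _ _ (Submodule.subset_span
          ⟨⟨i, (hSj i).2 ⟨Finset.ne_of_mem_erase hi, hij⟩⟩, rfl⟩)
    exact (Submodule.smul_mem_iff _ (sub_ne_zero.2 hj)).1 h4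
  by_cases hi0 : i = i₀
  · subst hi0; exact key _ _ ha hS
  by_cases hi1 : i = i₁
  · subst hi1; exact key _ _ ha.symm fun j => by rw [hS, and_comm]
  · exact Submodule.subset_span ⟨⟨i, (hS i).2 ⟨hi0, hi1⟩⟩, rfl⟩

end Relations

/-! ### The regular set as an independence condition on ambient differentials. -/

section Frame

variable {i₀ i₁ : Fin (k + l)} {S : Finset (Fin (k + l))}

/-- The functions defining `M_κ` together with a subfamily of the integrals. -/
def frame (J : Fin (k + l) → ℝ) (S : Finset (Fin (k + l))) : Fin 3 ⊕ S → Phase k l → ℝ :=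
  Sum.elim (constraint J) fun i => integralF J i

theorem contDiff_frame (i : Fin 3 ⊕ S) : ContDiff ℝ ω (frame J S i) := by
  rcases i with i | i
  · exact contDiff_constraint i
  · exact contDiff_integralF _

theorem card_of_forall_mem_iff (hi : i₀ ≠ i₁) (hS : ∀ i, i ∈ S ↔ i ≠ i₀ ∧ i ≠ i₁) :
    S.card = k + l - 2 := by
  have : S = (Finset.univ.erase i₁).erase i₀ := by
    ext i; simp [hS]
  rw [this, Finset.card_erase_of_mem (by simp [hi]), Finset.card_erase_of_mem (Finset.mem_univ _),
    Finset.card_univ, Fintype.card_fin, Nat.sub_sub]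

theorem differentialOn_apply (i : Fin (k + l)) (v : tangentAt (contactVariety J κ) p) :
    differentialOn (contactVariety J κ) (integralF J i) p v = fderiv ℝ (integralF J i) p v :=
  fderivWithin_apply_of_mem_tangentAt (differentiable_integralF i p) v.2

theorem span_differentialOn_eq (hJ : ∀ i j, i ≠ j → J i ^ 2 ≠ J j ^ 2) (hκ : 0 < κ)
    (hi : i₀ ≠ i₁) (hS : ∀ i, i ∈ S ↔ i ≠ i₀ ∧ i ≠ i₁) (hp : p ∈ contactVariety J κ) :
    Submodule.span ℝ (Set.range fun i => differentialOn (contactVariety J κ) (integralF J i) p) =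
    Submodule.span ℝ
      (Set.range fun i : S => differentialOn (contactVariety J κ) (integralF J i) p) := by
  refine le_antisymm (Submodule.span_le.2 ?_) (Submodule.span_mono ?_)
  · rintro _ ⟨i, rfl⟩
    refine mem_span_of_two_relations (a := fun i => J i ^ 2)
      (x := fun i => differentialOn (contactVariety J κ) (integralF J i) p) ?_ ?_ (hJ _ _ hi) hS i
    · refine LinearMap.ext fun v => ?_
      simp only [LinearMap.sum_apply, differentialOn_apply, LinearMap.zero_apply]
      exact sum_fderiv_integralF p v
    · refine LinearMap.ext fun v => ?_
      simp only [LinearMap.sum_apply, LinearMap.smul_apply, differentialOn_apply,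
        LinearMap.zero_apply, smul_eq_mul]
      rw [sum_sq_mul_fderiv_integralF hJ hp.1, fderiv_eq_zero_of_mem_tangentAt hκ hp v.2,
        ((mem_tangentAt_iff hκ hp v).1 v.2).1]
      ring
  · rintro _ ⟨i, rfl⟩
    exact ⟨i, rfl⟩

/-- The two relations put every differential into the span of those indexed by `S`, so a single
choice of `n - 2` integrals works at all regular points. -/
theorem rankAt_eq_iff_linearIndependent (hJ : ∀ i j, i ≠ j → J i ^ 2 ≠ J j ^ 2) (hκ : 0 < κ)
    (hi : i₀ ≠ i₁) (hS : ∀ i, i ∈ S ↔ i ≠ i₀ ∧ i ≠ i₁) (hp : p ∈ contactVariety J κ) :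
    rankAt (contactVariety J κ) (integralF J) p = k + l - 2 ↔ LinearIndependent ℝ
      fun i : S => differentialOn (contactVariety J κ) (integralF J i) p := by
  rw [linearIndependent_iff_card_eq_finrank_span, rankAt, span_differentialOn_eq hJ hκ hi hS hp,
    Fintype.card_coe, card_of_forall_mem_iff hi hS, Set.finrank]
  exact eq_comm

/-- Tangent vectors are the common kernel of the three constraint differentials, so independence on
the tangent space is independence modulo those three. -/
theorem linearIndependent_differentialOn_iff (hκ : 0 < κ) (hp : p ∈ contactVariety J κ) :
    (LinearIndependent ℝ
      fun i : S => differentialOn (contactVariety J κ) (integralF J i) p) ↔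
    LinearIndependent ℝ fun i => fderiv ℝ (frame J S i) p := by
  classical
  constructor
  · intro h
    rw [Fintype.linearIndependent_iff] at h ⊢
    intro g hg
    have hg' : ∀ v, ∑ i : Fin 3, g (Sum.inl i) * fderiv ℝ (constraint J i) p v +
        ∑ i : S, g (Sum.inr i) * fderiv ℝ (integralF J i) p v = 0 := by
      intro v
      have := congrArg (fun L => L v) hg
      simpa [frame, sum_apply] using this
    have h1 : ∀ i : S, g (Sum.inr i) = 0 := by
      refine h (fun i => g (Sum.inr i)) (LinearMap.ext fun v => ?_)
      have h2 := hg' v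
      rw [Finset.sum_eq_zero fun i _ => by
        rw [(mem_tangentAt_iff_constraint hκ hp v).1 v.2 i, mul_zero], zero_add] at h2
      simpa only [LinearMap.sum_apply, LinearMap.smul_apply, differentialOn_apply, smul_eq_mul,
        LinearMap.zero_apply] using h2
    have h3 := Fintype.linearIndependent_iff.1 (linearIndependent_fderiv_constraint hκ hp)
      (fun i => g (Sum.inl i)) (ContinuousLinearMap.ext fun v => by
        simpa [h1, sum_apply] using hg' v)
    rintro (i | i)
    exacts [h3 i, h1 i]
  · intro h
    have hs := surjective_pi_of_linearIndependent h
    rw [Fintype.linearIndependent_iff]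
    intro g hg i
    -- A vector dual to the `i`-th differential and annihilated by all others; being killed by the
    -- constraints, it is tangent.
    obtain ⟨v, hv⟩ := hs (Pi.single (Sum.inr i) 1)
    have hvT : v ∈ tangentAt (contactVariety J κ) p := by
      rw [mem_tangentAt_iff_constraint hκ hp]
      intro j
      simpa [frame] using congrFun hv (Sum.inl j)
    have hvS : ∀ j : S, fderiv ℝ (integralF J j) p v = if j = i then 1 else 0 := by
      intro j
      simpa [frame, Pi.single_apply] using congrFun hv (Sum.inr j)
    have h1 := LinearMap.congr_fun hg ⟨v, hvT⟩
    simpa [LinearMap.sum_apply, differentialOn_apply, hvS] using h1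

theorem regularSet_eq (hJ : ∀ i j, i ≠ j → J i ^ 2 ≠ J j ^ 2) (hκ : 0 < κ)
    (hi : i₀ ≠ i₁) (hS : ∀ i, i ∈ S ↔ i ≠ i₀ ∧ i ≠ i₁) :
    regularSet J κ = contactVariety J κ ∩
      {p | LinearIndependent ℝ fun i => fderiv ℝ (frame J S i) p} := by
  ext p
  refine and_congr_right fun hp => ?_
  rw [rankAt_eq_iff_linearIndependent hJ hκ hi hS hp, linearIndependent_differentialOn_iff hκ hp]
  rfl

theorem isOpen_setOf_linearIndependent_frame :
    IsOpen {p | LinearIndependent ℝ fun i => fderiv ℝ (frame J S i) p} := by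
  have hc : Continuous fun x => (fun i => fderiv ℝ (frame J S i) x) :=
    continuous_pi fun i => (contDiff_frame i).continuous_fderiv (by simp)
  exact isOpen_setOfPred_linearIndependent.preimage hc

end Frame

end HeisenbergContact
end

noncomputable section
namespace HeisenbergContact

variable {k l : ℕ} {J : Fin (k + l) → ℝ} {κ : ℝ} {p : Phase k l}

/-! ### Coprime rational functions force independence. -/

section Criterion

open Polynomial

/-- The node polynomials `∏_{j ≠ i} (X - J_j²)`. -/
def nodePoly (J : Fin (k + l) → ℝ) (i : Fin (k + l)) : ℝ[X] :=
  Lagrange.nodal (Finset.univ.erase i) fun j => J j ^ 2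

/-- The numerator of the rational function `∑ τ_i w_i / (X - J_i²)`. -/
def numPoly (J w : Fin (k + l) → ℝ) : ℝ[X] := ∑ i, C (sgn k l i * w i) * nodePoly J i

theorem natDegree_nodePoly (i : Fin (k + l)) : (nodePoly J i).natDegree = k + l - 1 := by
  rw [nodePoly, Lagrange.natDegree_nodal, Finset.card_erase_of_mem (Finset.mem_univ _),
    Finset.card_univ, Fintype.card_fin]

theorem natDegree_numPoly_le (w : Fin (k + l) → ℝ) : (numPoly J w).natDegree ≤ k + l - 1 := by
  refine natDegree_sum_le_of_forall_le _ _ fun i _ => ?_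
  refine natDegree_mul_le.trans ?_
  rw [natDegree_C, zero_add, natDegree_nodePoly]

/-- The node polynomials are monic of degree `n - 1`. For `w = q * JQ` this coefficient is `L ≠ 0`;
for `w = q * q` it is `⟨q,q⟩ = 0`. -/
theorem coeff_numPoly (w : Fin (k + l) → ℝ) :
    (numPoly J w).coeff (k + l - 1) = ∑ i, sgn k l i * w i := by
  rw [numPoly, finsetSum_coeff]
  refine Finset.sum_congr rfl fun i _ => ?_
  have h : (nodePoly J i).coeff (k + l - 1) = 1 := by
    rw [← natDegree_nodePoly (J := J) i]
    exact (Lagrange.nodal_monic (s := Finset.univ.erase i) (v := fun j => J j ^ 2)).coeff_natDegree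
  rw [coeff_C_mul, h, mul_one]

theorem eval_nodePoly_of_ne {i j : Fin (k + l)} (hij : i ≠ j) :
    (nodePoly J i).eval (J j ^ 2) = 0 :=
  Lagrange.eval_nodal_at_node (v := fun j => J j ^ 2) (Finset.mem_erase.2 ⟨hij.symm, Finset.mem_univ _⟩)

theorem eval_nodePoly_self_ne_zero (hJ : ∀ i j, i ≠ j → J i ^ 2 ≠ J j ^ 2) (i : Fin (k + l)) :
    (nodePoly J i).eval (J i ^ 2) ≠ 0 := by
  rw [nodePoly, Lagrange.eval_nodal]
  exact Finset.prod_ne_zero_iff.2 fun j hj =>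
    sub_ne_zero.2 (hJ i j (Finset.ne_of_mem_erase hj).symm)

theorem eval_numPoly_node (w : Fin (k + l) → ℝ) (i : Fin (k + l)) :
    (numPoly J w).eval (J i ^ 2) = sgn k l i * w i * (nodePoly J i).eval (J i ^ 2) := by
  rw [numPoly, eval_finsetSum, Finset.sum_eq_single i]
  · simp
  · intro j _ hj
    rw [eval_mul, eval_nodePoly_of_ne hj, mul_zero]
  · simp

theorem eval_numPoly (w : Fin (k + l) → ℝ) (x : ℝ) :
    (numPoly J w).eval x = ∑ i, sgn k l i * w i * (nodePoly J i).eval x := by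
  rw [numPoly, eval_finsetSum]
  exact Finset.sum_congr rfl fun i _ => by rw [eval_mul, eval_C]

theorem sub_mul_eval_nodePoly (i : Fin (k + l)) (x : ℝ) :
    (x - J i ^ 2) * (nodePoly J i).eval x =
      (Lagrange.nodal Finset.univ fun j => J j ^ 2).eval x := by
  rw [Lagrange.nodal_eq_mul_nodal_erase (Finset.mem_univ i), eval_mul]
  simp [nodePoly]

/-- The rational functions `A = ∑ τ q_i² / (X - J_i²)`, `C = ∑ τ q_i J_i Q_i / (X - J_i²)` and
their analogues `E`, `G` for a variation `η` of `J Q` which preserves the integrals satisfy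
`A E = C G`. -/
theorem numPoly_mul_eq (hJ0 : ∀ i, J i ≠ 0) (hJ : ∀ i j, i ≠ j → J i ^ 2 ≠ J j ^ 2)
    {η : Fin (k + l) → ℝ} (hη : ∀ i, fderiv ℝ (integralF J i) p (0, J⁻¹ * η) = 0) :
    numPoly J (p.1 * p.1) * numPoly J (J * p.2 * η) =
      numPoly J (p.1 * (J * p.2)) * numPoly J (p.1 * η) := by
  refine Polynomial.funext fun x => ?_
  rw [eval_mul, eval_mul]
  simp only [eval_numPoly, Pi.mul_apply]
  set D : Fin (k + l) → ℝ := fun i => (nodePoly J i).eval x with hD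
  set N := (Lagrange.nodal Finset.univ fun j => J j ^ 2).eval x with hN
  have hDN : ∀ i, (x - J i ^ 2) * D i = N := fun i => sub_mul_eval_nodePoly i x
  let c : Fin (k + l) → Fin (k + l) → ℝ := fun i j =>
    coeffF J i j * angMom J i j p * (η j * p.1 i - p.1 j * η i)
  have hc : ∀ i, ∑ j, c i j = 0 := by
    intro i
    rw [← hη i, fderiv_integralF]
    refine Finset.sum_congr rfl fun j _ => ?_
    have := hJ0 i
    have := hJ0 j
    simp only [c, dAngMom, Pi.zero_apply, Pi.mul_apply, Pi.inv_apply]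
    field_simp
    ring
  -- The identity is the derivative of `∑ f_i/(X - J_i²) = A B - C²` along `η`, where `B = ∑ τ
  -- (J_iQ_i)²/(X - J_i²)`. Each term splits into `N c_ij D_i`, which sums to zero over `j`, and a
  -- part antisymmetric in `i, j`.
  have hterm : ∀ i j, 2 * (sgn k l i * (p.1 i * p.1 i) * D i *
        (sgn k l j * (J j * p.2 j * η j) * D j) -
      sgn k l i * (p.1 i * (J i * p.2 i)) * D i * (sgn k l j * (p.1 j * η j) * D j)) =
      N * (c i j * D i) + (sgn k l i * sgn k l j * D i * D j *
        ((p.1 i ^ 2 * (J j * p.2 j * η j) - p.1 j ^ 2 * (J i * p.2 i * η i)) +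
        (p.1 j * (J j * p.2 j) * (p.1 i * η i) - p.1 i * (J i * p.2 i) * (p.1 j * η j))) +
        N * (- c i j * (D i + D j) / 2)) := by
    intro i j
    have hcN : N * (c i j * (D i - D j)) =
        2 * (sgn k l i * sgn k l j) * (angMom J i j p * (η j * p.1 i - p.1 j * η i)) *
          (D i * D j) := by
      by_cases hij : i = j
      · subst hij; rw [angMom_self]; ring
      · have hne := sub_ne_zero.2 (hJ i j hij)
        have h1 : N * (D i - D j) = (J i ^ 2 - J j ^ 2) * (D i * D j) := by
          linear_combination -D i * hDN j + D j * hDN i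
        have h2 : coeffF J i j * (J i ^ 2 - J j ^ 2) = 2 * (sgn k l i * sgn k l j) := by
          rw [coeffF]; field_simp
        simp only [c]
        linear_combination (coeffF J i j * angMom J i j p * (η j * p.1 i - p.1 j * η i)) * h1 +
          (angMom J i j p * (η j * p.1 i - p.1 j * η i)) * (D i * D j) * h2
    have hA : angMom J i j p = J j * p.2 j * p.1 i - p.1 j * J i * p.2 i := rfl
    rw [hA] at hcN
    linear_combination -hcN / 2
  rw [← sub_eq_zero, Finset.sum_mul_sum, Finset.sum_mul_sum, ← Finset.sum_sub_distrib]
  simp only [← Finset.sum_sub_distrib]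
  have h2 : (2 : ℝ) * ∑ i, ∑ j, (sgn k l i * (p.1 i * p.1 i) * D i *
        (sgn k l j * (J j * p.2 j * η j) * D j) -
      sgn k l i * (p.1 i * (J i * p.2 i)) * D i * (sgn k l j * (p.1 j * η j) * D j)) = 0 := by
    simp only [Finset.mul_sum, hterm, Finset.sum_add_distrib]
    have s1 : ∑ i, ∑ j, N * (c i j * D i) = 0 := by
      simp only [← Finset.mul_sum, ← Finset.sum_mul, hc]; simp
    rw [s1, zero_add, ← Finset.sum_add_distrib]
    simp only [← Finset.sum_add_distrib]
    refine sum_antisymm _ fun i j => ?_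
    simp only [c]
    rw [coeffF_swap i j, angMom_swap i j]
    ring
  exact (mul_eq_zero.1 h2).resolve_left two_ne_zero

theorem isCoprime_numPoly_apply_ne_zero {w w' : Fin (k + l) → ℝ}
    (h : IsCoprime (numPoly J (w * w)) (numPoly J (w * w'))) (i : Fin (k + l)) : w i ≠ 0 := by
  intro hw
  obtain ⟨a, b, hab⟩ := h
  have := congrArg (eval (J i ^ 2)) hab
  simp [eval_numPoly_node, hw] at this

/-- In `A E = C G`, coprimality gives `C ∣ E`. As `C` already has the maximal degree `n - 1`, the
quotient is a constant `t`; then `G = t A`, and evaluation at the nodes yields `η = t q`. -/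
theorem exists_eq_smul_of_fderiv_integralF_eq_zero (hJ0 : ∀ i, J i ≠ 0)
    (hJ : ∀ i j, i ≠ j → J i ^ 2 ≠ J j ^ 2) (hL : lagrangian J p ≠ 0)
    (hcop : IsCoprime (numPoly J (p.1 * p.1)) (numPoly J (p.1 * (J * p.2))))
    {η : Fin (k + l) → ℝ} (hη : ∀ i, fderiv ℝ (integralF J i) p (0, J⁻¹ * η) = 0) :
    ∃ t : ℝ, η = t • p.1 := by
  have hmul := numPoly_mul_eq hJ0 hJ hη
  set u := numPoly J (p.1 * p.1) with hu
  set v := numPoly J (p.1 * (J * p.2)) with hv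
  have hvc : v.coeff (k + l - 1) ≠ 0 := by
    rw [hv, coeff_numPoly]
    convert hL using 1
    rw [lagrangian, ip]
    exact Finset.sum_congr rfl fun i _ => by simp; ring
  have hv0 : v ≠ 0 := by intro h; rw [h] at hvc; simp at hvc
  have hvd : v.natDegree = k + l - 1 :=
    le_antisymm (natDegree_numPoly_le _) (le_natDegree_of_ne_zero hvc)
  obtain ⟨s, hs⟩ : v ∣ numPoly J (J * p.2 * η) :=
    hcop.symm.dvd_of_dvd_mul_left ⟨_, hmul⟩
  have hsd : s.natDegree = 0 := by
    by_cases hs0 : s = 0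
    · simp [hs0]
    · have h1 := natDegree_mul hv0 hs0
      rw [← hs, hvd] at h1
      have h2 := natDegree_numPoly_le (J := J) (J * p.2 * η)
      omega
  obtain ⟨t, rfl⟩ := natDegree_eq_zero.1 hsd
  have hg : numPoly J (p.1 * η) = C t * u := by
    refine mul_left_cancel₀ hv0 ?_
    rw [← hmul, hs]; ring
  refine ⟨t, funext fun i => ?_⟩
  have hq : p.1 i ≠ 0 := isCoprime_numPoly_apply_ne_zero hcop i
  have h1 := congrArg (eval (J i ^ 2)) hg
  rw [eval_mul, eval_C, hu, eval_numPoly_node, eval_numPoly_node] at h1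
  have h2 := eval_nodePoly_self_ne_zero hJ i
  have h3 := sgn_ne_zero (k := k) (l := l) i
  simp only [Pi.mul_apply] at h1
  have h4 : (sgn k l i * p.1 i * (nodePoly J i).eval (J i ^ 2)) * (η i - t * p.1 i) = 0 := by
    linear_combination h1
  rcases mul_eq_zero.1 h4 with h5 | h5
  · exact absurd h5 (mul_ne_zero (mul_ne_zero h3 hq) h2)
  · simpa using sub_eq_zero.1 h5

variable {i₀ i₁ : Fin (k + l)} {S : Finset (Fin (k + l))}

/-- The vertical derivative `T` of the integrals has at most a line as kernel, so its range has
dimension at least `n - 1`. A relation `c` independent of `∑ = 0` would confine the range to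
dimension `n - 2`. -/
theorem eq_of_sum_mul_fderiv_integralF_eq_zero (hJ0 : ∀ i, J i ≠ 0)
    (hJ : ∀ i j, i ≠ j → J i ^ 2 ≠ J j ^ 2) (hL : lagrangian J p ≠ 0)
    (hcop : IsCoprime (numPoly J (p.1 * p.1)) (numPoly J (p.1 * (J * p.2))))
    {c : Fin (k + l) → ℝ}
    (hc : ∀ η, ∑ i, c i * fderiv ℝ (integralF J i) p (0, J⁻¹ * η) = 0) (a b : Fin (k + l)) :
    c a = c b := by
  by_contra hab
  have hne : a ≠ b := fun h => hab (by rw [h])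
  let T : (Fin (k + l) → ℝ) →ₗ[ℝ] (Fin (k + l) → ℝ) :=
    { toFun := fun η i => fderiv ℝ (integralF J i) p (0, J⁻¹ * η)
      map_add' := fun x y => by
        ext i
        have : ((0, J⁻¹ * (x + y)) : Phase k l) = (0, J⁻¹ * x) + (0, J⁻¹ * y) := by
          rw [mul_add]; simp
        rw [this, map_add]; rfl
      map_smul' := fun r x => by
        ext i
        have : ((0, J⁻¹ * (r • x)) : Phase k l) = r • (0, J⁻¹ * x) := by
          rw [mul_smul_comm]; simp
        rw [this, map_smul]; rfl }
  have hker : LinearMap.ker T ≤ Submodule.span ℝ {p.1} := by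
    intro η hη
    obtain ⟨t, ht⟩ := exists_eq_smul_of_fderiv_integralF_eq_zero hJ0 hJ hL hcop
      (fun i => congrFun (LinearMap.mem_ker.1 hη) i)
    exact Submodule.mem_span_singleton.2 ⟨t, ht.symm⟩
  have hkerd : Module.finrank ℝ (LinearMap.ker T) ≤ 1 :=
    (Submodule.finrank_mono hker).trans ((finrank_span_le_card {p.1}).trans (by simp))
  let ℓ : (Fin (k + l) → ℝ) →ₗ[ℝ] ℝ × ℝ :=
    (∑ i, LinearMap.proj i).prod (∑ i, c i • LinearMap.proj i)
  have hℓ : ∀ x, ℓ x = (∑ i, x i, ∑ i, c i * x i) := fun x => by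
    simp [ℓ]
  have hℓs : LinearMap.range ℓ = ⊤ := by
    rw [LinearMap.range_eq_top]
    rintro ⟨y, z⟩
    have hd := sub_ne_zero.2 hab
    refine ⟨Pi.single a ((z - c b * y) / (c a - c b)) +
      Pi.single b (y - (z - c b * y) / (c a - c b)), ?_⟩
    rw [hℓ]
    simp only [Pi.add_apply, mul_add, Finset.sum_add_distrib, Finset.sum_pi_single',
      Finset.mem_univ, if_true]
    have h1 : ∀ (d : Fin (k + l)) (r : ℝ),
        ∑ i, c i * (Pi.single d r : Fin (k + l) → ℝ) i = c d * r := by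
      intro d r
      rw [Finset.sum_eq_single d]
      · simp
      · intro i _ hi; simp [hi]
      · simp
    rw [h1, h1]
    ext
    · simp
    · simp only; field_simp; ring
  have hrange : LinearMap.range T ≤ LinearMap.ker ℓ := by
    rintro _ ⟨η, rfl⟩
    rw [LinearMap.mem_ker, hℓ]
    exact Prod.ext (sum_fderiv_integralF p _) (hc η)
  have r1 := LinearMap.finrank_range_add_finrank_ker T
  have r2 := LinearMap.finrank_range_add_finrank_ker ℓ
  rw [hℓs, finrank_top, Module.finrank_prod, Module.finrank_self] at r2
  have r3 := Submodule.finrank_mono hrange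
  omega

/-- If the rational functions `∑ τ q_i² / (X - J_i²)` and `∑ τ q_i J_i Q_i / (X - J_i²)` have
coprime numerators, the integrals are independent. -/
theorem linearIndependent_frame_of_isCoprime (hJ0 : ∀ i, J i ≠ 0)
    (hJ : ∀ i j, i ≠ j → J i ^ 2 ≠ J j ^ 2) (hκ : 0 < κ) (hi : i₀ ≠ i₁)
    (hS : ∀ i, i ∈ S ↔ i ≠ i₀ ∧ i ≠ i₁) (hp : p ∈ contactVariety J κ)
    (hcop : IsCoprime (numPoly J (p.1 * p.1)) (numPoly J (p.1 * (J * p.2)))) :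
    LinearIndependent ℝ fun i => fderiv ℝ (frame J S i) p := by
  classical
  have hL := lagrangian_ne_zero hκ hp
  have hK := hp.2.2.1
  rw [Fintype.linearIndependent_iff]
  intro g hg
  have hg' : ∀ v : Phase k l, g (Sum.inl 0) * (2 * ip p.1 v.1) +
      g (Sum.inl 1) * (2 * ip p.2 v.2) + g (Sum.inl 2) * fderiv ℝ (lagrangian J) p v +
      ∑ i : S, g (Sum.inr i) * fderiv ℝ (integralF J i) p v = 0 := by
    intro v
    have := congrArg (fun L => L v) hg
    simp only [Fintype.sum_sum_type, Fin.sum_univ_three, frame, Sum.elim_inl,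
      Sum.elim_inr] at this
    simp only [add_apply, sum_apply,
      smul_apply, fderiv_constraint_zero, fderiv_constraint_one,
      smul_eq_mul] at this
    exact this
  have hL0 : ∀ η, fderiv ℝ (lagrangian J) p (0, J⁻¹ * η) = ip p.1 η := by
    intro η
    rw [fderiv_lagrangian, ip_zero_left, mul_inv_mul_cancel_of_forall_ne_zero hJ0, zero_add]
  have h1 : g (Sum.inl 1) = 0 := by
    -- The shear direction is annihilated by every `df_i`, by `d⟨q,q⟩` and by `dL`, but not by
    -- `d⟨Q,Q⟩`.
    have := hg' (0, J⁻¹ * p.1)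
    rw [Finset.sum_eq_zero fun i _ => by
      rw [(isInvariantQuadratic_integralF hJ0 _).shear, mul_zero], hL0, hp.1,
      ip_zero_right, ip_inv_mul_eq_integralK] at this
    have h2 : g (Sum.inl 1) * integralK J p = 0 := by linarith
    exact (mul_eq_zero.1 h2).resolve_right hK
  let c : Fin (k + l) → ℝ := fun i => if h : i ∈ S then g (Sum.inr ⟨i, h⟩) else 0
  have hcsum : ∀ v, ∑ i : S, g (Sum.inr i) * fderiv ℝ (integralF J i) p v =
      ∑ i, c i * fderiv ℝ (integralF J i) p v := by
    intro v
    rw [← Finset.sum_subset (Finset.subset_univ S) fun i _ hi => by simp [c, hi],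
      ← Finset.sum_coe_sort S]
    exact Finset.sum_congr rfl fun i _ => by simp [c]
  -- On vertical vectors `∑ J_i² df_i = -2 L dL`. This absorbs `dL` into the integrals and leaves a
  -- relation among the `df_i` only, whose coefficients must all be equal.
  have hconst := eq_of_sum_mul_fderiv_integralF_eq_zero hJ0 hJ hL hcop
    (c := fun i => 2 * lagrangian J p * c i - g (Sum.inl 2) * J i ^ 2) (fun η => by
      have e1 := hg' (0, J⁻¹ * η)
      have e2 := sum_sq_mul_fderiv_integralF hJ hp.1 (0, J⁻¹ * η)
      rw [hcsum, h1, hL0] at e1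
      rw [hL0] at e2
      simp only [ip_zero_right, mul_zero, zero_mul, add_zero, zero_add, zero_sub] at e1 e2
      simp only [sub_mul, Finset.sum_sub_distrib, mul_assoc, ← Finset.mul_sum]
      rw [e2]
      linear_combination 2 * lagrangian J p * e1)
  have c0 : c i₀ = 0 := by simp [c, hS]
  have c1 : c i₁ = 0 := by simp [c, hS]
  -- The extended coefficients vanish at both omitted indices, where the values of `J²` differ;
  -- comparing the two gives `g 2 = 0`.
  have h2 : g (Sum.inl 2) = 0 := by
    have := hconst i₀ i₁
    simp only [c0, c1, mul_zero, zero_sub] at this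
    have h3 : g (Sum.inl 2) * (J i₀ ^ 2 - J i₁ ^ 2) = 0 := by linear_combination -this
    exact (mul_eq_zero.1 h3).resolve_right (sub_ne_zero.2 (hJ _ _ hi))
  have hcz : ∀ i, c i = 0 := by
    intro i
    have := hconst i i₀
    simp only [h2, c0, mul_zero, zero_mul, sub_zero] at this
    exact (mul_eq_zero.1 this).resolve_left (mul_ne_zero two_ne_zero hL)
  have hr : ∀ i : S, g (Sum.inr i) = 0 := by
    intro i
    have := hcz i
    simpa [c] using this
  have h0 : g (Sum.inl 0) = 0 := by
    have := hg' (J⁻¹ * p.2, 0)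
    simp only [h1, h2, hr, zero_mul, add_zero, Finset.sum_const_zero,
      ip_inv_mul_eq_integralK'] at this
    have h2 : g (Sum.inl 0) * integralK J p = 0 := by linarith
    exact (mul_eq_zero.1 h2).resolve_right hK
  rintro (i | i)
  · fin_cases i
    exacts [h0, h1, h2]
  · exact hr i

end Criterion

end HeisenbergContact
end

noncomputable section
namespace HeisenbergContact

variable {k l : ℕ} {J : Fin (k + l) → ℝ} {κ : ℝ} {p : Phase k l}

/-! ### Density and full measure of the regular set. -/

section Density

open Polynomial

theorem exists_mem_forall_of_forall_dense {X ι : Type*} [TopologicalSpace X] {M : Set X}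
    (s : Finset ι) {O : ι → Set X} (hO : ∀ i ∈ s, IsOpen (O i))
    (hd : ∀ i ∈ s, ∀ W, IsOpen W → (M ∩ W).Nonempty → ∃ x ∈ M ∩ W, x ∈ O i) :
    ∀ W, IsOpen W → (M ∩ W).Nonempty → ∃ x ∈ M ∩ W, ∀ i ∈ s, x ∈ O i := by
  classical
  induction s using Finset.induction_on with
  | empty => intro W _ ⟨x, hx⟩; exact ⟨x, hx, by simp⟩
  | insert a s _ ih =>
    intro W hW hne
    obtain ⟨x, hx, hxa⟩ := hd a (Finset.mem_insert_self a s) W hW hne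
    obtain ⟨y, hy, hys⟩ := ih (fun i hi => hO i (Finset.mem_insert_of_mem hi))
      (fun i hi => hd i (Finset.mem_insert_of_mem hi)) (W ∩ O a)
      (hW.inter (hO a (Finset.mem_insert_self a s))) ⟨x, hx.1, hx.2, hxa⟩
    refine ⟨y, ⟨hy.1, hy.2.1⟩, fun i hi => ?_⟩
    rcases Finset.mem_insert.1 hi with rfl | hi
    exacts [hy.2.2, hys i hi]

/-- If `q_i` vanished on an open piece, its differential would be zero on tangent vectors. But where
`q_i = 0`, the tangent projection of the `i`-th unit vector still has `i`-th coordinate `1`. -/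
theorem exists_mem_contactVariety_forall_fst_ne_zero (hJ0 : ∀ i, J i ≠ 0) (hκ : 0 < κ)
    {W : Set (Phase k l)} (hW : IsOpen W) (hne : (contactVariety J κ ∩ W).Nonempty) :
    ∃ p ∈ contactVariety J κ ∩ W, ∀ i, p.1 i ≠ 0 := by
  suffices hd : ∀ i ∈ Finset.univ, ∀ W : Set (Phase k l), IsOpen W →
      (contactVariety J κ ∩ W).Nonempty →
      ∃ x ∈ contactVariety J κ ∩ W, x ∈ {p : Phase k l | p.1 i ≠ 0} by
    obtain ⟨p, hp, h⟩ := exists_mem_forall_of_forall_dense Finset.univ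
      (fun i _ => isOpen_ne_fun (by fun_prop) continuous_const) hd W hW hne
    exact ⟨p, hp, fun i => h i (Finset.mem_univ i)⟩
  rintro i - W hW ⟨p, hp⟩
  by_contra! hcon
  have hz : ∀ x ∈ contactVariety J κ ∩ W, x.1 i = 0 := fun x hx => by
    by_contra h; exact hcon x hx h
  have hL := lagrangian_ne_zero hκ hp.1
  have hK := hp.1.2.2.1
  have hLd : ip (J * p.2) p.1 = lagrangian J p := by rw [lagrangian, ip_comm]
  let e : Fin (k + l) → ℝ := Pi.single i 1
  let w : Phase k l := (e - (ip p.1 e / integralK J p) • (J⁻¹ * p.2) -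
      (ip (J * p.2) e / lagrangian J p) • p.1, 0)
  have hw : w ∈ tangentAt (contactVariety J κ) p := by
    refine ((mem_horizontalAt_iff (J := J) hκ hp.1 w).2 ?_).1
    simp only [w, ip_sub_right, ip_smul_right, ip_inv_mul_eq_integralK', ip_mul_inv_mul hJ0,
      hp.1.1, hp.1.2.1, hLd, ip_zero_right]
    refine ⟨by field_simp; ring, trivial, by field_simp; ring, trivial⟩
  rw [← tangentAt_inter_open hW hp.2] at hw
  let π : Phase k l →L[ℝ] ℝ :=
    (ContinuousLinearMap.proj i).comp (ContinuousLinearMap.fst ℝ (Fin (k + l) → ℝ) _)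
  have h1 := fderivWithin_apply_eq_zero_of_const hp π.hasFDerivAt.hasFDerivWithinAt hz hw
  have hpi : p.1 i = 0 := hz p hp
  have h2 : π w = 1 := by
    simp [π, w, e, ip_single, hpi]
  rw [h1] at h2
  exact zero_ne_one h2

/-- The slice of `M_κ` over `q`. -/
def slice (J : Fin (k + l) → ℝ) (κ : ℝ) (q : Fin (k + l) → ℝ) : Set (Fin (k + l) → ℝ) :=
  {Q | (q, Q) ∈ contactVariety J κ}

theorem mem_tangentAt_slice_iff (hκ : 0 < κ) {q Q : Fin (k + l) → ℝ}
    (hQ : Q ∈ slice J κ q) (w : Fin (k + l) → ℝ) :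
    w ∈ tangentAt (slice J κ q) Q ↔ ip Q w = 0 ∧ ip (J * q) w = 0 := by
  have hp : (q, Q) ∈ contactVariety J κ := hQ
  have hL := lagrangian_ne_zero hκ hp
  have hK := hp.2.2.1
  obtain ⟨W, hWo, hpW, hMW⟩ := contactVariety_local_levelSet hκ hp
  let h : Fin 2 → (Fin (k + l) → ℝ) → ℝ := ![fun Q => ip Q Q, fun Q => ip (J * q) Q]
  have hh : ∀ i, ContDiff ℝ ∞ (h i) := by
    intro i
    fin_cases i
    · exact contDiff_ip contDiff_id contDiff_id
    · exact contDiff_ip contDiff_const contDiff_id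
  have d0 : ∀ w, fderiv ℝ (h 0) Q w = 2 * ip Q w := fun w => by
    refine fderiv_apply_of_hasDerivAt_line ((hh 0).differentiable (by simp) Q) ?_
    convert! hasDerivAt_ip_line Q Q w w using 1
    rw [ip_comm w]; ring
  have d1 : ∀ w, fderiv ℝ (h 1) Q w = ip (J * q) w := fun w => by
    refine fderiv_apply_of_hasDerivAt_line ((hh 1).differentiable (by simp) Q) ?_
    convert! hasDerivAt_ip_line (J * q) Q 0 w using 1
    · simp [h]
    · rw [ip_zero_left, zero_add]
  have hL' : ∀ Q', lagrangian J (q, Q') = ip (J * q) Q' := fun Q' => by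
    rw [lagrangian, ip_mul_left]
  have hK' : ip Q (J⁻¹ * q) = integralK J (q, Q) := ip_inv_mul_eq_integralK (p := (q, Q))
  have hli : LinearIndependent ℝ fun i => fderiv ℝ (h i) Q := by
    rw [Fintype.linearIndependent_iff]
    intro g hg
    have key : ∀ w, g 0 * (2 * ip Q w) + g 1 * ip (J * q) w = 0 := by
      intro w
      have := congrArg (fun L => L w) hg
      simpa [Fin.sum_univ_two, d0, d1] using this
    have g1 : g 1 = 0 := by
      have := key Q
      rw [hp.2.1, ← hL'] at this
      simp only [mul_zero, zero_add] at this
      exact (mul_eq_zero.1 this).resolve_right hL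
    have g0 : g 0 = 0 := by
      have := key (J⁻¹ * q)
      rw [hK', g1, zero_mul, add_zero] at this
      exact (mul_eq_zero.1 this).resolve_right (mul_ne_zero two_ne_zero hK)
    intro i
    fin_cases i
    exacts [g0, g1]
  have hcont : Continuous fun Q' : Fin (k + l) → ℝ => ((q, Q') : Phase k l) := by fun_prop
  have hlev : slice J κ q ∩ {Q' | (q, Q') ∈ W} =
      {Q' ∈ {Q' | (q, Q') ∈ W} | ∀ i, h i Q' = h i Q} := by
    ext Q'
    have := Set.ext_iff.1 hMW (q, Q')
    simp only [Set.mem_inter_iff, Set.mem_ofPred_eq, Fin.forall_fin_succ, IsEmpty.forall_iff,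
      and_true] at this ⊢
    rw [and_comm]
    refine and_congr_right fun hQ'W => ?_
    have h3 : ((q, Q') ∈ contactVariety J κ) ↔
        (ip q q = ip q q ∧ ip Q' Q' = ip Q Q ∧ lagrangian J (q, Q') = lagrangian J (q, Q)) := by
      constructor
      · intro h; exact (this.1 ⟨h, hQ'W⟩).2
      · intro h; exact (this.2 ⟨hQ'W, h⟩).1
    rw [hL', hL'] at h3
    change (q, Q') ∈ contactVariety J κ ↔ ip Q' Q' = ip Q Q ∧ ip (J * q) Q' = ip (J * q) Q
    rw [h3]; simp
  rw [mem_tangentAt_iff_of_levelSet hh hQ ((hWo.preimage hcont).mem_nhds hpW) hlev hli]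
  simp only [Fin.forall_fin_two, d0, d1, mul_eq_zero, OfNat.ofNat_ne_zero, false_or]

theorem aeval_numPoly (w : Fin (k + l) → ℝ) (r : ℂ) :
    aeval r (numPoly J w) = ∑ i, ((sgn k l i * w i : ℝ) : ℂ) * aeval r (nodePoly J i) := by
  rw [numPoly, map_sum]
  exact Finset.sum_congr rfl fun i _ => by rw [map_mul, aeval_C]; rfl

/-- The node polynomials vanish only at nodes, and with all `w i` nonzero no node is a root of the
numerator. -/
theorem aeval_nodePoly_ne_zero {w : Fin (k + l) → ℝ} {r : ℂ}
    (hJ : ∀ i j, i ≠ j → J i ^ 2 ≠ J j ^ 2) (hw : ∀ i, w i ≠ 0)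
    (hr : aeval r (numPoly J w) = 0) (i : Fin (k + l)) : aeval r (nodePoly J i) ≠ 0 := by
  have hnode : ∀ j, r ≠ ((J j ^ 2 : ℝ) : ℂ) := by
    rintro j rfl
    have h1 : aeval ((J j ^ 2 : ℝ) : ℂ) (numPoly J w) =
        (((numPoly J w).eval (J j ^ 2) : ℝ) : ℂ) :=
      aeval_algebraMap_apply_eq_algebraMap_eval (A := ℂ) (J j ^ 2) (numPoly J w)
    rw [h1, Complex.ofReal_eq_zero, eval_numPoly_node] at hr
    exact mul_ne_zero (mul_ne_zero (sgn_ne_zero j) (hw j)) (eval_nodePoly_self_ne_zero hJ j) hr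
  rw [nodePoly, Lagrange.nodal_eq, map_prod]
  refine Finset.prod_ne_zero_iff.2 fun j _ => ?_
  rw [map_sub, aeval_X, aeval_C]
  exact sub_ne_zero.2 (hnode j)

/-- For `n = 2` the numerator has degree at most one with leading coefficient `⟨q,q⟩ = 0`, so it is
a nonzero constant without roots. This settles the case in which the slices have dimension zero. -/
theorem three_le_of_aeval_numPoly_eq_zero {q : Fin (k + l) → ℝ} {r : ℂ} (hn : 2 ≤ k + l)
    (hJ : ∀ i j, i ≠ j → J i ^ 2 ≠ J j ^ 2) (hq : ∀ i, q i ≠ 0) (hqq : ip q q = 0)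
    (hr : aeval r (numPoly J (q * q)) = 0) : 3 ≤ k + l := by
  by_contra hlt
  have h2 : k + l - 1 = 1 := by omega
  have hc : (numPoly J (q * q)).coeff 1 = 0 := by
    have := coeff_numPoly (J := J) (q * q)
    rw [h2] at this
    rw [this, ← hqq, ip]
    exact Finset.sum_congr rfl fun i _ => by simp; ring
  have hd : (numPoly J (q * q)).natDegree = 0 := by
    have h3 := natDegree_numPoly_le (J := J) (q * q)
    rw [h2] at h3
    by_contra h0
    have h4 : (numPoly J (q * q)).natDegree = 1 := by omega
    have h5 : numPoly J (q * q) ≠ 0 := by intro h; rw [h] at h4; simp at h4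
    exact leadingCoeff_ne_zero.2 h5 (by rw [leadingCoeff, h4, hc])
  obtain ⟨c, hcu⟩ := natDegree_eq_zero.1 hd
  rw [← hcu, aeval_C] at hr
  have hc0 : c = 0 := by
    have : ((c : ℝ) : ℂ) = 0 := hr
    exact_mod_cast this
  have hne := eval_numPoly_node (J := J) (q * q) (⟨0, by omega⟩ : Fin (k + l))
  rw [← hcu, hc0] at hne
  simp only [map_zero, eval_zero] at hne
  exact mul_ne_zero (mul_ne_zero (sgn_ne_zero _) (mul_ne_zero (hq _) (hq _)))
    (eval_nodePoly_self_ne_zero hJ _) hne.symm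

/-- A nonzero complex linear form does not vanish on an open subset of a slice. -/
theorem exists_mem_slice_sum_mul_ne_zero (hn : 3 ≤ k + l) (hJ0 : ∀ i, J i ≠ 0) (hκ : 0 < κ)
    {q : Fin (k + l) → ℝ} (β : Fin (k + l) → ℂ) (hβ : β ≠ 0) {W : Set (Fin (k + l) → ℝ)}
    (hW : IsOpen W) (hne : (slice J κ q ∩ W).Nonempty) :
    ∃ Q ∈ slice J κ q ∩ W, ∑ i, β i * (Q i : ℂ) ≠ 0 := by
  by_contra! hcon
  let B : (Fin (k + l) → ℝ) →ₗ[ℝ] ℂ :=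
    { toFun := fun Q => ∑ i, β i * (Q i : ℂ)
      map_add' := fun x y => by
        rw [← Finset.sum_add_distrib]
        exact Finset.sum_congr rfl fun i _ => by push_cast [Pi.add_apply]; ring
      map_smul' := fun c x => by
        simp only [Pi.smul_apply, smul_eq_mul, Complex.ofReal_mul, RingHom.id_apply,
          Complex.real_smul, Finset.mul_sum]
        exact Finset.sum_congr rfl fun i _ => by ring }
  have hBs : ∀ i, B (Pi.single i 1) = β i := by
    intro i
    change ∑ j, β j * (((Pi.single i 1 : Fin (k + l) → ℝ) j : ℝ) : ℂ) = β i
    rw [Finset.sum_eq_single i]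
    · simp
    · intro j _ hj; simp [hj]
    · simp
  -- on the slice, `β` is proportional to `τ Q`
  have hprop : ∀ Q ∈ slice J κ q ∩ W, ∀ w,
      B w = (ip Q w : ℂ) * (B (J⁻¹ * q) / (integralK J (q, Q) : ℂ)) := by
    intro Q hQ w
    have hp : (q, Q) ∈ contactVariety J κ := hQ.1
    have hL := lagrangian_ne_zero hκ hp
    have hK := hp.2.2.1
    have hqq : ip q q = 0 := hp.1
    have hQQ : ip Q Q = 0 := hp.2.1
    have hLd : ip (J * q) Q = lagrangian J (q, Q) := by rw [lagrangian, ip_mul_left]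
    have hKd : ip Q (J⁻¹ * q) = integralK J (q, Q) := ip_inv_mul_eq_integralK (p := (q, Q))
    have ht : w - (ip Q w / integralK J (q, Q)) • (J⁻¹ * q) -
        (ip (J * q) w / lagrangian J (q, Q)) • Q ∈ tangentAt (slice J κ q) Q := by
      rw [mem_tangentAt_slice_iff hκ hQ.1]
      simp only [ip_sub_right, ip_smul_right, hKd, hQQ, ip_mul_inv_mul hJ0, hqq, hLd]
      exact ⟨by field_simp; ring, by field_simp; ring⟩
    rw [← tangentAt_inter_open hW hQ.2] at ht
    have h1 := fderivWithin_apply_eq_zero_of_const hQ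
      (LinearMap.toContinuousLinearMap B).hasFDerivAt.hasFDerivWithinAt hcon ht
    change B _ = 0 at h1
    have h2 : B Q = 0 := hcon Q hQ
    rw [map_sub, map_sub, map_smul, map_smul, h2, smul_zero, sub_zero, sub_eq_zero] at h1
    rw [h1, Complex.real_smul]
    push_cast
    ring
  obtain ⟨Q₀, hQ₀⟩ := hne
  have hp₀ : (q, Q₀) ∈ contactVariety J κ := hQ₀.1
  have hL₀ := lagrangian_ne_zero hκ hp₀
  -- the slice is locally the single point `Q₀`
  have hWo : IsOpen (W ∩ {Q | 0 < ip (J * q) Q * lagrangian J (q, Q₀)}) := by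
    refine hW.inter (isOpen_lt continuous_const ?_)
    unfold ip
    fun_prop
  have hQ₀' : Q₀ ∈ W ∩ {Q | 0 < ip (J * q) Q * lagrangian J (q, Q₀)} := by
    refine ⟨hQ₀.2, ?_⟩
    have : ip (J * q) Q₀ = lagrangian J (q, Q₀) := by rw [lagrangian, ip_mul_left]
    rw [Set.mem_ofPred_eq, this]
    exact mul_self_pos.2 hL₀
  have hsingle : ∀ Q ∈ slice J κ q ∩ (W ∩ {Q | 0 < ip (J * q) Q * lagrangian J (q, Q₀)}),
      Q = Q₀ := by
    rintro Q ⟨hQs, hQW, hpos⟩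
    have hp : (q, Q) ∈ contactVariety J κ := hQs
    have hLe : ip (J * q) Q = ip (J * q) Q₀ := by
      have e1 : lagrangian J (q, Q) = ip (J * q) Q := by rw [lagrangian, ip_mul_left]
      have e2 : lagrangian J (q, Q₀) = ip (J * q) Q₀ := by rw [lagrangian, ip_mul_left]
      rw [Set.mem_ofPred_eq, e2] at hpos
      rcases hp.2.2.2 with h | h <;> rcases hp₀.2.2.2 with h' | h' <;> rw [e1] at h <;>
        rw [e2] at h' <;> rw [h, h'] at hpos ⊢ <;> nlinarith
    set t := B (J⁻¹ * q) / (integralK J (q, Q) : ℂ) with ht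
    set t₀ := B (J⁻¹ * q) / (integralK J (q, Q₀) : ℂ) with ht₀
    have h1 := hprop Q ⟨hQs, hQW⟩
    have h2 := hprop Q₀ hQ₀
    have hL' : (ip (J * q) Q₀ : ℂ) ≠ 0 := by
      have : ip (J * q) Q₀ = lagrangian J (q, Q₀) := by rw [lagrangian, ip_mul_left]
      rw [this]; exact_mod_cast hL₀
    -- Testing with `w = Jq` fixes the proportionality factor, because `⟨Q, Jq⟩ = L` has the same
    -- value at `Q` and `Q₀`.
    have htt : t = t₀ := by
      have e1 := h1 (J * q)
      have e2 := h2 (J * q)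
      rw [ip_comm, hLe] at e1
      rw [ip_comm] at e2
      exact mul_left_cancel₀ hL' (e1.symm.trans e2)
    have ht0 : t₀ ≠ 0 := by
      intro h
      apply hβ
      funext i
      rw [← hBs, h2, ← ht₀, h, mul_zero]
      rfl
    have h3 : Q - Q₀ = 0 := by
      refine eq_zero_of_ip_eq_zero fun w => ?_
      have e1 := h1 w
      rw [← ht, htt, h2 w, ← ht₀] at e1
      have e2 := mul_right_cancel₀ ht0 e1
      rw [ip_sub_left, sub_eq_zero]
      exact_mod_cast e2.symm
    exact sub_eq_zero.1 h3
  -- but the slice has positive dimension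
  let F : (Fin (k + l) → ℝ) →ₗ[ℝ] ℝ × ℝ :=
    { toFun := fun w => (ip Q₀ w, ip (J * q) w)
      map_add' := fun x y => by simp [ip_add_right]
      map_smul' := fun c x => by simp [ip_smul_right] }
  have hFk : LinearMap.ker F ≠ ⊥ := by
    intro h
    have h1 := LinearMap.finrank_le_finrank_of_injective (LinearMap.ker_eq_bot.1 h)
    rw [Module.finrank_fin_fun, Module.finrank_prod, Module.finrank_self] at h1
    omega
  obtain ⟨w, hw, hw0⟩ := Submodule.exists_mem_ne_zero_of_ne_bot hFk
  have hwt : w ∈ tangentAt (slice J κ q) Q₀ := by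
    rw [mem_tangentAt_slice_iff hκ hQ₀.1]
    exact ⟨congrArg Prod.fst (LinearMap.mem_ker.1 hw), congrArg Prod.snd (LinearMap.mem_ker.1 hw)⟩
  rw [← tangentAt_inter_open hWo hQ₀'] at hwt
  have h1 := fderivWithin_apply_eq_zero_of_const (Set.mem_inter hQ₀.1 hQ₀')
    (hasFDerivAt_id Q₀).hasFDerivWithinAt hsingle hwt
  exact hw0 h1

/-- With all `q_i ≠ 0` fixed, the first numerator has finitely many complex roots. At each of them
the second numerator is a nonzero complex linear form in `Q`, so `Q` can be moved in the slice to
avoid all common roots. -/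
theorem exists_mem_contactVariety_isCoprime (hn : 2 ≤ k + l) (hJ0 : ∀ i, J i ≠ 0)
    (hJ : ∀ i j, i ≠ j → J i ^ 2 ≠ J j ^ 2) (hκ : 0 < κ) {W : Set (Phase k l)} (hW : IsOpen W)
    (hne : (contactVariety J κ ∩ W).Nonempty) :
    ∃ p ∈ contactVariety J κ ∩ W,
      IsCoprime (numPoly J (p.1 * p.1)) (numPoly J (p.1 * (J * p.2))) := by
  obtain ⟨⟨q, Q⟩, hp, hq⟩ := exists_mem_contactVariety_forall_fst_ne_zero hJ0 hκ hW hne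
  have hcont : Continuous fun Q' : Fin (k + l) → ℝ => ((q, Q') : Phase k l) := by fun_prop
  have hq' : ∀ i, q i ≠ 0 := hq
  have hu0 : numPoly J (q * q) ≠ 0 := by
    intro h
    have h1 := eval_numPoly_node (J := J) (q * q) (⟨0, by omega⟩ : Fin (k + l))
    rw [h, eval_zero] at h1
    exact mul_ne_zero (mul_ne_zero (sgn_ne_zero _) (mul_ne_zero (hq' _) (hq' _)))
      (eval_nodePoly_self_ne_zero hJ _) h1.symm
  have hval : ∀ (r : ℂ) (Q' : Fin (k + l) → ℝ), aeval r (numPoly J (q * (J * Q'))) =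
      ∑ i, ((sgn k l i * q i * J i : ℝ) : ℂ) * aeval r (nodePoly J i) * (Q' i : ℂ) := by
    intro r Q'
    rw [aeval_numPoly]
    exact Finset.sum_congr rfl fun i _ => by push_cast [Pi.mul_apply]; ring
  obtain ⟨Q', hQ', hr⟩ := exists_mem_forall_of_forall_dense
    ((numPoly J (q * q)).aroots ℂ).toFinset
    (O := fun r => {Q' | aeval r (numPoly J (q * (J * Q'))) ≠ 0}) (M := slice J κ q)
    (fun r _ => by
      simp only [hval]
      exact isOpen_ne_fun (by fun_prop) continuous_const)
    (fun r hr V hV hVne => by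
      rw [Multiset.mem_toFinset, mem_aroots] at hr
      have h3 := three_le_of_aeval_numPoly_eq_zero hn hJ hq' hp.1.1 hr.2
      simp only [Set.mem_ofPred_eq, hval]
      refine exists_mem_slice_sum_mul_ne_zero h3 hJ0 hκ _ ?_ hV hVne
      intro h
      have h4 := congrFun h ⟨0, by omega⟩
      refine mul_ne_zero ?_ (aeval_nodePoly_ne_zero hJ (fun i => mul_ne_zero (hq' i) (hq' i))
        hr.2 _) h4
      exact_mod_cast mul_ne_zero (mul_ne_zero (sgn_ne_zero _) (hq' _)) (hJ0 _))
    _ (hW.preimage hcont) ⟨Q, hp.1, hp.2⟩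
  refine ⟨(q, Q'), ⟨hQ'.1, hQ'.2⟩, ?_⟩
  rw [isCoprime_iff_aeval_ne_zero_of_isAlgClosed ℝ ℂ]
  intro r
  by_cases h : aeval r (numPoly J (q * q)) = 0
  · refine Or.inr (hr r ?_)
    rw [Multiset.mem_toFinset, mem_aroots]
    exact ⟨hu0, h⟩
  · exact Or.inl h

variable {i₀ i₁ : Fin (k + l)} {S : Finset (Fin (k + l))}

theorem exists_mem_regularSet (hn : 2 ≤ k + l) (hJ0 : ∀ i, J i ≠ 0)
    (hJ : ∀ i j, i ≠ j → J i ^ 2 ≠ J j ^ 2) (hκ : 0 < κ) (hi : i₀ ≠ i₁)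
    (hS : ∀ i, i ∈ S ↔ i ≠ i₀ ∧ i ≠ i₁) {W : Set (Phase k l)} (hW : IsOpen W)
    (hne : (contactVariety J κ ∩ W).Nonempty) :
    ∃ p ∈ contactVariety J κ ∩ W, LinearIndependent ℝ fun i => fderiv ℝ (frame J S i) p := by
  obtain ⟨p, hp, hcop⟩ := exists_mem_contactVariety_isCoprime hn hJ0 hJ hκ hW hne
  exact ⟨p, hp, linearIndependent_frame_of_isCoprime hJ0 hJ hκ hi hS hp.1 hcop⟩

open MeasureTheory in
theorem hausdorffMeasure_diff_regularSet (hn : 2 ≤ k + l) (hJ0 : ∀ i, J i ≠ 0)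
    (hJ : ∀ i j, i ≠ j → J i ^ 2 ≠ J j ^ 2) (hκ : 0 < κ) (hi : i₀ ≠ i₁)
    (hS : ∀ i, i ∈ S ↔ i ≠ i₀ ∧ i ≠ i₁) :
    μH[((2 * (k + l) - 3 : ℕ) : ℝ)] (contactVariety J κ \ regularSet J κ) = 0 := by
  classical
  refine measure_null_of_locally_null _ fun p hp => ?_
  obtain ⟨W, hWo, hpW, hMW⟩ := contactVariety_local_levelSet hκ hp.1
  obtain ⟨V, hV, hnull⟩ := exists_nhds_hausdorffMeasure_zeros_eq_zero (d := 2 * (k + l) - 3)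
    (h := constraint J) contDiff_constraint (hWo.mem_nhds hpW) hMW
    (linearIndependent_fderiv_constraint hκ hp.1)
    (by rw [finrank_phase, Fintype.card_fin]; omega)
  obtain ⟨x, hx, hli⟩ := exists_mem_regularSet hn hJ0 hJ hκ hi hS isOpen_interior
    ⟨p, hp.1, mem_interior_iff_mem_nhds.2 hV⟩
  have hs := surjective_pi_of_linearIndependent hli
  -- Vectors dual to the differentials at one regular point `x`. The resulting minor `g` is analytic
  -- with `g x = 1`, and wherever it is nonzero the differentials are independent.
  choose w hw using fun b : Fin 3 ⊕ S => hs (Pi.single b 1)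
  let g : Phase k l → ℝ := fun y => Matrix.det
    (Matrix.of fun a b : Fin 3 ⊕ S => fderiv ℝ (frame J S a) y (w b))
  have hg : ContDiff ℝ ω g := by
    have hfd : ∀ a, ContDiff ℝ ω (fderiv ℝ (frame J S a)) := fun a =>
      (contDiff_frame a).fderiv_right (m := ω) (by simp)
    simp only [g, Matrix.det_apply, Matrix.of_apply]
    refine ContDiff.sum fun σ _ => ContDiff.const_smul _ (contDiff_prod fun i _ => ?_)
    exact (hfd _).clm_apply contDiff_const
  have hgx : g x ≠ 0 := by
    have : (Matrix.of fun a b : Fin 3 ⊕ S => fderiv ℝ (frame J S a) x (w b)) = 1 := by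
      ext a b
      have := congrFun (hw b) a
      rw [Matrix.one_apply]
      simpa [Pi.single_apply] using this
    simp only [g, this, Matrix.det_one]
    exact one_ne_zero
  have h0 := hnull g hg ⟨x, ⟨hx.1, interior_subset hx.2⟩, hgx⟩
  refine ⟨_, inter_mem_nhdsWithin _ hV, measure_mono_null ?_ h0⟩
  rintro y ⟨⟨hyM, hyr⟩, hyV⟩
  refine ⟨⟨hyM, hyV⟩, ?_⟩
  by_contra hgy
  apply hyr
  rw [regularSet_eq hJ hκ hi hS]
  refine ⟨hyM, ?_⟩
  rw [Set.mem_ofPred_eq, Fintype.linearIndependent_iff]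
  intro c hc
  have h1 : Matrix.vecMul c (Matrix.of fun a b : Fin 3 ⊕ S => fderiv ℝ (frame J S a) y (w b)) =
      0 := by
    funext b
    have := congrArg (fun L => L (w b)) hc
    simpa [Matrix.vecMul, dotProduct, sum_apply] using this
  exact congrFun (Matrix.eq_zero_of_vecMul_eq_zero hgy h1)

end Density

end HeisenbergContact
end

noncomputable section
namespace HeisenbergContact

/-! ### Dimensions of kernels. -/

section KernelDimension

variable {E : Type*} [NormedAddCommGroup E] [NormedSpace ℝ E] [FiniteDimensional ℝ E]

theorem finrank_ker_pi_add_card {ι : Type*} [Fintype ι] {L : ι → E →L[ℝ] ℝ}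
    (hL : LinearIndependent ℝ L) :
    Module.finrank ℝ (LinearMap.ker (ContinuousLinearMap.pi L).toLinearMap) + Fintype.card ι =
      Module.finrank ℝ E := by
  have h := LinearMap.finrank_range_add_finrank_ker (ContinuousLinearMap.pi L).toLinearMap
  rw [LinearMap.range_eq_top.2 (surjective_pi_of_linearIndependent hL), finrank_top,
    Module.finrank_fintype_fun_eq_card] at h
  omega

theorem finrank_inf_ker_add_one {P : Submodule ℝ E} {φ : E →ₗ[ℝ] ℝ} {z : E} (hz : z ∈ P)
    (hφ : φ z ≠ 0) : Module.finrank ℝ ↥(P ⊓ LinearMap.ker φ) + 1 = Module.finrank ℝ P := by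
  have h := LinearMap.finrank_range_add_finrank_ker (φ.domRestrict P)
  have hr : LinearMap.range (φ.domRestrict P) = ⊤ :=
    LinearMap.range_eq_top.2 (LinearMap.surjective fun h0 => hφ (LinearMap.congr_fun h0 ⟨z, hz⟩))
  have hk : Module.finrank ℝ ↥(P ⊓ LinearMap.ker φ) =
      Module.finrank ℝ (LinearMap.ker (φ.domRestrict P)) := by
    rw [← Submodule.map_comap_subtype, Submodule.finrank_map_subtype_eq]
    rfl
  rw [hr, finrank_top, Module.finrank_self] at h
  omega

end KernelDimension

/-! ### Regular level sets and the pre-Legendrian distribution. -/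

variable {k l : ℕ} {J : Fin (k + l) → ℝ} {κ : ℝ} {p : Phase k l}
variable {i₀ i₁ : Fin (k + l)} {S : Finset (Fin (k + l))}

/-- On `M_κ` the relations read `∑ f_i = 0` and `∑ J_i² f_i = -κ²`, for either sign of `L`, so the
integrals outside `S` are determined by those in `S`. -/
theorem integralF_eq_of_forall_mem (hJ : ∀ i j, i ≠ j → J i ^ 2 ≠ J j ^ 2) (hi : i₀ ≠ i₁)
    (hS : ∀ i, i ∈ S ↔ i ≠ i₀ ∧ i ≠ i₁) (hp : p ∈ contactVariety J κ) {x : Phase k l}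
    (hx : x ∈ contactVariety J κ) (h : ∀ i ∈ S, integralF J i x = integralF J i p)
    (i : Fin (k + l)) : integralF J i x = integralF J i p := by
  have h1 := mem_span_of_two_relations (x := fun i => integralF J i x - integralF J i p)
    (a := fun i => J i ^ 2)
    (by rw [Finset.sum_sub_distrib, sum_integralF, sum_integralF, sub_zero])
    (by
      simp only [smul_eq_mul, mul_sub, Finset.sum_sub_distrib]
      rw [sum_sq_mul_integralF hJ, sum_sq_mul_integralF hJ, hx.1, hp.1, lagrangian_sq hx,
        lagrangian_sq hp]
      ring) (hJ _ _ hi) hS i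
  have h2 : Submodule.span ℝ (Set.range fun i : S => integralF J i x - integralF J i p) = ⊥ := by
    rw [Submodule.span_eq_bot]
    rintro _ ⟨i, rfl⟩
    exact sub_eq_zero.2 (h i i.2)
  rw [h2, Submodule.mem_bot] at h1
  exact sub_eq_zero.1 h1

theorem regularLevel_local_levelSet (hJ : ∀ i j, i ≠ j → J i ^ 2 ≠ J j ^ 2) (hκ : 0 < κ)
    (hi : i₀ ≠ i₁) (hS : ∀ i, i ∈ S ↔ i ≠ i₀ ∧ i ≠ i₁) {c : Fin (k + l) → ℝ}
    (hp : p ∈ regularLevel J κ c) : ∃ W, IsOpen W ∧ p ∈ W ∧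
      regularLevel J κ c ∩ W = {x ∈ W | ∀ i, frame J S i x = frame J S i p} := by
  obtain ⟨hpr, hpc⟩ := hp
  have hpr' := hpr
  rw [regularSet_eq hJ hκ hi hS] at hpr'
  obtain ⟨W, hWo, hpW, hMW⟩ := contactVariety_local_levelSet hκ hpr.1
  refine ⟨W ∩ {p | LinearIndependent ℝ fun i => fderiv ℝ (frame J S i) p},
    hWo.inter isOpen_setOf_linearIndependent_frame, ⟨hpW, hpr'.2⟩, ?_⟩
  ext x
  constructor
  · rintro ⟨⟨hxr, hxc⟩, hxW, hxl⟩
    refine ⟨⟨hxW, hxl⟩, ?_⟩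
    rintro (i | i)
    · exact (hMW.subset ⟨hxr.1, hxW⟩).2 i
    · exact (hxc i).trans (hpc i).symm
  · rintro ⟨⟨hxW, hxl⟩, hx⟩
    have hxM : x ∈ contactVariety J κ :=
      (hMW.superset ⟨hxW, fun i => hx (Sum.inl i)⟩).1
    refine ⟨⟨?_, fun i => ?_⟩, hxW, hxl⟩
    · rw [regularSet_eq hJ hκ hi hS]
      exact ⟨hxM, hxl⟩
    · rw [← hpc i]
      exact integralF_eq_of_forall_mem hJ hi hS hpr.1 hxM
        (fun i h => hx (Sum.inr ⟨i, h⟩)) i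

/-- The common kernel of the differentials of the functions `frame J S`. -/
def frameKer (J : Fin (k + l) → ℝ) (S : Finset (Fin (k + l))) (p : Phase k l) :
    Submodule ℝ (Phase k l) :=
  LinearMap.ker (ContinuousLinearMap.pi fun i => fderiv ℝ (frame J S i) p).toLinearMap

theorem mem_frameKer {v : Phase k l} :
    v ∈ frameKer J S p ↔ ∀ i, fderiv ℝ (frame J S i) p v = 0 :=
  funext_iff

theorem card_frame (hi : i₀ ≠ i₁) (hS : ∀ i, i ∈ S ↔ i ≠ i₀ ∧ i ≠ i₁) :
    Fintype.card (Fin 3 ⊕ S) = 3 + (k + l - 2) := by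
  rw [Fintype.card_sum, Fintype.card_fin, Fintype.card_coe, card_of_forall_mem_iff hi hS]

theorem finrank_frameKer (hn : 2 ≤ k + l) (hi : i₀ ≠ i₁)
    (hS : ∀ i, i ∈ S ↔ i ≠ i₀ ∧ i ≠ i₁)
    (hli : LinearIndependent ℝ fun i => fderiv ℝ (frame J S i) p) :
    Module.finrank ℝ (frameKer J S p) = k + l - 1 := by
  have h := finrank_ker_pi_add_card hli
  rw [card_frame hi hS, finrank_phase] at h
  rw [frameKer]
  omega

theorem isSmoothSubmanifold_regularLevel (hn : 2 ≤ k + l)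
    (hJ : ∀ i j, i ≠ j → J i ^ 2 ≠ J j ^ 2) (hκ : 0 < κ)
    (hi : i₀ ≠ i₁) (hS : ∀ i, i ∈ S ↔ i ≠ i₀ ∧ i ≠ i₁) (c : Fin (k + l) → ℝ) :
    IsSmoothSubmanifold (k + l - 1) (regularLevel J κ c) := by
  refine isSmoothSubmanifold_of_levelSet (h := frame J S)
    (fun i => (contDiff_frame i).of_le le_top) ?_
    (fun p hp => regularLevel_local_levelSet hJ hκ hi hS hp) fun p hp => ?_
  · rw [card_frame hi hS, finrank_phase]; omega
  · exact ((regularSet_eq hJ hκ hi hS).subset hp.1).2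

theorem tangentAt_regularLevel (hJ : ∀ i j, i ≠ j → J i ^ 2 ≠ J j ^ 2) (hκ : 0 < κ)
    (hi : i₀ ≠ i₁) (hS : ∀ i, i ∈ S ↔ i ≠ i₀ ∧ i ≠ i₁) {c : Fin (k + l) → ℝ}
    (hp : p ∈ regularLevel J κ c) : tangentAt (regularLevel J κ c) p = frameKer J S p := by
  obtain ⟨W, hWo, hpW, hMW⟩ := regularLevel_local_levelSet hJ hκ hi hS hp
  ext v
  rw [mem_frameKer]
  exact mem_tangentAt_iff_of_levelSet (fun i => (contDiff_frame i).of_le le_top) hp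
    (hWo.mem_nhds hpW) hMW ((regularSet_eq hJ hκ hi hS).subset hp.1).2 v

theorem frameKer_le_tangentAt (hκ : 0 < κ) (hp : p ∈ contactVariety J κ) :
    frameKer J S p ≤ tangentAt (contactVariety J κ) p := fun _ hv =>
  (mem_tangentAt_iff_constraint hκ hp _).2 fun i => mem_frameKer.1 hv (Sum.inl i)

theorem reebField_mem_frameKer (hJ0 : ∀ i, J i ≠ 0) (hκ : 0 < κ) (hp : p ∈ contactVariety J κ) :
    reebField J p ∈ frameKer J S p := by
  rw [mem_frameKer]
  rintro (i | i)
  · exact (mem_tangentAt_iff_constraint hκ hp _).1 (reebField_mem_tangentAt hκ hp) i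
  · exact (isInvariantQuadratic_integralF hJ0 i).fderiv_reebField p

theorem contactField_mem_frameKer (hJ0 : ∀ i, J i ≠ 0) (hJ : ∀ i j, i ≠ j → J i ^ 2 ≠ J j ^ 2)
    (hκ : 0 < κ) (hp : p ∈ contactVariety J κ) (i : Fin (k + l)) :
    contactField J (integralF J i) p ∈ frameKer J S p := by
  rw [mem_frameKer]
  rintro (j | j)
  · exact (mem_tangentAt_iff_constraint hκ hp _).1
      ((isInvariantQuadratic_integralF hJ0 i).contactField_mem_tangentAt hJ0 hκ hp) j
  · exact (isInvariantQuadratic_integralF hJ0 j).fderiv_contactField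
      (fderiv_integralF_hamField hJ0 hJ i j p)

/-- On tangent vectors, contraction with `ω` kills `Z` and sends the contact fields to `-df_i`,
which are independent; then `α` detects the coefficient of `Z`. -/
theorem linearIndependent_reebField_contactField (hJ0 : ∀ i, J i ≠ 0) (hκ : 0 < κ)
    (hp : p ∈ contactVariety J κ)
    (hli : LinearIndependent ℝ fun i => fderiv ℝ (frame J S i) p) :
    LinearIndependent ℝ (Sum.elim (fun _ : Unit => reebField J p)
      fun i : S => contactField J (integralF J i) p) := by
  rw [← linearIndependent_differentialOn_iff hκ hp] at hli
  rw [Fintype.linearIndependent_iff] at hli ⊢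
  intro g hg
  simp only [Fintype.sum_sum_type, Sum.elim_inl, Sum.elim_inr, Finset.univ_unique,
    Finset.sum_singleton] at hg
  have h1 : ∀ i : S, g (Sum.inr i) = 0 := by
    refine hli (fun i => g (Sum.inr i)) (LinearMap.ext fun v => ?_)
    have h2 := congrArg (fun u => omegaL J u v) hg
    simp only [map_add, map_sum, map_smul, add_apply, sum_apply, smul_apply, omegaL_apply,
      omega_reebField, fderiv_eq_zero_of_mem_tangentAt hκ hp v.2, smul_eq_mul, mul_zero,
      neg_zero, zero_add, IsInvariantQuadratic.omega_contactField_of_mem_tangentAt hJ0 hκ hp v.2,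
      map_zero, zero_apply, mul_neg, Finset.sum_neg_distrib, neg_eq_zero] at h2
    simpa only [LinearMap.sum_apply, LinearMap.smul_apply, differentialOn_apply, smul_eq_mul,
      LinearMap.zero_apply] using h2
  have h2 : g (Sum.inl ()) = 0 := by
    have h3 := congrArg (alpha J p) hg
    simpa [h1, alpha_reebField hκ hp] using h3
  rintro (i | i)
  exacts [h2, h1 i]

/-- The fields lie in the common kernel, and `1 + (n - 2)` of them are independent, which is its
full dimension. -/
theorem span_reebField_contactField (hn : 2 ≤ k + l) (hJ0 : ∀ i, J i ≠ 0)
    (hJ : ∀ i j, i ≠ j → J i ^ 2 ≠ J j ^ 2) (hκ : 0 < κ) (hi : i₀ ≠ i₁)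
    (hS : ∀ i, i ∈ S ↔ i ≠ i₀ ∧ i ≠ i₁) (hp : p ∈ contactVariety J κ)
    (hli : LinearIndependent ℝ fun i => fderiv ℝ (frame J S i) p) :
    Submodule.span ℝ (insert (reebField J p)
      (Set.range fun i => contactField J (integralF J i) p)) = frameKer J S p := by
  refine Submodule.eq_of_le_of_finrank_le (Submodule.span_le.2 ?_) ?_
  · rintro _ (rfl | ⟨i, rfl⟩)
    exacts [reebField_mem_frameKer hJ0 hκ hp, contactField_mem_frameKer hJ0 hJ hκ hp i]
  · have h := finrank_span_eq_card (linearIndependent_reebField_contactField hJ0 hκ hp hli)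
    rw [Fintype.card_sum, Fintype.card_unit, Fintype.card_coe, card_of_forall_mem_iff hi hS] at h
    rw [finrank_frameKer hn hi hS hli, show k + l - 1 = 1 + (k + l - 2) by omega, ← h]
    refine Submodule.finrank_mono (Submodule.span_mono ?_)
    rintro _ ⟨i | i, rfl⟩
    exacts [Or.inl rfl, Or.inr ⟨i, rfl⟩]

/-- The kernel is spanned by fields whose contraction with `ω` is, on tangent vectors, `0` or
`-df_i`; every `df_i` vanishes on it, including the two omitted ones, by the linear relations. -/
theorem omega_eq_zero_of_mem_frameKer (hn : 2 ≤ k + l) (hJ0 : ∀ i, J i ≠ 0)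
    (hJ : ∀ i j, i ≠ j → J i ^ 2 ≠ J j ^ 2) (hκ : 0 < κ) (hi : i₀ ≠ i₁)
    (hS : ∀ i, i ∈ S ↔ i ≠ i₀ ∧ i ≠ i₁) (hp : p ∈ contactVariety J κ)
    (hli : LinearIndependent ℝ fun i => fderiv ℝ (frame J S i) p) {u v : Phase k l}
    (hu : u ∈ frameKer J S p) (hv : v ∈ frameKer J S p) : omega J u v = 0 := by
  have hvT := frameKer_le_tangentAt hκ hp hv
  have hv0 : ∀ i, fderiv ℝ (integralF J i) p v = 0 := by
    intro i
    have h1 := mem_span_of_two_relations (x := fun i => fderiv ℝ (integralF J i) p v)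
      (a := fun i => J i ^ 2) (sum_fderiv_integralF p v)
      (by
        simp only [smul_eq_mul]
        rw [sum_sq_mul_fderiv_integralF hJ hp.1, fderiv_eq_zero_of_mem_tangentAt hκ hp hvT,
          ((mem_tangentAt_iff hκ hp v).1 hvT).1]
        ring) (hJ _ _ hi) hS i
    have h2 : Submodule.span ℝ (Set.range fun i : S => fderiv ℝ (integralF J i) p v) = ⊥ := by
      rw [Submodule.span_eq_bot]
      rintro _ ⟨i, rfl⟩
      exact mem_frameKer.1 hv (Sum.inr i)
    rwa [h2, Submodule.mem_bot] at h1
  have hle : frameKer J S p ≤ LinearMap.ker ((omegaL J).flip v).toLinearMap := by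
    rw [← span_reebField_contactField hn hJ0 hJ hκ hi hS hp hli, Submodule.span_le]
    rintro _ (rfl | ⟨i, rfl⟩)
    · change omega J _ v = 0
      rw [omega_reebField, fderiv_eq_zero_of_mem_tangentAt hκ hp hvT, mul_zero, neg_zero]
    · change omega J _ v = 0
      rw [IsInvariantQuadratic.omega_contactField_of_mem_tangentAt hJ0 hκ hp hvT, hv0, neg_zero]
  exact hle hu

theorem finrank_tangentAt_contactVariety (hκ : 0 < κ) (hp : p ∈ contactVariety J κ) :
    Module.finrank ℝ (tangentAt (contactVariety J κ) p) + 3 = 2 * (k + l) := by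
  have h := finrank_ker_pi_add_card (linearIndependent_fderiv_constraint hκ hp)
  have ht : tangentAt (contactVariety J κ) p = LinearMap.ker
      (ContinuousLinearMap.pi fun i => fderiv ℝ (constraint J i) p).toLinearMap := by
    ext v
    rw [mem_tangentAt_iff_constraint hκ hp, LinearMap.mem_ker]
    exact funext_iff.symm
  rw [Fintype.card_fin, finrank_phase, ← ht] at h
  exact h

theorem isPreLegendrian_frameKer (hn : 2 ≤ k + l) (hJ0 : ∀ i, J i ≠ 0)
    (hJ : ∀ i j, i ≠ j → J i ^ 2 ≠ J j ^ 2) (hκ : 0 < κ) (hi : i₀ ≠ i₁)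
    (hS : ∀ i, i ∈ S ↔ i ≠ i₀ ∧ i ≠ i₁) {D : Phase k l → Submodule ℝ (Phase k l)}
    (hD : ∀ p ∈ regularSet J κ, D p = frameKer J S p) :
    IsPreLegendrian (regularSet J κ) (alpha J) D := by
  have hli : ∀ p ∈ regularSet J κ, LinearIndependent ℝ fun i => fderiv ℝ (frame J S i) p :=
    fun p hp => ((regularSet_eq hJ hκ hi hS).subset hp).2
  have hT : ∀ p ∈ regularSet J κ,
      tangentAt (regularSet J κ) p = tangentAt (contactVariety J κ) p := by
    intro p hp
    rw [regularSet_eq hJ hκ hi hS]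
    exact tangentAt_inter_open isOpen_setOf_linearIndependent_frame (hli p hp)
  have hDT : ∀ p ∈ regularSet J κ, D p ≤ tangentAt (regularSet J κ) p := fun p hp => by
    rw [hD p hp, hT p hp]
    exact frameKer_le_tangentAt hκ hp.1
  have hZ : ∀ p ∈ regularSet J κ, reebField J p ∈ D p := fun p hp => by
    rw [hD p hp]
    exact reebField_mem_frameKer hJ0 hκ hp.1
  have hinf : ∀ p ∈ regularSet J κ, D p ⊓ horizontalAt (regularSet J κ) (alpha J) p =
      D p ⊓ LinearMap.ker (alpha J p).toLinearMap := fun p hp => by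
    rw [horizontalAt, ← inf_assoc, inf_eq_left.2 (hDT p hp)]
  have hα : ∀ p ∈ regularSet J κ, (alpha J p).toLinearMap (reebField J p) = 1 := fun p hp =>
    alpha_reebField hκ hp.1
  -- The distribution is a common kernel of exact forms, hence closed under brackets.
  have hinv : IsInvolutiveOn (regularSet J κ) D := by
    intro X Y hX hY hXD hYD p hp
    rw [hD p hp, mem_frameKer]
    intro i
    refine fderiv_apply_lieBracketWithin_eq_zero hp ((contDiff_frame i).of_le le_top)
      ((hX p hp).differentiableWithinAt (by simp)) ((hY p hp).differentiableWithinAt (by simp))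
      (hDT p hp (hXD p hp)) (hDT p hp (hYD p hp)) (fun x hx => ?_) (fun x hx => ?_)
    · exact mem_frameKer.1 (hD x hx ▸ hXD x hx) i
    · exact mem_frameKer.1 (hD x hx ▸ hYD x hx) i
  refine ⟨hDT, hinv, fun p hp => ?_, ?_, fun p hp u hu v hv => ?_, fun p hp => ?_⟩
  · refine le_antisymm (sup_le (hDT p hp) inf_le_left) fun v hv => ?_
    refine Submodule.mem_sup.2 ⟨alpha J p v • reebField J p, Submodule.smul_mem _ _ (hZ p hp),
      v - alpha J p v • reebField J p, ⟨?_, ?_⟩, add_sub_cancel _ _⟩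
    · exact Submodule.sub_mem _ hv (Submodule.smul_mem _ _ (hDT p hp (hZ p hp)))
    · change alpha J p _ = 0
      rw [map_sub, map_smul, alpha_reebField hκ hp.1, smul_eq_mul, mul_one, sub_self]
  · intro X Y hX hY hXD hYD p hp
    have h1 := hinv X Y hX hY (fun p hp => (hXD p hp).1) (fun p hp => (hYD p hp).1) p hp
    refine (hinf p hp).ge ⟨h1, ?_⟩
    have hXp := (hXD p hp).1
    have hYp := (hYD p hp).1
    rw [hD p hp] at hXp hYp
    have h2 := apply_lieBracketWithin (a := fun _ => 0) (b := fun _ => 0) hp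
      (differentiableAt_alpha J p)
      ((hX p hp).differentiableWithinAt (by simp)) ((hY p hp).differentiableWithinAt (by simp))
      (hDT p hp (hXD p hp).1) (hDT p hp (hYD p hp).1)
      (differentiableAt_const _) (differentiableAt_const _)
      (fun x hx => (hXD x hx).2.2) (fun x hx => (hYD x hx).2.2)
    -- For horizontal fields, `α` of the bracket is `-dα(X, Y)`, which vanishes because the kernel
    -- is isotropic.
    have h3 := omega_eq_zero_of_mem_frameKer hn hJ0 hJ hκ hi hS hp.1 (hli p hp) hYp hXp
    rw [← dForm_alpha J p, dForm_eq (differentiableAt_alpha J p)] at h3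
    change alpha J p _ = 0
    rw [h2, h3]
    simp
  · rw [dForm_alpha]
    rw [hD p hp] at hu hv
    exact omega_eq_zero_of_mem_frameKer hn hJ0 hJ hκ hi hS hp.1 (hli p hp) hu.1 hv.1
  -- Since `α(Z) = 1`, intersecting with `ker α` lowers each dimension by one: `n - 1` becomes `n -
  -- 2`, and `2n - 3` becomes `2n - 4`.
  · have h1 := finrank_inf_ker_add_one (hZ p hp) ((hα p hp).trans_ne one_ne_zero)
    have h2 := finrank_inf_ker_add_one (hDT p hp (hZ p hp)) ((hα p hp).trans_ne one_ne_zero)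
    have h3 := finrank_tangentAt_contactVariety hκ hp.1
    have h4 : Module.finrank ℝ (D p) = k + l - 1 := by
      rw [hD p hp, finrank_frameKer hn hi hS (hli p hp)]
    rw [← hT p hp] at h3
    rw [hinf p hp, horizontalAt]
    omega

theorem commute_of_eq_reebField_contactField (hJ0 : ∀ i, J i ≠ 0) (hJ : ∀ i j, i ≠ j → J i ^ 2 ≠ J j ^ 2)
    (hκ : 0 < κ) {Z : Phase k l → Phase k l} {Y : Fin (k + l) → Phase k l → Phase k l}
    (hZ : ∀ p ∈ contactVariety J κ, Z p = reebField J p)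
    (hY : ∀ i, ∀ p ∈ contactVariety J κ, Y i p = contactField J (integralF J i) p) :
    (∀ i, ∀ p ∈ contactVariety J κ, lieDerivFun (contactVariety J κ) Z (integralF J i) p = 0) ∧
    (∀ i, CommuteOn (contactVariety J κ) Z (Y i)) ∧
    (∀ i j, ∀ p ∈ contactVariety J κ,
      jacobiBracket (contactVariety J κ) Z (Y i) (integralF J i) (integralF J j) p = 0) ∧
    (∀ i j, CommuteOn (contactVariety J κ) (Y i) (Y j)) := by
  have hf := isInvariantQuadratic_integralF (J := J) hJ0
  have hLZ : ∀ i, ∀ p ∈ contactVariety J κ,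
      lieDerivFun (contactVariety J κ) Z (integralF J i) p = 0 := fun i p hp => by
    rw [lieDerivFun, hZ p hp, fderivWithin_apply_of_mem_tangentAt (differentiable_integralF i p)
      (reebField_mem_tangentAt hκ hp), (hf i).fderiv_reebField]
  refine ⟨hLZ, fun i p hp => ?_, fun i j p hp => ?_, fun i j p hp => ?_⟩
  · rw [VectorField.lieBracketWithin_congr' hZ (hY i) hp]
    exact lieBracketWithin_reebField_contactField hJ0 hκ hp (hf i)
  · rw [jacobiBracket, hLZ i p hp, mul_zero, sub_zero, lieDerivFun, hY i p hp,
      fderivWithin_apply_of_mem_tangentAt (differentiable_integralF j p)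
        ((hf i).contactField_mem_tangentAt hJ0 hκ hp),
      (hf j).fderiv_contactField (fderiv_integralF_hamField hJ0 hJ i j p)]
  · rw [VectorField.lieBracketWithin_congr' (hY i) (hY j) hp]
    exact lieBracketWithin_contactField_contactField hJ0 hκ hp (hf i) (hf j)
      (fderiv_integralF_hamField hJ0 hJ i j) (fderiv_integralF_hamField hJ0 hJ j i)

theorem contactVariety_subset_closure_regularSet (hn : 2 ≤ k + l) (hJ0 : ∀ i, J i ≠ 0)
    (hJ : ∀ i j, i ≠ j → J i ^ 2 ≠ J j ^ 2) (hκ : 0 < κ) (hi : i₀ ≠ i₁)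
    (hS : ∀ i, i ∈ S ↔ i ≠ i₀ ∧ i ≠ i₁) : contactVariety J κ ⊆ closure (regularSet J κ) := by
  intro p hp
  rw [mem_closure_iff]
  intro W hW hpW
  obtain ⟨x, hx, hli⟩ := exists_mem_regularSet hn hJ0 hJ hκ hi hS hW ⟨p, hp, hpW⟩
  exact ⟨x, hx.2, (regularSet_eq hJ hκ hi hS).superset ⟨hx.1, hli⟩⟩

end HeisenbergContact
end

/-! ### The main theorem. -/

open HeisenbergContact in
theorem theorem4 (k l : ℕ) (hk : 1 ≤ k) (hl : 1 ≤ l) (J : Fin (k + l) → ℝ)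
    (hJ0 : ∀ i, J i ≠ 0) (hJ : ∀ i j, i ≠ j → J i ^ 2 ≠ J j ^ 2) (κ : ℝ) (hκ : 0 < κ) :
    -- `(M_κ, α)` is a contact manifold of dimension `2n - 3`
    IsSmoothSubmanifold (2 * (k + l) - 3) (contactVariety J κ) ∧
    IsContactFormOn (contactVariety J κ) (alpha J) ∧
    -- `Φ` is a contact transformation with integrals `f_i`
    IsContactTransformation (contactVariety J κ) (alpha J) (mapSource J κ) (mapTarget J κ)
      (heisenbergMap J) ∧
    (∀ i, ∀ p ∈ mapSource J κ, integralF J i (heisenbergMap J p) = integralF J i p) ∧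
    -- the regular set is open and dense in `M_κ` and has full measure
    (∃ O, IsOpen O ∧ regularSet J κ = contactVariety J κ ∩ O) ∧
    contactVariety J κ ⊆ closure (regularSet J κ) ∧
    μH[((2 * (k + l) - 3 : ℕ) : ℝ)] (contactVariety J κ \ regularSet J κ) = 0 ∧
    -- `n - 2` of the integrals are independent there
    (∃ S : Finset (Fin (k + l)), S.card = k + l - 2 ∧ ∀ p ∈ regularSet J κ,
      LinearIndependent ℝ fun i : S => differentialOn (contactVariety J κ) (integralF J i) p) ∧
    -- the Reeb field and the contact Hamiltonian fields exist
    (∃ Z, IsReebField (contactVariety J κ) (alpha J) Z) ∧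
    (∀ i, ∃ Y, IsContactHamiltonianField (contactVariety J κ) (alpha J) (integralF J i) Y) ∧
    ∀ (Z : Phase k l → Phase k l) (Y : Fin (k + l) → Phase k l → Phase k l),
      IsReebField (contactVariety J κ) (alpha J) Z →
      (∀ i, IsContactHamiltonianField (contactVariety J κ) (alpha J) (integralF J i) (Y i)) →
      -- the integrals are invariant under the Reeb field, and all the fields commute
      (∀ i, ∀ p ∈ contactVariety J κ, lieDerivFun (contactVariety J κ) Z (integralF J i) p = 0) ∧
      (∀ i, CommuteOn (contactVariety J κ) Z (Y i)) ∧
      (∀ i j, ∀ p ∈ contactVariety J κ,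
        jacobiBracket (contactVariety J κ) Z (Y i) (integralF J i) (integralF J j) p = 0) ∧
      (∀ i j, CommuteOn (contactVariety J κ) (Y i) (Y j)) ∧
      -- the regular level sets are invariant `(n - 1)`-dimensional submanifolds, with tangent
      -- spaces spanned by `Z, Y_1, …, Y_n`
      (∀ c : Fin (k + l) → ℝ,
        IsSmoothSubmanifold (k + l - 1) (regularLevel J κ c) ∧
        Set.BijOn (heisenbergMap J) (regularLevel J κ c ∩ mapSource J κ)
          (regularLevel J κ c ∩ mapTarget J κ) ∧
        ∀ p ∈ regularLevel J κ c, tangentAt (regularLevel J κ c) p =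
          Submodule.span ℝ (insert (Z p) (Set.range fun i => Y i p))) ∧
      -- the distribution spanned by `Z, Y_1, …, Y_n` is pre-Legendrian of rank `n - 1`
      (∀ p ∈ regularSet J κ, Module.finrank ℝ
        ↥(Submodule.span ℝ (insert (Z p) (Set.range fun i => Y i p))) = k + l - 1) ∧
      IsPreLegendrian (regularSet J κ) (alpha J)
        (fun p => Submodule.span ℝ (insert (Z p) (Set.range fun i => Y i p))) := by
  have hn : 2 ≤ k + l := by omega
  have hi : (⟨0, by omega⟩ : Fin (k + l)) ≠ ⟨1, by omega⟩ := by simp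
  -- Any two distinct indices may be omitted; the first two are chosen.
  obtain ⟨S, hS⟩ : ∃ S : Finset (Fin (k + l)),
      ∀ i, i ∈ S ↔ i ≠ ⟨0, by omega⟩ ∧ i ≠ ⟨1, by omega⟩ :=
    ⟨(Finset.univ.erase ⟨1, by omega⟩).erase ⟨0, by omega⟩, fun i => by simp⟩
  have hf := isInvariantQuadratic_integralF (J := J) hJ0
  refine ⟨isSmoothSubmanifold_contactVariety hn hκ, isContactFormOn_contactVariety hJ0 hκ,
    isContactTransformation_heisenbergMap hJ0 hκ,
    fun i p hp => integralF_heisenbergMap hJ0 hJ i hp.1,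
    ⟨_, isOpen_setOf_linearIndependent_frame, regularSet_eq hJ hκ hi hS⟩,
    contactVariety_subset_closure_regularSet hn hJ0 hJ hκ hi hS,
    hausdorffMeasure_diff_regularSet hn hJ0 hJ hκ hi hS,
    ⟨S, card_of_forall_mem_iff hi hS,
      fun p hp => (rankAt_eq_iff_linearIndependent hJ hκ hi hS hp.1).1 hp.2⟩,
    ⟨_, isReebField_reebField hκ⟩, fun i => ⟨_, (hf i).isContactHamiltonianField hJ0 hκ⟩,
    fun Z Y hZ hY => ?_⟩
  -- Uniqueness replaces arbitrary Reeb and contact Hamiltonian fields on `M_κ` by the explicit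
  -- ones.
  have hZe : ∀ p ∈ contactVariety J κ, Z p = reebField J p := fun p hp =>
    hZ.eq_reebField hJ0 hκ hp
  have hYe : ∀ i, ∀ p ∈ contactVariety J κ, Y i p = contactField J (integralF J i) p :=
    fun i p hp => (hf i).eq_contactField hJ0 hκ (hY i) hp
  have hli : ∀ p ∈ regularSet J κ, LinearIndependent ℝ fun i => fderiv ℝ (frame J S i) p :=
    fun p hp => ((regularSet_eq hJ hκ hi hS).subset hp).2
  have hD : ∀ p ∈ regularSet J κ,
      Submodule.span ℝ (insert (Z p) (Set.range fun i => Y i p)) = frameKer J S p := by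
    intro p hp
    rw [hZe p hp.1, funext fun i => hYe i p hp.1]
    exact span_reebField_contactField hn hJ0 hJ hκ hi hS hp.1 (hli p hp)
  obtain ⟨h1, h2, h3, h4⟩ := commute_of_eq_reebField_contactField hJ0 hJ hκ hZe hYe
  refine ⟨h1, h2, h3, h4, fun c => ⟨isSmoothSubmanifold_regularLevel hn hJ hκ hi hS c,
    bijOn_regularLevel hJ0 hJ c, fun p hp => ?_⟩, fun p hp => ?_,
    isPreLegendrian_frameKer hn hJ0 hJ hκ hi hS hD⟩
  · rw [hD p hp.1, tangentAt_regularLevel hJ hκ hi hS hp]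
  · rw [hD p hp, finrank_frameKer hn hi hS (hli p hp)]
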